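/- **Conventions.** All manifolds are smooth, Hausdorff, second countable and finite dimensional. For a $\mathbb Z$-graded real vector space $\mathsf L$ let $\mathsf L[-1]$ be $\mathsf L$ with all degrees lowered by one. An $L_\infty$-algebra is a graded vector space $\mathsf L$ with a degree one coderivation $\mathcal D$, $\mathcal D^2=0$, of the reduced symmetric coalgebra $\bar S(\mathsf L[-1])$; it is determined by its components $D_k:(\mathsf L[-1])^{\odot k}\to\mathsf L[-1]$, $k\ge 1$. Its higher products are $\mu_k=\varepsilon_kD_k$, with $\varepsilon_1=1$ and $\varepsilon_k=(-1)^{(k-2)(k-3)/2}$ for $k\ge2$. A Lie $n$-algebra is an $L_\infty$-algebra concentrated in degrees $1-n,\dots,0$. A (weak) morphism is a morphism $\Psi$ of graded coalgebras commuting with the codifferentials, given by its components $\Psi_k$; it is a (weak) isomorphism if $\Psi_1$ is bijective. A sub Lie $n$-algebra is a graded subspace closed under all higher products. Let $n\ge1$ and let $(M,\varpi)$ be an $n$-plectic manifold: $\varpi$ is a closed $(n+1)$-form on $M$ such that $\iota_X\varpi=0$ implies $X=0$ for vector fields $X$. A form $\alpha\in\Omega^{n-1}(M)$ is Hamiltonian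 if $d\alpha=-\iota_{X_\alpha}\varpi$ for a (unique) vector field $X_\alpha$; write $\Omega^{n-1}_{\rm Ham}(M)$ for the space of these forms. *The algebra of local observables* (shlalo) $\mathsf L_M$ is the complex $$C^\infty(M)\xrightarrow{d}\Omega^1(M)\xrightarrow{d}\cdots\xrightarrow{d}\Omega^{n-2}(M)\xrightarrow{d}\Omega^{n-1}_{\rm Ham}(M)$$ in degrees $1-n,\dots,0$, with $\mu_1=d$ and, for $k\ge2$, $\mu_k(\alpha_1,\dots,\alpha_k)=(-1)^{\binom{k+1}2}\iota_{X_{\alpha_1}}\cdots\iota_{X_{\alpha_k}}\varpi$ for $\alpha_i\in\Omega^{n-1}_{\rm Ham}(M)$; all other products vanish. *The algebra of the twisted Vinogradov algebroid* $TM\oplus\wedge^{n-1}T^*M$ is $$\mathsf L_{\mathcal V_n}=C^\infty(M)\oplus\Omega^1(M)\oplus\cdots\oplus\Omega^{n-2}(M)\oplus\bigl(\mathfrak X(M)\oplus\Omega^{n-1}(M)\bigr)$$ in degrees $1-n,\dots,0$. Let $\{-,-\}$ and $\{\{\Theta,-\},-\}$ be the bilinear operations given on vector fields $X,Y$ and on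 forms $\alpha\in\Omega^p(M)$, $\beta\in\Omega^q(M)$, by $$\{X,Y\}=0,\quad\{\alpha,\beta\}=0,\quad \{X,\beta\}=\iota_X\beta,\quad \{\beta,X\}=(-1)^{n-1-q}\iota_X\beta,$$ $$\{\{\Theta,X\},Y\}=[X,Y]+\iota_X\iota_Y\varpi,\quad \{\{\Theta,X\},\beta\}=\mathcal L_X\beta,\quad \{\{\Theta,\alpha\},Y\}=(-1)^{n+p}\iota_Yd\alpha,\quad\{\{\Theta,\alpha\},\beta\}=0 .$$ Then $\mu_1=d$ on elements of negative degree, $\mu_1=0$ in degree $0$, and for $k\ge2$ $$\mu_k(e_1,\dots,e_k)=\frac{(-1)^{k+k(k+1)/2}}{(k-1)!}B_{k-1}\sum_{\sigma\in S_k}\epsilon(\sigma)\,\{\ldots\{\delta e_{\sigma(1)},e_{\sigma(2)}\},\ldots,e_{\sigma(k)}\},$$ where $B_j$ are the Bernoulli numbers with $B_1=-\tfrac12$, $\epsilon(\sigma)$ is the Koszul sign of $\sigma$ with respect to the degrees in $\mathsf L_{\mathcal V_n}[-1]$, and $\delta e=\{\Theta,e\}$ if $e$ has degree $0$ and $\delta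 e=0$ otherwise. **Theorem.** With these products, $\mathsf L_{\mathcal V_n}$ and $\mathsf L_M$ are Lie $n$-algebras. Let $\mathcal A^{\rm Ham}_{n-1}=\{X_\alpha+\alpha:\alpha\in\Omega^{n-1}_{\rm Ham}(M)\}$ be the space of diagonal sections. The graded subspace $$C^\infty(M)\xrightarrow{d}\Omega^1(M)\xrightarrow{d}\cdots\xrightarrow{d}\Omega^{n-2}(M)\xrightarrow{d}\mathcal A^{\rm Ham}_{n-1}$$ of $\mathsf L_{\mathcal V_n}$ is closed under all higher products; it is a sub Lie $n$-algebra of $\mathsf L_{\mathcal V_n}$. There is a weak isomorphism of $L_\infty$-algebras from $\mathsf L_M$ onto this sub Lie $n$-algebra whose linear component is $\alpha\mapsto X_\alpha+\alpha$ in degree $0$ and the identity in negative degrees. -/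

import Mathlib

open scoped Manifold ContDiff
noncomputable section

section Geometry

variable (E : Type*) [NormedAddCommGroup E] [NormedSpace ℝ E]
  (M : Type*) [TopologicalSpace M] [ChartedSpace E M]

/-- The algebra `C^∞(M)` of smooth real functions on `M`. -/
abbrev SmoothFun : Type _ := C^∞⟮𝓘(ℝ, E), M; ℝ⟯

variable [IsManifold 𝓘(ℝ, E) ∞ M]

/-- The smooth vector fields `𝔛(M) = Γ(TM)`. -/
abbrev VecField : Type _ :=
  Cₛ^∞⟮𝓘(ℝ, E); E, (TangentSpace 𝓘(ℝ, E) : M → Type _)⟯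

variable {E M}

instance vecFieldSMul : SMul (SmoothFun E M) (VecField E M) :=
  ⟨fun f X => ⟨(f : M → ℝ) • (X : (x : M) → TangentSpace 𝓘(ℝ, E) x),
    ContMDiff.smul_section f.contMDiff X.contMDiff⟩⟩

theorem vecField_smul_apply (f : SmoothFun E M) (X : VecField E M) (x : M) :
    (f • X) x = f x • X x := rfl

/-- `𝔛(M)` as a `C^∞(M)`-module. -/
instance vecFieldModule : Module (SmoothFun E M) (VecField E M) where
  one_smul X := by ext x; simp [vecField_smul_apply]
  mul_smul f g X := by ext x; simp [vecField_smul_apply, mul_smul]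
  smul_zero f := by ext x; simp [vecField_smul_apply]
  smul_add f X Y := by ext x; simp [vecField_smul_apply]
  add_smul f g X := by ext x; simp [vecField_smul_apply, add_smul]
  zero_smul X := by ext x; simp [vecField_smul_apply]

instance vecFieldTower : IsScalarTower ℝ (SmoothFun E M) (VecField E M) :=
  ⟨fun c f X => by ext x; simp [vecField_smul_apply, mul_smul]⟩

/-- The derivative `X f` of a smooth function along a smooth vector field. -/
def VecField.act (X : VecField E M) (f : SmoothFun E M) : SmoothFun E M :=
  ⟨fun x => mvfderiv 𝓘(ℝ, E) f x (X x), by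
    have h1 : ContMDiff 𝓘(ℝ, E).tangent 𝓘(ℝ, ℝ).tangent ∞
        (tangentMap 𝓘(ℝ, E) 𝓘(ℝ, ℝ) f) :=
      f.contMDiff.contMDiff_tangentMap (by simp)
    exact (contMDiff_snd_tangentBundle_modelSpace ℝ 𝓘(ℝ, ℝ)).comp (h1.comp X.contMDiff)⟩

theorem smoothFun_mdifferentiableAt (f : SmoothFun E M) (x : M) :
    MDifferentiableAt 𝓘(ℝ, E) 𝓘(ℝ, ℝ) f x :=
  f.contMDiff.mdifferentiableAt (by simp)

theorem VecField.act_apply (X : VecField E M) (f : SmoothFun E M) (x : M) :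
    X.act f x = mvfderiv 𝓘(ℝ, E) f x (X x) := rfl

theorem VecField.act_add (X : VecField E M) (f g : SmoothFun E M) :
    X.act (f + g) = X.act f + X.act g := by
  ext x
  have := mvfderiv_add (smoothFun_mdifferentiableAt f x) (smoothFun_mdifferentiableAt g x)
  simp [VecField.act_apply, this]

theorem VecField.act_mul (X : VecField E M) (f g : SmoothFun E M) :
    X.act (f * g) = X.act f * g + f * X.act g := by
  ext x
  have := mvfderiv_mul (smoothFun_mdifferentiableAt f x) (smoothFun_mdifferentiableAt g x)
  simp [VecField.act_apply, this]
  ring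

theorem VecField.act_const_smul (X : VecField E M) (c : ℝ) (f : SmoothFun E M) :
    X.act (c • f) = c • X.act f := by
  ext x
  have h := mvfderiv_smul (I := 𝓘(ℝ, E)) (x := x) (a := fun _ : M => c)
    (g := f) mdifferentiableAt_const (smoothFun_mdifferentiableAt f x)
  rw [mvfderiv_const] at h
  have h2 : ((c • f : SmoothFun E M) : M → ℝ) = (fun _ : M => c) • (f : M → ℝ) := rfl
  simp only [VecField.act_apply, h2]
  rw [h]
  simp [VecField.act_apply]

theorem VecField.add_act (X Y : VecField E M) (f : SmoothFun E M) :
    (X + Y).act f = X.act f + Y.act f := by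
  ext x
  simp [VecField.act_apply]

theorem VecField.smul_act (g : SmoothFun E M) (X : VecField E M) (f : SmoothFun E M) :
    (g • X).act f = g * X.act f := by
  ext x
  simp [VecField.act_apply, vecField_smul_apply]

variable [FiniteDimensional ℝ E]

/-- The commutator of smooth vector fields. -/
instance vecFieldBracket : Bracket (VecField E M) (VecField E M) :=
  ⟨fun X Y => ⟨VectorField.mlieBracket 𝓘(ℝ, E) X Y, by
    have : CompleteSpace E := FiniteDimensional.complete ℝ E
    have : IsManifold 𝓘(ℝ, E) (((⊤ : ℕ∞) : WithTop ℕ∞) + 1) M := by simpa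
    have : IsManifold 𝓘(ℝ, E) (minSmoothness ℝ 2) M := by
      simp only [minSmoothness_of_isRCLikeNormedField]
      exact IsManifold.of_le (n := ∞) (WithTop.coe_le_coe.mpr (le_top : (2 : ℕ∞) ≤ ⊤))
    exact ContDiff.mlieBracket_vectorField (m := ⊤) (n := ⊤) X.contMDiff Y.contMDiff (by simp)⟩⟩

theorem vecField_bracket_apply (X Y : VecField E M) (x : M) :
    ⁅X, Y⁆ x = VectorField.mlieBracket 𝓘(ℝ, E) X Y x := rfl

theorem vecField_bracket_add (X Y Z : VecField E M) : ⁅X, Y + Z⁆ = ⁅X, Y⁆ + ⁅X, Z⁆ := by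
  ext x
  exact VectorField.mlieBracket_add_right Y.mdifferentiableAt Z.mdifferentiableAt

theorem vecField_add_bracket (X Y Z : VecField E M) : ⁅X + Y, Z⁆ = ⁅X, Z⁆ + ⁅Y, Z⁆ := by
  ext x
  exact VectorField.mlieBracket_add_left X.mdifferentiableAt Y.mdifferentiableAt

theorem vecField_bracket_smul (f : SmoothFun E M) (X Y : VecField E M) :
    ⁅X, f • Y⁆ = X.act f • Y + f • ⁅X, Y⁆ := by
  ext x
  exact VectorField.mlieBracket_smul_right (smoothFun_mdifferentiableAt f x) Y.mdifferentiableAt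

theorem vecField_bracket_swap (X Y : VecField E M) : ⁅X, Y⁆ = -⁅Y, X⁆ := by
  ext x
  exact VectorField.mlieBracket_swap_apply

theorem vecField_bracket_const_smul (c : ℝ) (X Y : VecField E M) :
    ⁅X, c • Y⁆ = c • ⁅X, Y⁆ := by
  ext x
  exact VectorField.mlieBracket_const_smul_right Y.mdifferentiableAt

theorem vecField_const_smul_bracket (c : ℝ) (X Y : VecField E M) :
    ⁅c • X, Y⁆ = c • ⁅X, Y⁆ := by
  ext x
  exact VectorField.mlieBracket_const_smul_left X.mdifferentiableAt

/-- Smooth differential `k`-forms on `M`: alternating `C^∞(M)`-multilinear maps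
`𝔛(M)^k → C^∞(M)`. -/
abbrev DForm (E : Type*) [NormedAddCommGroup E] [NormedSpace ℝ E]
    (M : Type*) [TopologicalSpace M] [ChartedSpace E M] [IsManifold 𝓘(ℝ, E) ∞ M]
    (k : ℕ) : Type _ :=
  (VecField E M) [⋀^Fin k]→ₗ[SmoothFun E M] (SmoothFun E M)

namespace DForm

variable {k : ℕ}

/-- `Y ↦ X (α (Y)) - ½ ∑ j, α (Y₁, …, [X, Yⱼ], …, Yₖ)`, as an `ℝ`-multilinear alternating map. -/
def koszulTerm (α : DForm E M k) (X : VecField E M) :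
    (VecField E M) [⋀^Fin k]→ₗ[ℝ] (SmoothFun E M) where
  toFun Y := X.act (α Y) - (2⁻¹ : ℝ) • ∑ j, α (Function.update Y j ⁅X, Y j⁆)
  map_update_add' := by
    intro _ Y j U V
    obtain rfl := Subsingleton.elim ‹DecidableEq (Fin k)› (instDecidableEqFin k)
    have key : ∀ i, α (Function.update (Function.update Y j (U + V)) i
          ⁅X, Function.update Y j (U + V) i⁆)
        = α (Function.update (Function.update Y j U) i ⁅X, Function.update Y j U i⁆)
        + α (Function.update (Function.update Y j V) i ⁅X, Function.update Y j V i⁆) := by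
      intro i
      by_cases h : i = j
      · subst h; simp [vecField_bracket_add]
      · simp [Function.update_of_ne h, Function.update_comm (Ne.symm h)]
    simp only [key, Finset.sum_add_distrib, AlternatingMap.map_update_add, VecField.act_add]
    module
  map_update_smul' := by
    intro _ Y j c U
    obtain rfl := Subsingleton.elim ‹DecidableEq (Fin k)› (instDecidableEqFin k)
    have hc : ∀ (Z : Fin k → VecField E M) (i : Fin k) (W : VecField E M),
        α (Function.update Z i (c • W)) = c • α (Function.update Z i W) := by
      intro Z i W
      have : c • W = (c • (1 : SmoothFun E M)) • W := by simp
      rw [this, AlternatingMap.map_update_smul]; simp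
    have key : ∀ i, α (Function.update (Function.update Y j (c • U)) i
          ⁅X, Function.update Y j (c • U) i⁆)
        = c • α (Function.update (Function.update Y j U) i ⁅X, Function.update Y j U i⁆) := by
      intro i
      by_cases h : i = j
      · subst h; simp [vecField_bracket_const_smul, hc]
      · simp only [Function.update_of_ne h, Function.update_comm (Ne.symm h), hc]
    simp only [key, ← Finset.smul_sum, hc, VecField.act_const_smul]
    module
  map_eq_zero_of_eq' := by
    intro Y a b hY hab
    have h1 : α Y = 0 := α.map_eq_zero_of_eq Y hY hab
    have h2 : X.act (0 : SmoothFun E M) = 0 := by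
      simpa using X.act_const_smul 0 (0 : SmoothFun E M)
    rw [h1, h2, Fintype.sum_eq_add a b hab]
    · have e : Function.update Y b ⁅X, Y b⁆
          = Function.update Y a ⁅X, Y a⁆ ∘ Equiv.swap a b := by
        funext i
        by_cases ha : i = a
        · subst ha; simp [hab, hY, Function.update_of_ne hab.symm]
        · by_cases hb : i = b
          · subst hb; simp [hY]
          · simp [Function.update_of_ne, ha, hb, Equiv.swap_apply_of_ne_of_ne ha hb]
      rw [e, α.map_swap _ hab]; simp
    · rintro i ⟨hia, hib⟩
      exact α.map_eq_zero_of_eq _ (by simp [Function.update_of_ne, hia.symm, hib.symm, hY]) hab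

theorem koszulTerm_apply (α : DForm E M k) (X : VecField E M) (Y : Fin k → VecField E M) :
    koszulTerm α X Y = X.act (α Y) - (2⁻¹ : ℝ) • ∑ j, α (Function.update Y j ⁅X, Y j⁆) := rfl

theorem koszulTerm_update_smul (α : DForm E M k) (X : VecField E M) (Y : Fin k → VecField E M)
    (j : Fin k) (f : SmoothFun E M) (U : VecField E M) :
    koszulTerm α X (Function.update Y j (f • U)) =
      f * koszulTerm α X (Function.update Y j U)
        + (2⁻¹ : ℝ) • (X.act f * α (Function.update Y j U)) := by
  have key : ∀ i, α (Function.update (Function.update Y j (f • U)) i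
        ⁅X, Function.update Y j (f • U) i⁆)
      = f * α (Function.update (Function.update Y j U) i ⁅X, Function.update Y j U i⁆)
        + if i = j then X.act f * α (Function.update Y j U) else 0 := by
    intro i
    by_cases h : i = j
    · subst h; simp [vecField_bracket_smul, add_comm]
    · simp [Function.update_comm (Ne.symm h), h]
  simp only [koszulTerm_apply, key, Finset.sum_add_distrib, ← Finset.mul_sum,
    AlternatingMap.map_update_smul, smul_eq_mul, VecField.act_mul, Finset.sum_ite_eq',
    Finset.mem_univ, if_true]
  generalize X.act f * α (Function.update Y j U) = A
  generalize ∑ i, α (Function.update (Function.update Y j U) i ⁅X, Function.update Y j U i⁆) = B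
  rw [mul_sub, mul_smul_comm]
  module

theorem koszulTerm_smul (α : DForm E M k) (f : SmoothFun E M) (X : VecField E M)
    (Y : Fin k → VecField E M) :
    koszulTerm α (f • X) Y = f * koszulTerm α X Y
      + (2⁻¹ : ℝ) • ∑ j, (Y j).act f * α (Function.update Y j X) := by
  have key : ∀ i, α (Function.update Y i ⁅f • X, Y i⁆)
      = f * α (Function.update Y i ⁅X, Y i⁆) - (Y i).act f * α (Function.update Y i X) := by
    intro i
    have h : ⁅f • X, Y i⁆ = f • ⁅X, Y i⁆ - (Y i).act f • X := by
      rw [vecField_bracket_swap, vecField_bracket_smul, vecField_bracket_swap X]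
      module
    rw [h, AlternatingMap.map_update_sub]; simp
  simp only [koszulTerm_apply, key, Finset.sum_sub_distrib, VecField.smul_act, ← Finset.mul_sum]
  rw [mul_sub, mul_smul_comm]
  module

/-- `koszulTerm` as an `ℝ`-linear function of the vector field. -/
def koszulTermLM (α : DForm E M k) :
    (VecField E M) →ₗ[ℝ] (VecField E M) [⋀^Fin k]→ₗ[ℝ] (SmoothFun E M) where
  toFun := koszulTerm α
  map_add' X Y := by
    ext1 Z
    simp only [koszulTerm_apply, AlternatingMap.add_apply, vecField_add_bracket,
      AlternatingMap.map_update_add, Finset.sum_add_distrib, VecField.add_act]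
    module
  map_smul' c X := by
    ext1 Z
    have h : c • X = (c • (1 : SmoothFun E M)) • X := by simp
    have h0 : ∀ Y : VecField E M, Y.act (c • (1 : SmoothFun E M)) = 0 := by
      intro Y
      have := Y.act_mul 1 1
      simp at this
      simp [VecField.act_const_smul, this]
    rw [h, koszulTerm_smul]
    simp [h0]

/-- The Koszul formula, as an `ℝ`-multilinear alternating map. -/
def koszul (α : DForm E M k) : (VecField E M) [⋀^Fin (k + 1)]→ₗ[ℝ] (SmoothFun E M) :=
  AlternatingMap.alternatizeUncurryFin (koszulTermLM α)

theorem koszul_apply (α : DForm E M k) (X : Fin (k + 1) → VecField E M) :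
    koszul α X = ∑ i : Fin (k + 1), (-1 : ℤ) ^ (i : ℕ) •
      ((X i).act (α (i.removeNth X)) - (2⁻¹ : ℝ) • ∑ j : Fin k,
        α (Function.update (i.removeNth X) j ⁅X i, i.removeNth X j⁆)) := by
  simp [koszul, AlternatingMap.alternatizeUncurryFin_apply, koszulTermLM, koszulTerm_apply]

theorem koszul_cons_smul (α : DForm E M k) (f : SmoothFun E M) (U : VecField E M)
    (w : Fin k → VecField E M) :
    koszul α (Fin.cons (f • U) w : Fin (k + 1) → VecField E M)
      = f * koszul α (Fin.cons U w : Fin (k + 1) → VecField E M) := by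
  have e : ∀ V : VecField E M, koszul α (Fin.cons V w : Fin (k + 1) → VecField E M)
      = koszulTerm α V w + ∑ i : Fin k, (-1 : ℤ) ^ ((i : ℕ) + 1) •
        koszulTerm α (w i) (i.succ.removeNth (Fin.cons V w : Fin (k + 1) → VecField E M)) := by
    intro V
    simp [koszul, AlternatingMap.alternatizeUncurryFin_apply, koszulTermLM, Fin.sum_univ_succ,
      Fin.removeNth_zero]
  rw [e, e]
  cases k with
  | zero => simp [koszulTerm_smul]
  | succ k =>
    have r : ∀ (V : VecField E M) (i : Fin (k + 1)),
        i.succ.removeNth (Fin.cons V w : Fin (k + 2) → VecField E M)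
          = Function.update (Fin.cons 0 (i.removeNth w) : Fin (k + 1) → VecField E M) 0 V := by
      intro V i
      funext j
      refine Fin.cases ?_ (fun j => ?_) j
      · simp [Fin.removeNth]
      · simp [Fin.removeNth]
    have s : ∀ i : Fin (k + 1), α (Function.update w i U)
        = (-1 : ℤ) ^ (i : ℕ) •
          α (Function.update (Fin.cons 0 (i.removeNth w) : Fin (k + 1) → VecField E M) 0 U) := by
      intro i
      have := α.map_insertNth i U (i.removeNth w)
      rw [Fin.insertNth_removeNth] at this
      rw [this]
      simp [Matrix.vecCons]
    simp only [r, koszulTerm_smul, koszulTerm_update_smul, s, mul_add, Finset.mul_sum,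
      smul_add, Finset.sum_add_distrib, Finset.smul_sum]
    rw [add_assoc]
    congr 1
    rw [← Finset.sum_add_distrib, ← Finset.sum_add_distrib]
    refine Finset.sum_congr rfl fun i _ => ?_
    rcases neg_one_pow_eq_or ℤ (i : ℕ) with h | h <;> simp [pow_succ, h]

theorem koszul_update_smul (α : DForm E M k) (X : Fin (k + 1) → VecField E M)
    (a : Fin (k + 1)) (f : SmoothFun E M) (U : VecField E M) :
    koszul α (Function.update X a (f • U)) = f * koszul α (Function.update X a U) := by
  have h0 : ∀ (Z : Fin (k + 1) → VecField E M),
      koszul α (Function.update Z 0 (f • U)) = f * koszul α (Function.update Z 0 U) := by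
    intro Z
    have e : ∀ V, Function.update Z 0 V = Fin.cons V (Fin.tail Z) := by
      intro V
      rw [← Fin.update_cons_zero (Z 0) (Fin.tail Z) V, Fin.cons_self_tail]
    rw [e, e, koszul_cons_smul]
  by_cases ha : a = 0
  · subst ha; exact h0 X
  · have e : ∀ V, Function.update X a V
        = Function.update (X ∘ Equiv.swap a 0) 0 V ∘ Equiv.swap a 0 := by
      intro V
      funext i
      by_cases hi : i = a
      · subst hi; simp
      · by_cases hi0 : i = 0
        · subst hi0; simp [Function.update_of_ne (Ne.symm ha), Function.update_of_ne ha]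
        · simp [Function.update_of_ne, hi, hi0, Equiv.swap_apply_of_ne_of_ne hi hi0]
    rw [e, e, AlternatingMap.map_swap _ _ ha, AlternatingMap.map_swap _ _ ha, h0]
    simp

/-- The exterior derivative, given by the Koszul formula
`dα(X₀,…,X_k) = ∑ᵢ (-1)ⁱ Xᵢ(α(…,X̂ᵢ,…)) - ∑_{i<j} (-1)ⁱ α(…,X̂ᵢ,…,[Xᵢ,Xⱼ],…)`,
with `[Xᵢ, Xⱼ]` in the place of `Xⱼ`. The sum over `i < j` is written as one half of
the sum over all `i ≠ j`, to which `(i, j)` and `(j, i)` contribute equally. -/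
def extDeriv (α : DForm E M k) : DForm E M (k + 1) where
  toFun X := ∑ i : Fin (k + 1), (-1 : ℤ) ^ (i : ℕ) •
      ((X i).act (α (i.removeNth X)) - (2⁻¹ : ℝ) • ∑ j : Fin k,
        α (Function.update (i.removeNth X) j ⁅X i, i.removeNth X j⁆))
  map_update_add' := by
    intro _ X a U V
    simp only [← koszul_apply]
    exact (koszul α).map_update_add' X a U V
  map_update_smul' := by
    intro _ X a f U
    obtain rfl := Subsingleton.elim ‹DecidableEq (Fin (k + 1))› (instDecidableEqFin (k + 1))
    simp only [← koszul_apply]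
    exact koszul_update_smul α X a f U
  map_eq_zero_of_eq' := by
    intro X a b h hab
    simp only [← koszul_apply]
    exact (koszul α).map_eq_zero_of_eq X h hab

theorem extDeriv_apply (α : DForm E M k) (X : Fin (k + 1) → VecField E M) :
    extDeriv α X = ∑ i : Fin (k + 1), (-1 : ℤ) ^ (i : ℕ) •
      ((X i).act (α (i.removeNth X)) - (2⁻¹ : ℝ) • ∑ j : Fin k,
        α (Function.update (i.removeNth X) j ⁅X i, i.removeNth X j⁆)) := rfl

theorem extDeriv_add (α β : DForm E M k) : extDeriv (α + β) = extDeriv α + extDeriv β := by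
  ext1 X
  simp only [extDeriv_apply, AlternatingMap.add_apply, ← Finset.sum_add_distrib]
  refine Finset.sum_congr rfl fun i _ => ?_
  rw [VecField.act_add, Finset.sum_add_distrib, ← smul_add]
  congr 1
  module

theorem extDeriv_smul (c : ℝ) (α : DForm E M k) : extDeriv (c • α) = c • extDeriv α := by
  ext1 X
  simp only [extDeriv_apply, AlternatingMap.smul_apply, Finset.smul_sum]
  refine Finset.sum_congr rfl fun i _ => ?_
  rw [VecField.act_const_smul, ← Finset.smul_sum, ← Finset.smul_sum, ← Finset.smul_sum]
  module

/-- The contraction `ι_X α = α(X, …)`. -/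
def interior (X : VecField E M) (α : DForm E M (k + 1)) : DForm E M k := α.curryLeft X

end DForm

end Geometry

section LInfinity

variable {V W : Type*} [AddCommGroup V] [Module ℝ V] [AddCommGroup W] [Module ℝ W]

/-- For homogeneous elements `v₁, …, v_m` of a graded vector space of degrees `d₁, …, d_m`, this is
the Koszul sign, in the shifted degrees `dᵢ - 1`, of the permutation which sorts the `vᵢ` by the
value of `f` (keeping the order of elements with equal values of `f`). -/
def koszulSign {m : ℕ} {ι : Type*} [LinearOrder ι] (d : Fin m → ℤ) (f : Fin m → ι) : ℤ :=
  ∏ i, ∏ j, if i < j ∧ f j < f i then ((Int.negOnePow ((d i - 1) * (d j - 1)) : ℤˣ) : ℤ) else 1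

/-- The subtuple of `x` with indices in `S`, in increasing order. -/
def subtuple {m : ℕ} {A : Type*} (S : Finset (Fin m)) (x : Fin m → A) : Fin S.card → A :=
  fun a => x (S.orderEmbOfFin rfl a)

/-- A family of maps `F k` of `k` homogeneous arguments; `F k d x` is the value on `x₁, …, x_k` of
degrees `d₁, …, d_k`. -/
abbrev GradedFamily (V W : Type*) : Type _ := (k : ℕ) → (Fin k → ℤ) → (Fin k → V) → W

/-- `F` restricts to multilinear maps `F k : L[-1]^{⊙ k} → L'[-1]`, `k ≥ 1`, of degree `s`, which
are graded symmetric. Here `L[-1]` denotes the graded vector space `L` in which the degree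
of each element has been decreased by one. -/
structure IsGradedSymmetric (L : ℤ → Submodule ℝ V) (L' : ℤ → Submodule ℝ W) (s : ℤ)
    (F : GradedFamily V W) : Prop where
  mem : ∀ k, 1 ≤ k → ∀ (d : Fin k → ℤ) (x : Fin k → V), (∀ i, x i ∈ L (d i)) →
    F k d x ∈ L' (∑ i, (d i - 1) + s + 1)
  map_add : ∀ k, 1 ≤ k → ∀ (d : Fin k → ℤ) (x : Fin k → V), (∀ i, x i ∈ L (d i)) →
    ∀ (i : Fin k) (u v : V), u ∈ L (d i) → v ∈ L (d i) →
      F k d (Function.update x i (u + v)) =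
        F k d (Function.update x i u) + F k d (Function.update x i v)
  map_smul : ∀ k, 1 ≤ k → ∀ (d : Fin k → ℤ) (x : Fin k → V), (∀ i, x i ∈ L (d i)) →
    ∀ (i : Fin k) (c : ℝ) (u : V), u ∈ L (d i) →
      F k d (Function.update x i (c • u)) = c • F k d (Function.update x i u)
  symm : ∀ k, 1 ≤ k → ∀ (d : Fin k → ℤ) (x : Fin k → V), (∀ i, x i ∈ L (d i)) →
    ∀ σ : Equiv.Perm (Fin k), F k (d ∘ σ) (x ∘ σ) = koszulSign d σ.symm • F k d x

/-- For families `F` and `D`, the sum over all unshuffles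
`∑ ε(σ) F (D (x_{σ(1)}, …, x_{σ(i)}), x_{σ(i+1)}, …, x_{σ(m)})`, `1 ≤ i ≤ m`. An unshuffle is given
by the subset `S = {σ(1), …, σ(i)}`. If `D` consists of the components of a coderivation of degree
one on `S̄(L[-1])` then this is the component of `F ∘ D` on `x₁ ⊙ … ⊙ x_m`. -/
def unshuffleSum (F : GradedFamily V W) (D : GradedFamily V V) {m : ℕ}
    (d : Fin m → ℤ) (x : Fin m → V) : W :=
  ∑ S : Finset (Fin m) with S.Nonempty,
    koszulSign d (fun i => if i ∈ S then 0 else 1) •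
      F (Sᶜ.card + 1)
        (Fin.cons (∑ i ∈ S, (d i - 1) + 2) (subtuple Sᶜ d))
        (Fin.cons (D S.card (subtuple S d) (subtuple S x)) (subtuple Sᶜ x))

/-- For families `F` and `Ψ`, the sum over `r` and over all decompositions of `{1, …, m}`
into `r` nonempty blocks `B₁, …, B_r` of the terms `1/r! ε F (Ψ (x_{B₁}), …, Ψ (x_{B_r}))`. If `Ψ`
consists of the components of a morphism of the coalgebras `S̄(L[-1])` and `S̄(L'[-1])`
then this is the component of `F ∘ Ψ` on `x₁ ⊙ … ⊙ x_m`. -/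
def partitionSum {U : Type*} [AddCommGroup U] [Module ℝ U] (F : GradedFamily W U)
    (Ψ : GradedFamily V W) {m : ℕ} (d : Fin m → ℤ) (x : Fin m → V) : U :=
  ∑ r ∈ Finset.range (m + 1), ((r.factorial : ℝ)⁻¹) •
    ∑ f : Fin m → Fin r with Function.Surjective f,
      koszulSign d f •
        F r (fun a => ∑ i with f i = a, (d i - 1) + 1)
          (fun a => Ψ (Finset.univ.filter fun i => f i = a).card
            (subtuple (Finset.univ.filter fun i => f i = a) d)
            (subtuple (Finset.univ.filter fun i => f i = a) x))

/-- `L`, a family of subspaces of `V` indexed by the degree, with the family `D` is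
an `L_∞`-algebra: `L` is a graded vector space `⨁ L d`, and `D` consists of
the components `L[-1]^{⊙ k} → L[-1]` of a coderivation of degree one on `S̄(L[-1])`
whose square is zero. -/
structure IsLInfinityAlgebra (L : ℤ → Submodule ℝ V) (D : GradedFamily V V) : Prop where
  independent : iSupIndep L
  symmetric : IsGradedSymmetric L L 1 D
  square_zero : ∀ (m : ℕ) (d : Fin m → ℤ) (x : Fin m → V), (∀ i, x i ∈ L (d i)) →
    unshuffleSum D D d x = 0

/-- A Lie `n`-algebra, i.e. an `L_∞`-algebra concentrated in degrees `1 - n, …, 0`. -/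
structure IsLieNAlgebra (n : ℕ) (L : ℤ → Submodule ℝ V) (D : GradedFamily V V) : Prop
    extends IsLInfinityAlgebra L D where
  concentrated : ∀ d : ℤ, d < 1 - n ∨ 0 < d → L d = ⊥

/-- The graded subspace `L'` of `L` is closed under all higher products, i.e. it is a sub
`L_∞`-algebra. -/
structure IsSubLInfinityAlgebra (L' L : ℤ → Submodule ℝ V) (D : GradedFamily V V) : Prop where
  le : ∀ d, L' d ≤ L d
  closed : ∀ k, 1 ≤ k → ∀ (d : Fin k → ℤ) (x : Fin k → V), (∀ i, x i ∈ L' (d i)) →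
    D k d x ∈ L' (∑ i, (d i - 1) + 2)

/-- `Ψ` consists of the components `L[-1]^{⊙ k} → L'[-1]` of a (weak) morphism of
`L_∞`-algebras: a coalgebra morphism `Ψ` with `Ψ ∘ D = D' ∘ Ψ`. -/
structure IsLInfinityMorphism (L : ℤ → Submodule ℝ V) (D : GradedFamily V V)
    (L' : ℤ → Submodule ℝ W) (D' : GradedFamily W W) (Ψ : GradedFamily V W) : Prop where
  symmetric : IsGradedSymmetric L L' 0 Ψ
  comm : ∀ m, 1 ≤ m → ∀ (d : Fin m → ℤ) (x : Fin m → V), (∀ i, x i ∈ L (d i)) →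
    unshuffleSum Ψ D d x = partitionSum D' Ψ d x

/-- A (weak) isomorphism of `L_∞`-algebras: a (weak) morphism whose linear component is bijective
in each degree. -/
structure IsLInfinityIso (L : ℤ → Submodule ℝ V) (D : GradedFamily V V)
    (L' : ℤ → Submodule ℝ W) (D' : GradedFamily W W) (Ψ : GradedFamily V W) : Prop
    extends IsLInfinityMorphism L D L' D' Ψ where
  bijective : ∀ d : ℤ, Set.BijOn (fun v => Ψ 1 (fun _ => d) (fun _ => v)) (L d) (L' d)

/-- The sign between the higher product `μ_k` and the component `D_k` of the codifferential on
`S̄(L[-1])`: it is `1` for `k = 1` and `(-1)^((k-2)(k-3)/2)` for `k ≥ 2`. -/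
def productSign (k : ℕ) : ℤ := if k = 1 then 1 else -(-1) ^ (k * (k - 1) / 2)

/-- The components `D_k` of the codifferential which encodes the higher products `μ_k`. -/
def codifferential (μ : GradedFamily V V) : GradedFamily V V :=
  fun k d x => productSign k • μ k d x

end LInfinity

section Plectic

variable {E : Type*} [NormedAddCommGroup E] [NormedSpace ℝ E] [FiniteDimensional ℝ E]
  {M : Type*} [TopologicalSpace M] [ChartedSpace E M] [IsManifold 𝓘(ℝ, E) ∞ M]

/-- An `n`-plectic form: a closed nondegenerate `(n + 1)`-form. -/
structure IsNPlectic {n : ℕ} (ϖ : DForm E M (n + 1)) : Prop where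
  closed : ϖ.extDeriv = 0
  nondegenerate : ∀ X : VecField E M, ϖ.interior X = 0 → X = 0

/-- The space `Ω^•(M)` of inhomogeneous differential forms; `β k` is the component of `β` of form
degree `k`. -/
abbrev TotalForm (E : Type*) [NormedAddCommGroup E] [NormedSpace ℝ E]
    (M : Type*) [TopologicalSpace M] [ChartedSpace E M] [IsManifold 𝓘(ℝ, E) ∞ M] : Type _ :=
  (k : ℕ) → DForm E M k

namespace TotalForm

/-- The exterior derivative on `Ω^•(M)`. -/
def extDeriv (β : TotalForm E M) : TotalForm E M
  | 0 => 0
  | k + 1 => (β k).extDeriv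

/-- The contraction `ι_X` on `Ω^•(M)`. -/
def interior (X : VecField E M) (β : TotalForm E M) : TotalForm E M :=
  fun k => (β (k + 1)).interior X

/-- The Lie derivative `𝓛_X = d ι_X + ι_X d` on `Ω^•(M)`. -/
def lieDeriv (X : VecField E M) (β : TotalForm E M) : TotalForm E M :=
  extDeriv (interior X β) + interior X (extDeriv β)

/-- A form of fixed degree as an element of `Ω^•(M)`. -/
def of {k : ℕ} (α : DForm E M k) : TotalForm E M := Pi.single k α

/-- `ι_{X₁} ⋯ ι_{X_k} β`. -/
def contract : {k : ℕ} → (Fin k → VecField E M) → TotalForm E M → TotalForm E M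
  | 0, _, β => β
  | _ + 1, X, β => interior (X 0) (contract (Fin.tail X) β)

theorem extDeriv_add (β γ : TotalForm E M) : extDeriv (β + γ) = extDeriv β + extDeriv γ := by
  funext k
  cases k with
  | zero => simp [extDeriv]
  | succ k => exact DForm.extDeriv_add _ _

theorem extDeriv_smul (c : ℝ) (β : TotalForm E M) : extDeriv (c • β) = c • extDeriv β := by
  funext k
  cases k with
  | zero => simp [extDeriv]
  | succ k => exact DForm.extDeriv_smul _ _

theorem interior_add_left (X Y : VecField E M) (β : TotalForm E M) :
    interior (X + Y) β = interior X β + interior Y β := by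
  funext k
  simp [interior, DForm.interior]

theorem interior_smul_left (c : ℝ) (X : VecField E M) (β : TotalForm E M) :
    interior (c • X) β = c • interior X β := by
  funext k
  have h : c • X = (c • (1 : SmoothFun E M)) • X := by simp
  simp only [interior, DForm.interior, h, map_smul]
  ext1 Y
  simp [interior, DForm.interior]

end TotalForm

/-- The form part of the complexes: `Ω^{n-1+d}(M)` in degrees `1 - n ≤ d ≤ 0`, and zero in
all other degrees. -/
def formGrading (n : ℕ) (d : ℤ) : Submodule ℝ (TotalForm E M) where
  carrier := {β | ∀ q : ℕ, (0 < d ∨ (q : ℤ) ≠ n - 1 + d) → β q = 0}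
  zero_mem' := fun _ _ => rfl
  add_mem' := fun {β γ} hβ hγ q hq => by simp [hβ q hq, hγ q hq]
  smul_mem' := fun c β hβ q hq => by simp [hβ q hq]

/-- `X` is a Hamiltonian vector field of `α`, i.e. `dα = -ι_X ϖ`. -/
def IsHamiltonianPair {n : ℕ} (ϖ : DForm E M (n + 1)) (X : VecField E M) (α : TotalForm E M) :
    Prop :=
  α.extDeriv = -TotalForm.interior X (TotalForm.of ϖ)

/-- The space `Ω^{n-1}_Ham(M)` of Hamiltonian `(n-1)`-forms. -/
def hamForms {n : ℕ} (ϖ : DForm E M (n + 1)) : Submodule ℝ (TotalForm E M) where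
  carrier := {α | α ∈ formGrading n 0 ∧ ∃ X, IsHamiltonianPair ϖ X α}
  zero_mem' := ⟨zero_mem _, 0, by
    have h1 := TotalForm.extDeriv_smul (0 : ℝ) (0 : TotalForm E M)
    have h2 := TotalForm.interior_smul_left (0 : ℝ) 0 (TotalForm.of ϖ)
    simp only [zero_smul] at h1 h2
    simp [IsHamiltonianPair, h1, h2]⟩
  add_mem' := by
    rintro α β ⟨hα, X, hX⟩ ⟨hβ, Y, hY⟩
    refine ⟨add_mem hα hβ, X + Y, ?_⟩
    simp only [IsHamiltonianPair] at *
    rw [TotalForm.extDeriv_add, TotalForm.interior_add_left, hX, hY]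
    abel
  smul_mem' := by
    rintro c α ⟨hα, X, hX⟩
    refine ⟨Submodule.smul_mem _ c hα, c • X, ?_⟩
    simp only [IsHamiltonianPair] at *
    rw [TotalForm.extDeriv_smul, TotalForm.interior_smul_left, hX, smul_neg]

open Classical in
/-- The Hamiltonian vector field `X_α` of a Hamiltonian form `α`, which is unique if `ϖ` is
`n`-plectic (and zero by convention if `α` is not Hamiltonian). -/
def hamVecField {n : ℕ} (ϖ : DForm E M (n + 1)) (α : TotalForm E M) : VecField E M :=
  if h : ∃ X, IsHamiltonianPair ϖ X α then h.choose else 0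

/-- The graded vector space
`C^∞(M) ⊕ Ω¹(M) ⊕ … ⊕ Ω^{n-2}(M) ⊕ Ω^{n-1}_Ham(M)`, in degrees `1 - n, …, 0`,
underlying the algebra of local observables. -/
def obsGrading {n : ℕ} (ϖ : DForm E M (n + 1)) (d : ℤ) : Submodule ℝ (TotalForm E M) :=
  if d = 0 then hamForms ϖ else formGrading n d

/-- The higher products of the strong homotopy Lie algebra of local observables: `μ₁` is the
exterior derivative in negative degrees, and
`μ_k(α₁, …, α_k) = (-1)^{k(k+1)/2} ι_{X_{α₁}} ⋯ ι_{X_{α_k}} ϖ` for `k ≥ 2` and `αᵢ` of degree zero;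
all other products vanish. -/
def obsProduct {n : ℕ} (ϖ : DForm E M (n + 1)) : GradedFamily (TotalForm E M) (TotalForm E M)
  | 0, _, _ => 0
  | 1, d, x => if d 0 = 0 then 0 else (x 0).extDeriv
  | k + 2, d, x =>
      if ∀ i, d i = 0 then
        (-1 : ℤ) ^ ((k + 3).choose 2) •
          TotalForm.contract (fun i => hamVecField ϖ (x i)) (TotalForm.of ϖ)
      else 0

/-- The space containing the sections `X + α` of `TM ⊕ ⋀^{n-1} T^*M` and the differential forms
of lower degree. -/
abbrev VinSpace (E : Type*) [NormedAddCommGroup E] [NormedSpace ℝ E]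
    (M : Type*) [TopologicalSpace M] [ChartedSpace E M] [IsManifold 𝓘(ℝ, E) ∞ M] : Type _ :=
  VecField E M × TotalForm E M

/-- The graded vector space
`C^∞(M) ⊕ Ω¹(M) ⊕ … ⊕ Ω^{n-2}(M) ⊕ (𝔛(M) ⊕ Ω^{n-1}(M))`, in degrees `1 - n, …, 0`,
of functions of degree at most `n - 1` on the Vinogradov algebroid. -/
def vinGrading (n : ℕ) (d : ℤ) : Submodule ℝ (VinSpace E M) where
  carrier := {e | (d ≠ 0 → e.1 = 0) ∧ e.2 ∈ formGrading n d}
  zero_mem' := ⟨fun _ => rfl, zero_mem _⟩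
  add_mem' := fun {e f} he hf =>
    ⟨fun h => by simp [he.1 h, hf.1 h], add_mem he.2 hf.2⟩
  smul_mem' := fun c e he => ⟨fun h => by simp [he.1 h], Submodule.smul_mem _ c he.2⟩

/-- The Poisson bracket `{e, f}` for functions of degree less than `n`: the vector fields and the
forms Poisson commute among themselves, `{X, β} = ι_X β`, and
`{β, X} = (-1)^{n-1-q} ι_X β` for `β` of form degree `q`. On sections of
`TM ⊕ ⋀^{n-1} T^*M` this is `ι_X β + ι_Y α`. -/
def poisson (n : ℕ) (e f : VinSpace E M) : VinSpace E M :=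
  (0, fun q => TotalForm.interior e.1 f.2 q + (-1 : ℤ) ^ (n + q) • TotalForm.interior f.1 e.2 q)

/-- The derived bracket `{{Θ, e}, f}` of the Vinogradov algebroid twisted by `ϖ`:
`{{Θ, X}, Y} = [X, Y] + ι_X ι_Y ϖ`, `{{Θ, X}, β} = 𝓛_X β`,
`{{Θ, α}, Y} = (-1)^{n+q} ι_Y dα` for `α` of form degree `q`, and `{{Θ, α}, β} = 0`.
On sections of `TM ⊕ ⋀^{n-1} T^*M` this is the twisted Dorfman bracket
`[X, Y] + 𝓛_X β - ι_Y dα + ι_X ι_Y ϖ`. -/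
def derivedBracket {n : ℕ} (ϖ : DForm E M (n + 1)) (e f : VinSpace E M) : VinSpace E M :=
  (⁅e.1, f.1⁆, fun q =>
    TotalForm.lieDeriv e.1 f.2 q
      + (-1 : ℤ) ^ (n + q) • TotalForm.interior f.1 e.2.extDeriv q
      + TotalForm.interior e.1 (TotalForm.interior f.1 (TotalForm.of ϖ)) q)

/-- `{… {{{Θ, e₁}, e₂}, e₃} …, e_k}`, for `k ≥ 2`. -/
def nestedBracket {n : ℕ} (ϖ : DForm E M (n + 1)) :
    (k : ℕ) → (Fin (k + 2) → VinSpace E M) → VinSpace E M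
  | 0, e => derivedBracket ϖ (e 0) (e 1)
  | k + 1, e => poisson n (nestedBracket ϖ k (Fin.init e)) (e (Fin.last (k + 2)))

/-- The higher products of the Lie `n`-algebra associated with the Vinogradov algebroid twisted by
`ϖ`: `μ₁ e = {Θ, e} = de` for `e` of negative degree, `μ₁ e = 0` in degree zero, and for `k ≥ 2`
`μ_k(e₁, …, e_k) = (-1)^{k + k(k+1)/2} / (k-1)! B_{k-1}
  ∑_σ ε(σ) {… {δe_{σ(1)}, e_{σ(2)}} …, e_{σ(k)}}`
where `ε(σ)` is the Koszul sign, `B_j` are the Bernoulli numbers with `B₁ = -1/2`, and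
`δe = {Θ, e}` for `e` of degree zero and `δe = 0` otherwise. -/
def vinProduct {n : ℕ} (ϖ : DForm E M (n + 1)) : GradedFamily (VinSpace E M) (VinSpace E M)
  | 0, _, _ => 0
  | 1, d, e => if d 0 = 0 then 0 else (0, (e 0).2.extDeriv)
  | k + 2, d, e =>
      ((-1 : ℝ) ^ ((k + 2) + (k + 2) * (k + 3) / 2) / ((k + 1).factorial : ℝ)
          * (bernoulli (k + 1) : ℝ)) •
        ∑ σ : Equiv.Perm (Fin (k + 2)),
          koszulSign d σ.symm •
            if d (σ 0) = 0 then nestedBracket ϖ k (fun i => e (σ i)) else 0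

/-- The space of diagonal sections `X_α + α` of `TM ⊕ ⋀^{n-1} T^*M`, with `α` a Hamiltonian
`(n-1)`-form and `X_α` its Hamiltonian vector field. -/
def diagSections {n : ℕ} (ϖ : DForm E M (n + 1)) : Submodule ℝ (VinSpace E M) where
  carrier := {e | e.2 ∈ formGrading n 0 ∧ IsHamiltonianPair ϖ e.1 e.2}
  zero_mem' := ⟨zero_mem _, by
    have h1 := TotalForm.extDeriv_smul (0 : ℝ) (0 : TotalForm E M)
    have h2 := TotalForm.interior_smul_left (0 : ℝ) 0 (TotalForm.of ϖ)
    simp only [zero_smul] at h1 h2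
    simp [IsHamiltonianPair, h1, h2]⟩
  add_mem' := by
    rintro e f ⟨he, hX⟩ ⟨hf, hY⟩
    refine ⟨add_mem he hf, ?_⟩
    simp only [IsHamiltonianPair, Prod.fst_add, Prod.snd_add] at *
    rw [TotalForm.extDeriv_add, TotalForm.interior_add_left, hX, hY]
    abel
  smul_mem' := by
    rintro c e ⟨he, hX⟩
    refine ⟨Submodule.smul_mem _ c he, ?_⟩
    simp only [IsHamiltonianPair, Prod.smul_fst, Prod.smul_snd] at *
    rw [TotalForm.extDeriv_smul, TotalForm.interior_smul_left, hX, smul_neg]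

/-- The graded subspace `C^∞(M) ⊕ Ω¹(M) ⊕ … ⊕ Ω^{n-2}(M) ⊕ 𝒜^Ham_{n-1}(M)`
of the Lie `n`-algebra of the twisted Vinogradov algebroid, where `𝒜^Ham_{n-1}(M)` consists
of the diagonal sections. -/
def diagGrading {n : ℕ} (ϖ : DForm E M (n + 1)) (d : ℤ) : Submodule ℝ (VinSpace E M) :=
  if d = 0 then diagSections ϖ else vinGrading n d

end Plectic

end

/-!
The structures are evaluated on a *generic element*. Given homogeneous elements `e i = X i + φ i` of
degrees `d i`, attach to each a parameter `θ i` whose parity is that of the shifted degree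
`d i - 1`, and consider `∑ i, θ i • e i`. A graded symmetric family of multilinear maps is
determined by the coefficient of `θ 0 ⋯ θ (m - 1)` in its value on generic elements, and the Koszul
signs disappear into the commutation rules of the parameters.

Put `φ = ∑ i, θ i • φ i`, let `R = contr` be the contraction with `∑ i, θ i • X i`, and let
`L = [R, d]` (`lieOp`) and `Q = [R, L]` (`curvOp`). Cartan's relations give `d ^ 2 = 0` and
`[R, Q] = 0`; apart from degrees, nothing else about differential forms is used, and these facts are
recorded in the structure `CartanCalculus`. With `F = t / (e ^ t - 1)`, `a = (1 - F) / t`,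
`b = (1 - t / 2 - F) / t ^ 2` and `r = 1 - t - e ^ (-t)`, and with `π` the projection to the part
which comes from arguments of degree `0`, the form parts of the structures are

* `(d + a(R) L + b(R) Q) φ - F(R) d π φ + R (1 - F(R)) ϖ` for the nested brackets (`vinForm`),
* `r(R) ϖ + d (1 - π) φ` for the local observables (`obsForm`),

while both have the vector part `[X, X] / 2` (`vecCurv`). The isomorphism is `φ ↦ (F + t)(R) φ`
(`morForm`), with identity vector part. The Hamiltonian condition on the arguments reads
`d π φ = - R ϖ`.

Composition of such families amounts to adding an infinitesimal generic element (`IsInsertion`): the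
operator `f(R)` changes by `f'(R)` times the contraction with the inserted vector field, which for
the vector part `[X, X] / 2` is `- Q / 2` up to the parity. The homotopy Jacobi identities and the
morphism equation thereby become identities between power series with coefficients to the left of
`d`, `L` and `Q`. They are `SeriesOps.conn_square`, `SeriesOps.obs_square` and
`SeriesOps.conn_intertwine`, and follow from `F' = (a - 1) F`, `2 b = a ^ 2 - a - a'`,
`(F + t)' = a (F + t)` and `(F + t) r = t (1 - F) - t ^ 2`.

The right-hand side of the morphism equation is a sum over all partitions of the arguments. A nested
bracket vanishes if two of its arguments have no vector part, and the components of the morphism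
with at least two arguments take values in forms; so only the partitions with at most one block of
at least two elements contribute (`partitionSum_symmetrize`), and this side, too, is a value on the
generic element plus a single insertion.
-/

noncomputable section

/-! ### Cartan calculus of differential forms -/

section Cartan

variable {E : Type*} [NormedAddCommGroup E] [NormedSpace ℝ E] [FiniteDimensional ℝ E]
  {M : Type*} [TopologicalSpace M] [ChartedSpace E M] [IsManifold 𝓘(ℝ, E) ∞ M]

theorem vecField_jacobi (X Y Z : VecField E M) :
    ⁅X, ⁅Y, Z⁆⁆ = ⁅⁅X, Y⁆, Z⁆ + ⁅Y, ⁅X, Z⁆⁆ := by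
  have : CompleteSpace E := FiniteDimensional.complete ℝ E
  have : IsManifold 𝓘(ℝ, E) (minSmoothness ℝ 3) M := by
    simp only [minSmoothness_of_isRCLikeNormedField]
    exact IsManifold.of_le (n := ∞) (WithTop.coe_le_coe.mpr (le_top : (3 : ℕ∞) ≤ ⊤))
  have hX : ∀ X : VecField E M, ∀ x, ContMDiffAt 𝓘(ℝ, E) 𝓘(ℝ, E).tangent (minSmoothness ℝ 2)
      (fun x => (X x : TangentBundle 𝓘(ℝ, E) M)) x := by
    intro X x
    simp only [minSmoothness_of_isRCLikeNormedField]
    exact (X.contMDiff x).of_le (WithTop.coe_le_coe.mpr (le_top : (2 : ℕ∞) ≤ ⊤))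
  ext x
  exact VectorField.leibniz_identity_mlieBracket_apply (hX X x) (hX Y x) (hX Z x)

/-- The bracket of vector fields is the commutator of the derivations which they induce. In view of
the Leibniz rule, the Jacobi identity for `X`, `Y`, `f • Z` says that the difference of both sides
annihilates every vector field `Z`; where `X`, `Y` and `⁅X, Y⁆` all vanish, both sides are zero. -/
theorem VecField.bracket_act (X Y : VecField E M) (f : SmoothFun E M) :
    ⁅X, Y⁆.act f = X.act (Y.act f) - Y.act (X.act f) := by
  have key : ∀ Z : VecField E M,
      (⁅X, Y⁆.act f - (X.act (Y.act f) - Y.act (X.act f))) • Z = 0 := by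
    intro Z
    have h := vecField_jacobi X Y (f • Z)
    have h1 := vecField_jacobi X Y Z
    simp only [vecField_bracket_smul, vecField_bracket_add] at h
    rw [h1] at h
    have e : (⁅X, Y⁆.act f - (X.act (Y.act f) - Y.act (X.act f))) • Z
      = (⁅X, Y⁆.act f • Z + f • ⁅⁅X, Y⁆, Z⁆ +
        (Y.act (X.act f) • Z + X.act f • ⁅Y, Z⁆ + (Y.act f • ⁅X, Z⁆ + f • ⁅Y, ⁅X, Z⁆⁆)))
       - (X.act (Y.act f) • Z + Y.act f • ⁅X, Z⁆ +
        (X.act f • ⁅Y, Z⁆ + f • (⁅⁅X, Y⁆, Z⁆ + ⁅Y, ⁅X, Z⁆⁆))) := by module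
    rw [e, ← h, sub_self]
  ext x
  by_contra hne
  have hz : ∀ Z : VecField E M, Z x = 0 := by
    intro Z
    have h2 := congrArg (fun W : VecField E M => W x) (key Z)
    simp only [vecField_smul_apply] at h2
    exact (smul_eq_zero.mp h2).resolve_left fun h0 => hne (sub_eq_zero.mp h0)
  apply hne
  change mvfderiv 𝓘(ℝ, E) f x (⁅X, Y⁆ x) = mvfderiv 𝓘(ℝ, E) (Y.act f) x (X x)
    - mvfderiv 𝓘(ℝ, E) (X.act f) x (Y x)
  simp [hz]

theorem VecField.act_zero (X : VecField E M) : X.act 0 = 0 := by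
  simpa using X.act_const_smul 0 (0 : SmoothFun E M)

namespace DForm

variable {k : ℕ}

theorem interior_apply (α : DForm E M (k + 1)) (X : VecField E M) (Y : Fin k → VecField E M) :
    interior X α Y = α (Fin.cons X Y : Fin (k + 1) → VecField E M) := rfl

/-- Cartan's formula: `d ι_X + ι_X d` is the Lie derivative, which acts by the Leibniz rule. -/
theorem cartan_apply (α : DForm E M (k + 1)) (X : VecField E M) (Y : Fin (k + 1) → VecField E M) :
    (extDeriv (interior X α) + interior X (extDeriv α)) Y
      = X.act (α Y) - ∑ j, α (Function.update Y j ⁅X, Y j⁆) := by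
  have r : ∀ i : Fin (k + 1), i.succ.removeNth (Fin.cons X Y : Fin (k + 2) → VecField E M)
      = (Fin.cons X (i.removeNth Y) : Fin (k + 1) → VecField E M) := by
    intro i
    funext j
    refine Fin.cases ?_ (fun j => ?_) j <;> simp [Fin.removeNth]
  have s : ∀ i : Fin (k + 1),
      (-1 : ℤ) ^ (i : ℕ) • α (Fin.cons ⁅Y i, X⁆ (i.removeNth Y) : Fin (k + 1) → VecField E M)
        = -α (Function.update Y i ⁅X, Y i⁆) := by
    intro i
    have h := α.neg_one_pow_smul_map_insertNth i ⁅X, Y i⁆ (i.removeNth Y)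
    rw [vecField_bracket_swap, ← Fin.update_cons_zero X, AlternatingMap.map_update_neg,
      Fin.update_cons_zero, smul_neg, neg_inj]
    have h3 : α (Matrix.vecCons ⁅X, Y i⁆ (i.removeNth Y)) =
      α (Fin.cons ⁅X, Y i⁆ (i.removeNth Y) : Fin (k + 1) → VecField E M) := rfl
    rw [← h3, ← h, smul_smul, ← pow_add, Fin.insertNth_removeNth]
    simp [← two_mul]
  have e : ∀ i : Fin (k + 1), (-1 : ℤ) ^ ((i : ℕ) + 1) •
      ((Y i).act (α (Fin.cons X (i.removeNth Y) : Fin (k + 1) → VecField E M)) - (2⁻¹ : ℝ) •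
        (α (Fin.cons ⁅Y i, X⁆ (i.removeNth Y) : Fin (k + 1) → VecField E M) +
        ∑ j : Fin k, α (Fin.cons X (Function.update (i.removeNth Y) j ⁅Y i, i.removeNth Y j⁆) :
          Fin (k + 1) → VecField E M)))
      = -((-1 : ℤ) ^ (i : ℕ) •
      ((Y i).act (α (Fin.cons X (i.removeNth Y) : Fin (k + 1) → VecField E M)) - (2⁻¹ : ℝ) •
        ∑ j : Fin k, α (Fin.cons X (Function.update (i.removeNth Y) j ⁅Y i, i.removeNth Y j⁆) :
          Fin (k + 1) → VecField E M))) - (2⁻¹ : ℝ) • α (Function.update Y i ⁅X, Y i⁆) := by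
    intro i
    have h := s i
    rw [neg_eq_iff_eq_neg.symm] at h
    rw [← h, pow_succ]
    module
  simp only [AlternatingMap.add_apply, interior_apply, extDeriv_apply]
  rw [Fin.sum_univ_succ (n := k + 1)]
  simp only [Fin.sum_univ_succ (n := k) (f := fun j => α (Function.update (Fin.cons _ _) _ _)),
    r, Fin.cons_zero, Fin.cons_succ, Fin.removeNth_zero, Fin.tail_cons, Fin.val_zero,
    pow_zero, one_smul, Fin.val_succ, Fin.update_cons_zero, ← Fin.cons_update, e]
  rw [Finset.sum_sub_distrib, Finset.sum_neg_distrib, ← Finset.smul_sum]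
  module

end DForm

namespace TotalForm

/-- The exterior derivative as a linear map. -/
def extDerivLM : TotalForm E M →ₗ[ℝ] TotalForm E M where
  toFun := extDeriv
  map_add' := extDeriv_add
  map_smul' := extDeriv_smul

/-- The contraction with a vector field as a bilinear map. -/
def interiorLM : VecField E M →ₗ[ℝ] TotalForm E M →ₗ[ℝ] TotalForm E M :=
  LinearMap.mk₂ ℝ interior interior_add_left interior_smul_left
    (fun X β γ => by funext k; ext1 Y; simp [interior, DForm.interior_apply])
    (fun c X β => by funext k; ext1 Y; simp [interior, DForm.interior_apply])

theorem interiorLM_apply (X : VecField E M) (β : TotalForm E M) :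
    interiorLM X β = interior X β := rfl

/-- The bracket of vector fields as a bilinear map. -/
def bracketLM : VecField E M →ₗ[ℝ] VecField E M →ₗ[ℝ] VecField E M :=
  LinearMap.mk₂ ℝ (fun X Y => ⁅X, Y⁆) vecField_add_bracket vecField_const_smul_bracket
    vecField_bracket_add vecField_bracket_const_smul

theorem lieDeriv_succ_apply (X : VecField E M) (β : TotalForm E M) (k : ℕ)
    (Y : Fin (k + 1) → VecField E M) : lieDeriv X β (k + 1) Y
      = X.act (β (k + 1) Y) - ∑ j, β (k + 1) (Function.update Y j ⁅X, Y j⁆) :=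
  DForm.cartan_apply (β (k + 1)) X Y

theorem lieDeriv_zero_apply (X : VecField E M) (β : TotalForm E M)
    (Y : Fin 0 → VecField E M) : lieDeriv X β 0 Y = X.act (β 0 Y) := by
  have h : lieDeriv X β 0 Y
      = 0 + (β 0).extDeriv (Fin.cons X Y : Fin 1 → VecField E M) := rfl
  have hY : (0 : Fin 1).removeNth (Fin.cons X Y : Fin 1 → VecField E M) = Y := Subsingleton.elim _ _
  rw [h, DForm.extDeriv_apply]
  simp [hY]

/-- A form of positive degree is zero if all its contractions with vector fields vanish. -/
theorem eq_zero_of_interior {β : TotalForm E M} {k : ℕ}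
    (h : ∀ X, interior X β k = 0) : β (k + 1) = 0 := by
  ext1 Y
  have h1 := congrArg (fun α : DForm E M k => α (Fin.tail Y)) (h (Y 0))
  simpa [interior, DForm.interior_apply] using h1

theorem interior_interior_self (X : VecField E M) (β : TotalForm E M) :
    interior X (interior X β) = 0 := by
  funext k
  ext1 Y
  exact (β (k + 2)).map_eq_zero_of_eq _ (i := 0) (j := 1) (by simp [Matrix.vecCons]) (by simp)

theorem lieDeriv_interior (X Y : VecField E M) (β : TotalForm E M) :
    lieDeriv X (interior Y β) = interior ⁅X, Y⁆ β + interior Y (lieDeriv X β) := by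
  funext k
  ext1 Z
  have h2 : (interior ⁅X, Y⁆ β + interior Y (lieDeriv X β)) k Z
      = β (k + 1) (Fin.cons ⁅X, Y⁆ Z : Fin (k + 1) → VecField E M)
        + lieDeriv X β (k + 1) (Fin.cons Y Z : Fin (k + 1) → VecField E M) := rfl
  rw [h2, lieDeriv_succ_apply, Fin.sum_univ_succ]
  simp only [Fin.cons_zero, Fin.cons_succ, Fin.update_cons_zero, ← Fin.cons_update]
  cases k with
  | zero => rw [lieDeriv_zero_apply]; simp [interior, DForm.interior_apply]
  | succ k =>
    rw [lieDeriv_succ_apply]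
    simp only [interior, DForm.interior_apply]
    abel

theorem interior_add (X : VecField E M) (β γ : TotalForm E M) :
    interior X (β + γ) = interior X β + interior X γ := map_add (interiorLM X) β γ

theorem interior_sub (X : VecField E M) (β γ : TotalForm E M) :
    interior X (β - γ) = interior X β - interior X γ := map_sub (interiorLM X) β γ

theorem lieDeriv_add (X : VecField E M) (β γ : TotalForm E M) :
    lieDeriv X (β + γ) = lieDeriv X β + lieDeriv X γ := by
  simp only [lieDeriv, interior_add, extDeriv_add]; abel

/-- The Lie derivative is a representation of vector fields: on functions this is
`VecField.bracket_act`, and the general case follows by contracting with vector fields. -/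
theorem lieDeriv_lieDeriv (X Y : VecField E M) (β : TotalForm E M) :
    lieDeriv X (lieDeriv Y β) - lieDeriv Y (lieDeriv X β) = lieDeriv ⁅X, Y⁆ β := by
  funext k
  induction k generalizing β with
  | zero =>
    ext1 Z
    have h : (lieDeriv X (lieDeriv Y β) - lieDeriv Y (lieDeriv X β)) 0 Z
      = lieDeriv X (lieDeriv Y β) 0 Z - lieDeriv Y (lieDeriv X β) 0 Z := rfl
    rw [h]
    simp only [lieDeriv_zero_apply, VecField.bracket_act]
  | succ k ih =>
    refine sub_eq_zero.mp (eq_zero_of_interior (β := _ - lieDeriv ⁅X, Y⁆ β) fun Z => ?_)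
    have h := ih (interior Z β)
    simp only [lieDeriv_interior, lieDeriv_add] at h
    have j : interior ⁅⁅X, Y⁆, Z⁆ β = interior ⁅X, ⁅Y, Z⁆⁆ β - interior ⁅Y, ⁅X, Z⁆⁆ β := by
      rw [vecField_jacobi X Y Z, interior_add_left]; abel
    rw [j, ← sub_eq_zero] at h
    rw [interior_sub, interior_sub, ← h]
    simp only [Pi.add_apply, Pi.sub_apply]
    abel

/-- The Lie derivative commutes with the differential, by induction on the degree: after contraction
with `Z`, the claim reduces to the one in lower degree and to `lieDeriv_lieDeriv`. -/
theorem lieDeriv_extDeriv (X : VecField E M) (β : TotalForm E M) :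
    lieDeriv X (extDeriv β) = extDeriv (lieDeriv X β) := by
  funext k
  induction k generalizing β with
  | zero =>
    ext1 Z
    rw [lieDeriv_zero_apply]
    exact VecField.act_zero X
  | succ k ih =>
    refine sub_eq_zero.mp (eq_zero_of_interior
      (β := lieDeriv X (extDeriv β) - extDeriv (lieDeriv X β)) fun Z => ?_)
    have c : ∀ (Z : VecField E M) (β : TotalForm E M),
        interior Z (extDeriv β) = lieDeriv Z β - extDeriv (interior Z β) := by
      intro Z β; simp [lieDeriv]
    have h := ih (interior Z β)
    have h1 : interior Z (lieDeriv X (extDeriv β) - extDeriv (lieDeriv X β))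
      = lieDeriv X (lieDeriv Z β) - lieDeriv Z (lieDeriv X β) - lieDeriv ⁅X, Z⁆ β
        - (lieDeriv X (extDeriv (interior Z β)) - extDeriv (lieDeriv X (interior Z β))) := by
      have h2 := lieDeriv_interior X Z (extDeriv β)
      have h3 : lieDeriv X (lieDeriv Z β) = lieDeriv X (extDeriv (interior Z β))
          + lieDeriv X (interior Z (extDeriv β)) := lieDeriv_add _ _ _
      rw [interior_sub, c Z (lieDeriv X β), h3, h2, lieDeriv_interior, extDeriv_add,
        c ⁅X, Z⁆ β]
      abel
    rw [h1, lieDeriv_lieDeriv, sub_self, zero_sub, Pi.neg_apply, Pi.sub_apply, h, sub_self,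
      neg_zero]

/-- The differential squares to zero, by induction on the degree: contraction with `X` commutes with
`d ^ 2`, since `d` commutes with the Lie derivative along `X`. -/
theorem extDeriv_extDeriv (β : TotalForm E M) : extDeriv (extDeriv β) = 0 := by
  funext k
  induction k generalizing β with
  | zero => rfl
  | succ k ih =>
    refine eq_zero_of_interior fun X => ?_
    have h := lieDeriv_extDeriv X β
    have h1 : interior X (extDeriv (extDeriv β)) = extDeriv (extDeriv (interior X β)) := by
      simp only [lieDeriv, extDeriv_add] at h
      have h2 := add_right_cancel ((add_comm _ _).trans h)
      exact h2
    rw [h1, ih]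
    rfl

end TotalForm
end Cartan
/-! ### The Bernoulli power series and the operator identities which they satisfy -/

section Series

open PowerSeries

/-- The series `F = t / (e^t - 1) = ∑ B_k t^k / k!`. -/
def bernSeries : ℝ⟦X⟧ := bernoulliPowerSeries ℝ

/-- The series `(1 - F) / t`. -/
def lieSeries : ℝ⟦X⟧ := mk fun k => -coeff (k + 1) bernSeries

/-- The series `(1 - t / 2 - F) / t ^ 2`. -/
def curvSeries : ℝ⟦X⟧ := mk fun k => -coeff (k + 2) bernSeries

/-- The series `1 - t - e^{-t}`. -/
def obsSeries : ℝ⟦X⟧ := 1 - X - evalNegHom (exp ℝ)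

theorem coeff_bernSeries (k : ℕ) :
    coeff k bernSeries = (bernoulli k : ℝ) / (k.factorial : ℝ) := by
  simp [bernSeries, bernoulliPowerSeries]

theorem bernSeries_mul : bernSeries * (exp ℝ - 1) = X := bernoulliPowerSeries_mul_exp_sub_one ℝ

theorem X_mul_lieSeries : X * lieSeries = 1 - bernSeries := by
  ext k
  cases k with
  | zero =>
    have := coeff_bernSeries 0
    simp at this
    simp [this]
  | succ k => simp [lieSeries, coeff_succ_X_mul, coeff_one]

theorem X_mul_curvSeries : X * curvSeries = lieSeries - C (1 / 2 : ℝ) := by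
  ext k
  cases k with
  | zero =>
    simp [lieSeries, coeff_bernSeries]
    norm_num
  | succ k => simp [lieSeries, curvSeries, coeff_succ_X_mul]

theorem two_mul_C_half : (2 : ℝ⟦X⟧) * C (1 / 2 : ℝ) = 1 := by
  rw [show (2 : ℝ⟦X⟧) = C (2 : ℝ) from (map_ofNat C 2).symm, ← map_mul]; norm_num

theorem deriv_bernSeries : d⁄dX ℝ bernSeries = (lieSeries - 1) * bernSeries := by
  have h := congrArg (d⁄dX ℝ) bernSeries_mul
  have hX := X_mul_lieSeries
  have hb := bernSeries_mul
  simp only [Derivation.leibniz, map_sub, derivative_exp, smul_eq_mul, derivative_X,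
    Derivation.map_one_eq_zero, sub_zero] at h
  refine mul_left_cancel₀ (X_ne_zero (R := ℝ)) ?_
  linear_combination bernSeries * h - (bernSeries + d⁄dX ℝ bernSeries) * hb - bernSeries * hX

/-- The Riccati equation for `a = lieSeries`, with `b = curvSeries`. -/
theorem two_mul_curvSeries :
    2 * curvSeries = lieSeries ^ 2 - lieSeries - d⁄dX ℝ lieSeries := by
  have h := congrArg (d⁄dX ℝ) X_mul_lieSeries
  have hX := X_mul_lieSeries
  have hb := X_mul_curvSeries
  simp only [Derivation.leibniz, map_sub, smul_eq_mul, derivative_X,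
    Derivation.map_one_eq_zero, deriv_bernSeries] at h
  refine mul_left_cancel₀ (X_ne_zero (R := ℝ)) ?_
  linear_combination 2 * hb + h - two_mul_C_half - (lieSeries - 1) * hX

theorem deriv_one_sub_bernSeries : d⁄dX ℝ (X * (1 - bernSeries))
    = lieSeries * (X * (1 - bernSeries)) + X * bernSeries := by
  simp only [Derivation.leibniz, map_sub, smul_eq_mul, derivative_X,
    Derivation.map_one_eq_zero, deriv_bernSeries]
  linear_combination -X_mul_lieSeries

theorem deriv_bernSeries_add_X : d⁄dX ℝ (bernSeries + X) = lieSeries * (bernSeries + X) := by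
  simp only [map_add, derivative_X, deriv_bernSeries]
  linear_combination -X_mul_lieSeries

/-- The relation by which the isomorphism transforms the terms which contain `ϖ`. -/
theorem bernSeries_mul_obsSeries :
    (bernSeries + X) * obsSeries = X * (1 - bernSeries) - X ^ 2 := by
  have h := exp_mul_exp_neg_eq_one (A := ℝ)
  have hb := bernSeries_mul
  rw [obsSeries]
  linear_combination (evalNegHom (exp ℝ)) * hb - bernSeries * h

theorem deriv_evalNegHom_exp :
    d⁄dX ℝ (evalNegHom (exp ℝ)) = -evalNegHom (exp ℝ) := by
  have h := congrArg (d⁄dX ℝ) (exp_mul_exp_neg_eq_one (A := ℝ))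
  have h1 := exp_mul_exp_neg_eq_one (A := ℝ)
  simp only [Derivation.leibniz, smul_eq_mul, derivative_exp, Derivation.map_one_eq_zero] at h
  linear_combination (evalNegHom (exp ℝ)) * h
    - (d⁄dX ℝ (evalNegHom (exp ℝ)) + evalNegHom (exp ℝ)) * h1

theorem deriv_obsSeries : d⁄dX ℝ obsSeries = -1 + evalNegHom (exp ℝ) := by
  simp [obsSeries, deriv_evalNegHom_exp, derivative_X]

theorem coeff_obsSeries (k : ℕ) :
    coeff (k + 2) obsSeries = (-1) ^ (k + 3) / ((k + 2).factorial : ℝ) := by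
  simp [obsSeries, evalNegHom, coeff_one, coeff_X, coeff_exp, coeff_rescale]
  ring

/-- Operators `d`, `L = [t, d]` and `Q = [t, L]` on a module over a commutative ring `P` with
a derivation `δ`, to be thought of as a ring of power series in `t`, subject to the relations which
hold if `d ^ 2 = 0` and `[t, Q] = 0`. The element `h` of `P` plays the role of one half. -/
structure SeriesOps {P : Type*} [CommRing P] (δ : P → P) (h : P)
    (A : Type*) [AddCommGroup A] [Module P A] where
  /-- The differential. -/
  d : A →+ A
  /-- The commutator of `t` and `d`. -/
  L : A →+ A
  /-- The iterated commutator of `t` and `d`. -/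
  Q : A →+ A
  two_mul_half : 2 * h = 1
  d_smul : ∀ (f : P) (v : A), d (f • v) = f • d v - δ f • L v + (h * δ (δ f)) • Q v
  L_smul : ∀ (f : P) (v : A), L (f • v) = f • L v - δ f • Q v
  Q_smul : ∀ (f : P) (v : A), Q (f • v) = f • Q v
  d_d : ∀ v, d (d v) = 0
  d_L : ∀ v, d (L v) = -L (d v)
  L_L : ∀ v, L (L v) = -(h • (Q (d v) + d (Q v)))
  L_Q : ∀ v, L (Q v) = -Q (L v)
  Q_Q : ∀ v, Q (Q v) = 0

namespace SeriesOps

variable {P : Type*} [CommRing P] {δ : P → P} {h : P}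
  {A : Type*} [AddCommGroup A] [Module P A] (O : SeriesOps δ h A)

/-- The operator `d + a L + b Q`. -/
def conn (a b : P) (v : A) : A := O.d v + a • O.L v + b • O.Q v

/-- The curvature of `conn a b`, if `a` and `b` satisfy the Riccati equation `2 b = a ^ 2 - a - a'`.
The derivative of this equation is a separate hypothesis, because `δ` is not assumed to satisfy the
Leibniz rule. -/
theorem conn_conn {a b : P} (hb : 2 * b = a ^ 2 - a - δ a)
    (hb' : 2 * δ b = 2 * a * δ a - δ a - δ (δ a)) (v : A) :
    O.conn a b (O.conn a b v) + (h * δ a) • O.Q (O.L v)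
      + (h * a) • (O.Q (O.d v) + O.d (O.Q v)) = 0 := by
  have hh := O.two_mul_half
  simp only [conn, map_add, O.d_smul, O.L_smul, O.Q_smul, O.d_d, O.d_L, O.L_L, O.L_Q, O.Q_Q]
  match_scalars
  · ring
  · linear_combination h * hb - b * hh
  · linear_combination h * hb - b * hh
  · linear_combination h * hb' - δ b * hh + a * δ a * hh

/-- The identity behind the homotopy Jacobi identities with values in forms. Here `v` stands for
`φ`, `u` for `d π φ` and `x` for `ϖ`, and `w` for the series `t (1 - F)`. The first line is the
structure applied to its own value, where the subtracted term is `F(R) d π` of this value; the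
second line is the change of the operators under the shift of `X` by `[X, X] / 2`. -/
theorem conn_square {t a b F w : P} (hb : 2 * b = a ^ 2 - a - δ a)
    (hb' : 2 * δ b = 2 * a * δ a - δ a - δ (δ a)) (hF : δ F = (a - 1) * F)
    (hF' : δ (δ F) = δ a * F + (a - 1) ^ 2 * F) (hw' : δ w = a * w + t * F)
    (hw'' : δ (δ w) = δ a * w + a * δ w + F + t * δ F)
    {v u x : A} (hu : O.d u = 0) (hx : O.d x = 0) :
    O.conn a b (O.conn a b v - F • u + w • x) - F • (-O.L u - t • O.L x + h • O.Q x)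
      + (h * δ a) • O.Q (O.L v) + (h * a) • (O.Q (O.d v) + O.d (O.Q v)) - (h * δ F) • O.Q u
      + (h * δ w) • O.Q x = 0 := by
  have hh := O.two_mul_half
  have h0 : O.conn a b (O.conn a b v - F • u + w • x)
    = O.conn a b (O.conn a b v) - O.conn a b (F • u) + O.conn a b (w • x) := by
    simp only [conn, map_add, map_sub, smul_add, smul_sub]; abel
  have h1 := O.conn_conn hb hb' v
  have h2 : O.conn a b (F • u) + (h * δ F) • O.Q u = F • O.L u := by
    simp only [conn, O.d_smul, O.L_smul, O.Q_smul, hu]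
    match_scalars
    · linear_combination -hF
    · linear_combination h * hF' + (h - a) * hF + F * (h * hb - b * hh) + F * (a ^ 2 - a) * hh
  have h3 : O.conn a b (w • x) + (F * t) • O.L x - (F * h) • O.Q x + (h * δ w) • O.Q x = 0 := by
    simp only [conn, O.d_smul, O.L_smul, O.Q_smul, hx]
    match_scalars
    · linear_combination -hw'
    · linear_combination h * hw'' + (h * a + h - a) * hw' + w * (h * hb - b * hh) + h * t * hF
        + a * (a * w + t * F) * hh
  rw [h0]
  linear_combination (norm := module) (1 : P) • h1 - (1 : P) • h2 + (1 : P) • h3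

/-- The identity behind the compatibility of the isomorphism with the codifferentials, for
Hamiltonian arguments, which satisfy `u = - t x` in the notation of `conn_square`. -/
theorem conn_intertwine {t a b F w G r : P} (hb : 2 * b = a ^ 2 - a - δ a)
    (hG : δ G = a * G) (hG' : δ (δ G) = δ a * G + a * δ G) (hGF : G = F + t)
    (hr : G * r = w - t ^ 2) {v u x : A} (hux : u = -(t • x)) :
    O.conn a b (G • v) - F • u + w • x = G • (r • x + O.d v - u) - (h * δ G) • O.Q v := by
  have hh := O.two_mul_half
  subst hux
  simp only [conn, O.d_smul, O.L_smul, O.Q_smul]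
  match_scalars
  · ring
  · linear_combination -hG
  · linear_combination h * hG' + (h * a + h - a) * hG + G * (h * hb - b * hh) + G * a ^ 2 * hh
  · linear_combination -hr - t * hGF

/-- The identity behind the homotopy Jacobi identities of the local observables. The Lie derivative
`L x` of `x = ϖ` vanishes, because Hamiltonian vector fields preserve `ϖ`. -/
theorem obs_square {r : P} (hr : δ (δ r) = -1 - δ r) {x : A} (hx : O.d x = 0) (hLx : O.L x = 0) :
    O.d (r • x) + h • O.Q x + (h * δ r) • O.Q x = 0 := by
  rw [O.d_smul, hx, hLx, hr]
  module

variable {A' : Type*} [AddCommGroup A'] [Module ℝ⟦X⟧ A']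

/-- `conn_square` for the Bernoulli series. -/
theorem bern_square (O : SeriesOps (d⁄dX ℝ) (C (1 / 2 : ℝ)) A') {v u x : A'} (hu : O.d u = 0)
    (hx : O.d x = 0) :
    O.conn lieSeries curvSeries (O.conn lieSeries curvSeries v - bernSeries • u
        + (X * (1 - bernSeries)) • x)
      - bernSeries • (-O.L u - (X : ℝ⟦X⟧) • O.L x + C (1 / 2 : ℝ) • O.Q x)
      + (C (1 / 2 : ℝ) * d⁄dX ℝ lieSeries) • O.Q (O.L v)
      + (C (1 / 2 : ℝ) * lieSeries) • (O.Q (O.d v) + O.d (O.Q v))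
      - (C (1 / 2 : ℝ) * d⁄dX ℝ bernSeries) • O.Q u
      + (C (1 / 2 : ℝ) * d⁄dX ℝ (X * (1 - bernSeries))) • O.Q x = 0 := by
  have h3 := congrArg (d⁄dX ℝ) two_mul_curvSeries
  have h20 : d⁄dX ℝ (2 : ℝ⟦X⟧) = 0 := by
    rw [show (2 : ℝ⟦X⟧) = ((2 : ℕ) : ℝ⟦X⟧) by simp, Derivation.map_natCast]
  have h4 := congrArg (d⁄dX ℝ) deriv_bernSeries
  simp only [Derivation.leibniz, map_sub, smul_eq_mul, pow_two, h20,
    Derivation.map_one_eq_zero] at h3 h4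
  refine O.conn_square two_mul_curvSeries ?_ deriv_bernSeries ?_ deriv_one_sub_bernSeries ?_ hu hx
  · linear_combination h3
  · linear_combination h4 + (lieSeries - 1) * deriv_bernSeries
  · conv_lhs => rw [deriv_one_sub_bernSeries, map_add,
      Derivation.leibniz _ lieSeries (X * (1 - bernSeries)), Derivation.leibniz _ X bernSeries,
      derivative_X]
    simp only [smul_eq_mul]
    ring

/-- `conn_intertwine` for the Bernoulli series. -/
theorem bern_intertwine (O : SeriesOps (d⁄dX ℝ) (C (1 / 2 : ℝ)) A') {v u x : A'}
    (hux : u = -((X : ℝ⟦X⟧) • x)) :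
    O.conn lieSeries curvSeries ((bernSeries + X) • v) - bernSeries • u
        + (X * (1 - bernSeries)) • x
      = (bernSeries + X) • (obsSeries • x + O.d v - u)
        - (C (1 / 2 : ℝ) * d⁄dX ℝ (bernSeries + X)) • O.Q v := by
  refine O.conn_intertwine two_mul_curvSeries deriv_bernSeries_add_X ?_ rfl
    bernSeries_mul_obsSeries hux
  rw [deriv_bernSeries_add_X, Derivation.leibniz, deriv_bernSeries_add_X]
  simp only [smul_eq_mul]
  ring

/-- `obs_square` for the series `1 - t - e ^ (-t)`. -/
theorem obsSeries_square (O : SeriesOps (d⁄dX ℝ) (C (1 / 2 : ℝ)) A') {x : A'} (hx : O.d x = 0)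
    (hLx : O.L x = 0) :
    O.d (obsSeries • x) + C (1 / 2 : ℝ) • O.Q x + (C (1 / 2 : ℝ) * d⁄dX ℝ obsSeries) • O.Q x
      = 0 := by
  refine O.obs_square ?_ hx hLx
  rw [deriv_obsSeries, map_add, deriv_evalNegHom_exp, map_neg, Derivation.map_one_eq_zero]
  ring

end SeriesOps

end Series
/-! ### Power series of nilpotent operators -/

section SeriesAction

open PowerSeries

variable {A : Type*} [AddCommGroup A] [Module ℝ A]

/-- The truncated evaluation `∑_{k < N} f_k R ^ k` of a power series at an endomorphism. -/
def evalSeries (N : ℕ) (R : Module.End ℝ A) (f : ℝ⟦X⟧) : Module.End ℝ A :=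
  ∑ k ∈ Finset.range N, coeff k f • R ^ k

theorem evalSeries_eq_of_le {N N' : ℕ} {R : Module.End ℝ A} (hR : R ^ N = 0) (h : N ≤ N')
    (f : ℝ⟦X⟧) : evalSeries N' R f = evalSeries N R f := by
  refine (Finset.sum_subset (Finset.range_mono h) fun k _ hk => ?_).symm
  rw [pow_eq_zero_of_le (by simpa using hk) hR, smul_zero]

theorem evalSeries_eq_aeval (N : ℕ) (R : Module.End ℝ A) (f : ℝ⟦X⟧) :
    evalSeries N R f = Polynomial.aeval R (trunc N f) := by
  cases N with
  | zero => simp [evalSeries]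
  | succ N =>
    rw [Polynomial.aeval_eq_sum_range' (natDegree_trunc_lt f N), evalSeries]
    refine Finset.sum_congr rfl fun k hk => ?_
    rw [coeff_trunc, if_pos (by simpa using hk)]

theorem aeval_trunc {N : ℕ} {R : Module.End ℝ A} (hR : R ^ N = 0) (p : Polynomial ℝ) :
    Polynomial.aeval R (trunc N (p : ℝ⟦X⟧)) = Polynomial.aeval R p := by
  rw [← evalSeries_eq_aeval, Polynomial.aeval_eq_sum_range]
  rw [← evalSeries_eq_of_le hR (le_max_left N (p.natDegree + 1)), evalSeries]
  simp only [Polynomial.coeff_coe]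
  refine (Finset.sum_subset (Finset.range_mono (le_max_right _ _)) fun k _ hk => ?_).symm
  rw [Polynomial.coeff_eq_zero_of_natDegree_lt (by simpa using hk), zero_smul]

/-- Evaluation of power series at a nilpotent endomorphism. -/
def evalSeriesHom {N : ℕ} {R : Module.End ℝ A} (hR : R ^ N = 0) :
    ℝ⟦X⟧ →+* Module.End ℝ A where
  toFun := evalSeries N R
  map_one' := by
    rw [evalSeries_eq_aeval, ← Polynomial.coe_one, aeval_trunc hR, map_one]
  map_mul' f g := by
    simp only [evalSeries_eq_aeval]
    rw [← map_mul, ← aeval_trunc hR (trunc N f * trunc N g), Polynomial.coe_mul,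
      trunc_trunc_mul_trunc]
  map_zero' := by simp [evalSeries]
  map_add' f g := by simp [evalSeries, add_smul, Finset.sum_add_distrib]

theorem evalSeries_mul {N : ℕ} {R : Module.End ℝ A} (hR : R ^ N = 0) (f g : ℝ⟦X⟧) :
    evalSeries N R (f * g) = evalSeries N R f * evalSeries N R g := map_mul (evalSeriesHom hR) f g

theorem evalSeries_C {N : ℕ} {R : Module.End ℝ A} (hR : R ^ N = 0) (c : ℝ) :
    evalSeries N R (C c) = c • 1 := by
  rw [evalSeries_eq_aeval, ← Polynomial.coe_C, aeval_trunc hR, Polynomial.aeval_C,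
    Algebra.algebraMap_eq_smul_one]

theorem evalSeries_X {N : ℕ} {R : Module.End ℝ A} (hR : R ^ N = 0) :
    evalSeries N R X = R := by
  rw [evalSeries_eq_aeval, ← Polynomial.coe_X, aeval_trunc hR, Polynomial.aeval_X]

/-- The derivative with respect to `R` of the evaluation. -/
theorem sum_range_deriv (N : ℕ) (R : Module.End ℝ A) (f : ℝ⟦X⟧) :
    ∑ k ∈ Finset.range (N + 1), coeff k f • (k • R ^ (k - 1)) = evalSeries N R (d⁄dX ℝ f) := by
  rw [Finset.sum_range_succ']
  simp only [zero_smul, smul_zero, add_zero, evalSeries, coeff_derivative]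
  refine Finset.sum_congr rfl fun k _ => ?_
  rw [Nat.add_sub_cancel, ← Nat.cast_smul_eq_nsmul ℝ, smul_smul]
  push_cast
  rfl

section Commutators

variable {R d L Q : Module.End ℝ A}

/-- `[L, R ^ k] = - k R ^ (k - 1) Q`. For `k = 0` the coefficient vanishes, so that the truncated
subtraction does no harm. -/
theorem mul_pow_of_commute_curv (hL : L * R = R * L - Q) (hQ : Q * R = R * Q) (k : ℕ) :
    L * R ^ k = R ^ k * L - k • (R ^ (k - 1) * Q) := by
  induction k with
  | zero => simp
  | succ k ih =>
    have hk : k • (R ^ (k - 1) * R) = k • R ^ k := by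
      cases k with
      | zero => simp
      | succ k => simp [pow_succ]
    rw [pow_succ, ← mul_assoc, ih, sub_mul, mul_assoc (R ^ k), hL, smul_mul_assoc, mul_assoc _ Q,
      hQ, ← mul_assoc _ R Q, ← smul_mul_assoc, hk, Nat.add_sub_cancel, mul_sub, succ_nsmul,
      smul_mul_assoc, mul_assoc]
    abel

/-- `[d, R ^ k] = - k R ^ (k - 1) L + k (k - 1) / 2 R ^ (k - 2) Q`. Where the subtraction of
exponents is truncated, the coefficient vanishes. -/
theorem mul_pow_of_commutators (hd : d * R = R * d - L) (hL : L * R = R * L - Q)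
    (hQ : Q * R = R * Q) (k : ℕ) :
    d * R ^ k = R ^ k * d - k • (R ^ (k - 1) * L)
      + (1 / 2 : ℝ) • k • (k - 1) • (R ^ (k - 1 - 1) * Q) := by
  induction k with
  | zero => simp
  | succ k ih =>
    have hk : k • (R ^ (k - 1) * R) = k • R ^ k := by
      cases k with
      | zero => simp
      | succ k => simp [pow_succ]
    have hk2 : k • (k - 1) • (R ^ (k - 1 - 1) * R) = k • (k - 1) • R ^ (k - 1) := by
      rcases k with _ | _ | k
      · simp
      · simp
      · simp [pow_succ]
    have e1 : k • (R ^ (k - 1) * L * R) = k • (R ^ k * L) - k • (R ^ (k - 1) * Q) := by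
      rw [mul_assoc, hL, mul_sub, smul_sub, ← mul_assoc, ← smul_mul_assoc k (R ^ (k - 1) * R), hk,
        smul_mul_assoc]
    have e2 : k • (k - 1) • (R ^ (k - 1 - 1) * Q * R) = k • (k - 1) • (R ^ (k - 1) * Q) := by
      rw [mul_assoc, hQ, ← mul_assoc, ← smul_mul_assoc, ← smul_mul_assoc, hk2, smul_mul_assoc,
        smul_mul_assoc]
    rw [pow_succ, ← mul_assoc, ih, add_mul, sub_mul, mul_assoc (R ^ k), hd, mul_sub,
      smul_mul_assoc k, e1, smul_mul_assoc, smul_mul_assoc, smul_mul_assoc, e2, Nat.add_sub_cancel,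
      ← mul_assoc]
    have e3 : (k : ℕ) • (k - 1) • (R ^ (k - 1) * Q)
      = ((k : ℝ) * ((k : ℝ) - 1)) • (R ^ (k - 1) * Q) := by
      rcases k with _ | k
      · simp
      · simp only [Nat.add_sub_cancel, ← Nat.cast_smul_eq_nsmul ℝ, smul_smul]
        push_cast
        congr 1
        ring
    rw [e3]
    simp only [← Nat.cast_smul_eq_nsmul ℝ]
    push_cast
    module

theorem mul_evalSeries_of_commute_curv {N : ℕ} (hR : R ^ N = 0) (hL : L * R = R * L - Q)
    (hQ : Q * R = R * Q) (f : ℝ⟦X⟧) :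
    L * evalSeries N R f = evalSeries N R f * L - evalSeries N R (d⁄dX ℝ f) * Q := by
  rw [← sum_range_deriv, ← evalSeries_eq_of_le hR (Nat.le_succ N) f]
  simp only [evalSeries, Finset.mul_sum, Finset.sum_mul, mul_smul_comm,
    mul_pow_of_commute_curv hL hQ, smul_sub, Finset.sum_sub_distrib, smul_mul_assoc]

/-- Taylor's formula `d f(R) = f(R) d - f'(R) L + f''(R) Q / 2`; it ends with the second derivative,
because `Q` commutes with `R`. -/
theorem mul_evalSeries_of_commutators {N : ℕ} (hR : R ^ N = 0) (hd : d * R = R * d - L)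
    (hL : L * R = R * L - Q) (hQ : Q * R = R * Q) (f : ℝ⟦X⟧) :
    d * evalSeries N R f = evalSeries N R f * d - evalSeries N R (d⁄dX ℝ f) * L
      + (1 / 2 : ℝ) • (evalSeries N R (d⁄dX ℝ (d⁄dX ℝ f)) * Q) := by
  have e : evalSeries N R (d⁄dX ℝ (d⁄dX ℝ f))
      = ∑ k ∈ Finset.range (N + 2), coeff k f • k • (k - 1) • R ^ (k - 1 - 1) := by
    rw [← sum_range_deriv, Finset.sum_range_succ' _ (N + 1)]
    simp only [coeff_derivative, zero_smul, smul_zero, add_zero, Nat.add_sub_cancel]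
    refine Finset.sum_congr rfl fun k _ => ?_
    simp only [← Nat.cast_smul_eq_nsmul ℝ, smul_smul]
    push_cast
    congr 1
    ring
  rw [e, ← evalSeries_eq_of_le hR (Nat.le_succ N) (d⁄dX ℝ f), ← sum_range_deriv,
    ← evalSeries_eq_of_le hR (Nat.le_add_right N 2) f]
  simp only [evalSeries, Finset.mul_sum, Finset.sum_mul, mul_smul_comm,
    mul_pow_of_commutators hd hL hQ, smul_sub, smul_add, Finset.sum_sub_distrib,
    Finset.sum_add_distrib, smul_mul_assoc, Finset.smul_sum]
  congr 1
  refine Finset.sum_congr rfl fun k _ => ?_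
  rw [smul_comm (coeff k f) (1 / 2 : ℝ)]

/-- The commutator of `R` with `d ^ 2 = 0`. -/
theorem anticomm_of_sq (hdd : d * d = 0) (hd : d * R = R * d - L) : d * L = -(L * d) := by
  have hL : L = R * d - d * R := by rw [hd]; abel
  rw [hL]
  have : d * (R * d - d * R) + (R * d - d * R) * d = R * (d * d) - d * d * R := by noncomm_ring
  rw [hdd] at this
  simpa using eq_neg_of_add_eq_zero_left (by simpa using this)

/-- The commutator of `R` with `d L + L d = 0`. -/
theorem sq_of_sq (hdd : d * d = 0) (hd : d * R = R * d - L) (hL : L * R = R * L - Q) :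
    L * L = -((1 / 2 : ℝ) • (Q * d + d * Q)) := by
  have h := anticomm_of_sq hdd hd
  have eL : L = R * d - d * R := by rw [hd]; abel
  have eQ : Q = R * L - L * R := by rw [hL]; abel
  have h2 : (Q * d + d * Q) + (2 : ℝ) • (L * L) = R * (d * L + L * d) - (d * L + L * d) * R := by
    have e : R * (d * L + L * d) - (d * L + L * d) * R
      = (R * L - L * R) * d + d * (R * L - L * R)
        + (L * (R * d - d * R) + (R * d - d * R) * L) := by
      noncomm_ring
    rw [e, ← eL, ← eQ, two_smul]
  rw [h, neg_add_cancel, mul_zero, zero_mul, sub_zero] at h2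
  rw [eq_neg_of_add_eq_zero_left h2]
  module

/-- The commutator of `R` with the relation `sq_of_sq`. -/
theorem anticomm_curv (hdd : d * d = 0) (hd : d * R = R * d - L) (hL : L * R = R * L - Q)
    (hQ : Q * R = R * Q) : L * Q = -(Q * L) := by
  have h := sq_of_sq hdd hd hL
  have eL : L = R * d - d * R := by rw [hd]; abel
  have eQ : Q = R * L - L * R := by rw [hL]; abel
  have h2 : Q * L + L * Q = R * (L * L) - L * L * R := by
    rw [eQ]; noncomm_ring
  have h3 : Q * L + L * Q = R * (Q * d + d * Q) - (Q * d + d * Q) * R := by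
    have : R * (Q * d + d * Q) - (Q * d + d * Q) * R
      = Q * (R * d - d * R) + (R * d - d * R) * Q + (R * Q - Q * R) * d + d * (R * Q - Q * R) := by
      noncomm_ring
    rw [this, ← eL, hQ]
    simp
  have h4 : Q * L + L * Q = -((1 / 2 : ℝ) • (Q * L + L * Q)) := by
    nth_rewrite 2 [h3]
    rw [h2, h, smul_sub, mul_neg, neg_mul, mul_smul_comm, smul_mul_assoc]
    abel
  have h5 : (3 / 2 : ℝ) • (Q * L + L * Q) = 0 := by
    have : (3 / 2 : ℝ) • (Q * L + L * Q) = (Q * L + L * Q) + (1 / 2 : ℝ) • (Q * L + L * Q) := by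
      module
    rw [this]
    nth_rewrite 1 [h4]
    simp
  rw [smul_eq_zero] at h5
  exact eq_neg_of_add_eq_zero_right (h5.resolve_left (by norm_num))

/-- The commutator of `R` with `L Q + Q L = 0`. -/
theorem sq_curv (hdd : d * d = 0) (hd : d * R = R * d - L) (hL : L * R = R * L - Q)
    (hQ : Q * R = R * Q) : Q * Q = 0 := by
  have h := anticomm_curv hdd hd hL hQ
  have eQ : Q = R * L - L * R := by rw [hL]; abel
  have h2 : Q * Q + Q * Q = R * (Q * L + L * Q) - (Q * L + L * Q) * R := by
    have : R * (Q * L + L * Q) - (Q * L + L * Q) * R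
      = Q * (R * L - L * R) + (R * L - L * R) * Q + (R * Q - Q * R) * L + L * (R * Q - Q * R) := by
      noncomm_ring
    rw [this, ← eQ, hQ]
    simp
  rw [h] at h2
  have h3 : (2 : ℝ) • (Q * Q) = 0 := by rw [two_smul, h2]; simp
  exact (smul_eq_zero.mp h3).resolve_left (by norm_num)

/-- The operators on a real vector space, on which power series act through the nilpotent
endomorphism `R`. -/
def seriesOps {N : ℕ} (hR : R ^ N = 0) (hdd : d * d = 0) (hd : d * R = R * d - L)
    (hL : L * R = R * L - Q) (hQ : Q * R = R * Q) :
    letI := Module.compHom A (evalSeriesHom hR)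
    SeriesOps (d⁄dX ℝ) (C (1 / 2 : ℝ)) A :=
  letI := Module.compHom A (evalSeriesHom hR)
  have hc : ∀ (f : ℝ⟦X⟧) (v : A), (C (1 / 2 : ℝ) * f) • v = (1 / 2 : ℝ) • evalSeries N R f v := by
    intro f v
    change evalSeries N R (C (1 / 2 : ℝ) * f) v = _
    rw [evalSeries_mul hR, evalSeries_C hR]
    simp
  { d := d.toAddMonoidHom
    L := L.toAddMonoidHom
    Q := Q.toAddMonoidHom
    two_mul_half := two_mul_C_half
    d_smul := fun f v => by
      rw [hc]
      exact LinearMap.congr_fun (mul_evalSeries_of_commutators hR hd hL hQ f) v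
    L_smul := fun f v => LinearMap.congr_fun (mul_evalSeries_of_commute_curv hR hL hQ f) v
    Q_smul := fun f v => by
      have h : Q * evalSeries N R f = evalSeries N R f * Q := by
        simp only [evalSeries, Finset.mul_sum, Finset.sum_mul, mul_smul_comm, smul_mul_assoc]
        exact Finset.sum_congr rfl fun k _ => by rw [(show Commute Q R from hQ).pow_right k]
      exact LinearMap.congr_fun h v
    d_d := fun v => LinearMap.congr_fun hdd v
    d_L := fun v => LinearMap.congr_fun (anticomm_of_sq hdd hd) v
    L_L := fun v => by
      have := hc 1 ((Q * d + d * Q) v)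
      rw [mul_one, show evalSeries N R 1 = 1 from map_one (evalSeriesHom hR)] at this
      refine (LinearMap.congr_fun (sq_of_sq hdd hd hL) v).trans ?_
      exact congrArg Neg.neg this.symm
    L_Q := fun v => LinearMap.congr_fun (anticomm_curv hdd hd hL hQ) v
    Q_Q := fun v => LinearMap.congr_fun (sq_curv hdd hd hL hQ) v }

/-- The operator `d + a(R) L + b(R) Q`, where `a = (1 - F) / t` and `b = (1 - t / 2 - F) / t ^ 2`
for `F = t / (e ^ t - 1)`. -/
def bernConn (N : ℕ) (R d L Q : Module.End ℝ A) : Module.End ℝ A :=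
  d + evalSeries N R lieSeries * L + evalSeries N R curvSeries * Q

/-- `SeriesOps.bern_square` for the action of power series through `R`. -/
theorem bernConn_square {N : ℕ} (hR : R ^ N = 0) (hdd : d * d = 0) (hd : d * R = R * d - L)
    (hL : L * R = R * L - Q) (hQ : Q * R = R * Q) {v u x : A} (hu : d u = 0) (hx : d x = 0) :
    bernConn N R d L Q (bernConn N R d L Q v - evalSeries N R bernSeries u
        + evalSeries N R (X * (1 - bernSeries)) x)
      - evalSeries N R bernSeries (-L u - R (L x) + (1 / 2 : ℝ) • Q x)
      + (1 / 2 : ℝ) • evalSeries N R (d⁄dX ℝ lieSeries) (Q (L v))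
      + (1 / 2 : ℝ) • evalSeries N R lieSeries (Q (d v) + d (Q v))
      - (1 / 2 : ℝ) • evalSeries N R (d⁄dX ℝ bernSeries) (Q u)
      + (1 / 2 : ℝ) • evalSeries N R (d⁄dX ℝ (X * (1 - bernSeries))) (Q x) = 0 := by
  letI := Module.compHom A (evalSeriesHom hR)
  have hs : ∀ (f : ℝ⟦X⟧) (v : A), f • v = evalSeries N R f v := fun _ _ => rfl
  have h := SeriesOps.bern_square (seriesOps hR hdd hd hL hQ) (v := v) hu hx
  simp only [SeriesOps.conn, hs, evalSeries_mul hR (C (1 / 2 : ℝ)), evalSeries_C hR,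
    evalSeries_X hR, smul_mul_assoc, one_mul, LinearMap.smul_apply, Module.End.one_apply] at h
  exact h

/-- `SeriesOps.bern_intertwine` for the action of power series through `R`. -/
theorem bernConn_intertwine {N : ℕ} (hR : R ^ N = 0) (hdd : d * d = 0) (hd : d * R = R * d - L)
    (hL : L * R = R * L - Q) (hQ : Q * R = R * Q) {v u x : A} (hux : u = -R x) :
    bernConn N R d L Q (evalSeries N R (bernSeries + X) v) - evalSeries N R bernSeries u
        + evalSeries N R (X * (1 - bernSeries)) x
      = evalSeries N R (bernSeries + X) (evalSeries N R obsSeries x + d v - u)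
        - (1 / 2 : ℝ) • evalSeries N R (d⁄dX ℝ (bernSeries + X)) (Q v) := by
  letI := Module.compHom A (evalSeriesHom hR)
  have hs : ∀ (f : ℝ⟦X⟧) (v : A), f • v = evalSeries N R f v := fun _ _ => rfl
  have h := SeriesOps.bern_intertwine (seriesOps hR hdd hd hL hQ) (v := v) (u := u) (x := x)
    (by rw [hs, evalSeries_X hR, hux])
  simp only [SeriesOps.conn, hs, evalSeries_mul hR (C (1 / 2 : ℝ)), evalSeries_C hR,
    smul_mul_assoc, one_mul, LinearMap.smul_apply] at h
  exact h

/-- `SeriesOps.obsSeries_square` for the action of power series through `R`. -/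
theorem evalSeries_obs_square {N : ℕ} (hR : R ^ N = 0) (hdd : d * d = 0) (hd : d * R = R * d - L)
    (hL : L * R = R * L - Q) (hQ : Q * R = R * Q) {x : A} (hx : d x = 0) (hLx : L x = 0) :
    d (evalSeries N R obsSeries x) + (1 / 2 : ℝ) • Q x
      + (1 / 2 : ℝ) • evalSeries N R (d⁄dX ℝ obsSeries) (Q x) = 0 := by
  letI := Module.compHom A (evalSeriesHom hR)
  have hs : ∀ (f : ℝ⟦X⟧) (v : A), f • v = evalSeries N R f v := fun _ _ => rfl
  have h := SeriesOps.obsSeries_square (seriesOps hR hdd hd hL hQ) (x := x) hx hLx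
  simp only [hs, evalSeries_mul hR (C (1 / 2 : ℝ)), evalSeries_C hR,
    smul_mul_assoc, one_mul, LinearMap.smul_apply, Module.End.one_apply] at h
  exact h

end Commutators

end SeriesAction
/-! ### Koszul signs and the algebra of parameters -/

section Signs

theorem negOnePow_sum {ι : Type*} (s : Finset ι) (f : ι → ℤ) :
    Int.negOnePow (∑ i ∈ s, f i) = ∏ i ∈ s, Int.negOnePow (f i) := by
  classical
  induction s using Finset.induction_on with
  | empty => simp
  | insert i s hi ih => rw [Finset.sum_insert hi, Finset.prod_insert hi, Int.negOnePow_add, ih]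

variable {m : ℕ} (d : Fin m → ℤ)

/-- The sign of the transposition of two homogeneous elements, in the shifted degrees. -/
def pairSign (i j : Fin m) : ℤ := ((Int.negOnePow ((d i - 1) * (d j - 1)) : ℤˣ) : ℤ)

theorem pairSign_comm (i j : Fin m) : pairSign d i j = pairSign d j i := by
  rw [pairSign, pairSign, mul_comm]

theorem pairSign_mul_self (i j : Fin m) : pairSign d i j * pairSign d i j = 1 := by
  rw [pairSign, ← Units.val_mul, Int.units_mul_self, Units.val_one]

/-- The sign of moving the element with index `i` past those elements with indices in `S` which
have to follow it. -/
def moveSign (S : Finset (Fin m)) (i : Fin m) : ℤ :=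
  ∏ j ∈ S, if i < j then pairSign d j i else 1

/-- The sign of sorting the concatenation of the elements with indices in `S` and in `T`. -/
def mergeSign (S T : Finset (Fin m)) : ℤ := ∏ i ∈ T, moveSign d S i

/-- The Koszul sign of an unshuffle, which is encoded by the map with value `0` on `S` and value `1`
elsewhere. -/
theorem mergeSign_compl (S : Finset (Fin m)) :
    koszulSign d (fun i => if i ∈ S then 0 else 1) = mergeSign d S Sᶜ := by
  have e : ∀ i j : Fin m, (if i < j ∧ (if j ∈ S then 0 else 1) < (if i ∈ S then 0 else 1)
      then ((Int.negOnePow ((d i - 1) * (d j - 1)) : ℤˣ) : ℤ) else 1)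
      = if i ∈ S then 1 else if j ∈ S then if i < j then pairSign d j i else 1 else 1 := by
    intro i j
    rw [pairSign_comm, pairSign]
    by_cases hi : i ∈ S <;> by_cases hj : j ∈ S <;> simp [hi, hj]
  simp only [koszulSign, e, mergeSign, moveSign]
  rw [← Finset.prod_subset (Finset.subset_univ Sᶜ)]
  · refine Finset.prod_congr rfl fun i hi => ?_
    rw [Finset.mem_compl] at hi
    simp only [hi, if_false]
    rw [← Finset.prod_subset (Finset.subset_univ S)]
    · exact Finset.prod_congr rfl fun j hj => by simp [hj]
    · intro j _ hj; simp [hj]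
  · intro i _ hi
    rw [Finset.mem_compl, not_not] at hi
    simp [hi]

theorem moveSign_insert {S : Finset (Fin m)} {i j : Fin m} (hj : j ∉ S) :
    moveSign d (insert j S) i = (if i < j then pairSign d j i else 1) * moveSign d S i :=
  Finset.prod_insert hj

theorem mergeSign_insert_right {S T : Finset (Fin m)} {i : Fin m} (hi : i ∉ T) :
    mergeSign d S (insert i T) = moveSign d S i * mergeSign d S T := Finset.prod_insert hi

theorem mergeSign_empty_right (S : Finset (Fin m)) : mergeSign d S ∅ = 1 := rfl

theorem mergeSign_empty_left (T : Finset (Fin m)) : mergeSign d ∅ T = 1 := by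
  simp [mergeSign, moveSign]

theorem moveSign_union {S T : Finset (Fin m)} (h : Disjoint S T) (i : Fin m) :
    moveSign d (S ∪ T) i = moveSign d S i * moveSign d T i := Finset.prod_union h

theorem prod_prod_eq_prod_lt {α : Type*} [CommMonoid α] (X : Fin m → Fin m → α)
    (h : ∀ i, X i i = 1) :
    ∏ i, ∏ j, X i j = ∏ i, ∏ j, if i < j then X i j * X j i else 1 := by
  have e : ∀ i j, X i j = (if i < j then X i j else 1) * (if j < i then X i j else 1) := by
    intro i j
    rcases lt_trichotomy i j with h1 | h1 | h1
    · simp [h1, h1.not_gt]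
    · subst h1; simp [h]
    · simp [h1, h1.not_gt]
  have e2 : ∀ i j, (if i < j then X i j * X j i else 1)
      = (if i < j then X i j else 1) * (if i < j then X j i else 1) := by
    intro i j; split_ifs <;> simp
  conv_lhs => enter [2, i, 2, j]; rw [e]
  simp only [e2, Finset.prod_mul_distrib]
  congr 1
  exact Finset.prod_comm

/-- The Koszul sign of sorting by `π ∘ f` is the product of the sign of sorting by `f` and of the
sign of permuting the blocks of `f` by `π`. -/
theorem koszulSign_perm_comp {r : ℕ} (f : Fin m → Fin r) (π : Equiv.Perm (Fin r)) :
    koszulSign d (π ∘ f) = koszulSign d f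
      * koszulSign (fun a => ∑ i with f i = a, (d i - 1) + 1) π := by
  have e : koszulSign (fun a => ∑ i with f i = a, (d i - 1) + 1) π
      = ∏ i, ∏ j, if f i < f j ∧ π (f j) < π (f i) then pairSign d i j else 1 := by
    have e1 : ∀ a b : Fin r, (if a < b ∧ π b < π a then
        ((Int.negOnePow ((∑ i with f i = a, (d i - 1) + 1 - 1)
          * (∑ i with f i = b, (d i - 1) + 1 - 1)) : ℤˣ) : ℤ) else 1)
        = ∏ i with f i = a, ∏ j with f j = b,
          if f i < f j ∧ π (f j) < π (f i) then pairSign d i j else 1 := by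
      intro a b
      have e2 : ∏ i with f i = a, ∏ j with f j = b,
          (if f i < f j ∧ π (f j) < π (f i) then pairSign d i j else 1)
          = ∏ i with f i = a, ∏ j with f j = b,
          (if a < b ∧ π b < π a then pairSign d i j else 1) := by
        refine Finset.prod_congr rfl fun i hi => Finset.prod_congr rfl fun j hj => ?_
        simp only [Finset.mem_filter, Finset.mem_univ, true_and] at hi hj
        rw [hi, hj]
      rw [e2]
      split_ifs with h
      · simp only [pairSign, add_sub_cancel_right, Finset.sum_mul_sum]
        rw [negOnePow_sum, Units.coe_prod]
        refine Finset.prod_congr rfl fun i _ => ?_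
        rw [negOnePow_sum, Units.coe_prod]
      · simp
    simp only [koszulSign, e1]
    have e3 : ∀ a, ∏ b, ∏ i with f i = a, ∏ j with f j = b,
          (if f i < f j ∧ π (f j) < π (f i) then pairSign d i j else 1)
        = ∏ i with f i = a, ∏ j,
          (if f i < f j ∧ π (f j) < π (f i) then pairSign d i j else 1) := by
      intro a
      rw [Finset.prod_comm]
      exact Finset.prod_congr rfl fun i _ => Finset.prod_fiberwise _ f _
    simp only [e3]
    exact Finset.prod_fiberwise _ f _
  rw [e, prod_prod_eq_prod_lt _ (by simp)]
  simp only [koszulSign]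
  simp only [← Finset.prod_mul_distrib]
  refine Finset.prod_congr rfl fun i _ => Finset.prod_congr rfl fun j _ => ?_
  by_cases hij : i < j
  · simp only [hij, true_and, if_true, Function.comp]
    rw [pairSign_comm d j i]
    have hs := pairSign_mul_self d i j
    change (if _ then pairSign d i j else 1) = (if _ then pairSign d i j else 1) * _
    rcases lt_trichotomy (f i) (f j) with h | h | h
    · simp [h, h.not_gt]
    · simp [h]
    · rcases lt_trichotomy (π (f i)) (π (f j)) with h' | h' | h'
      · simp [h, h.not_gt, h', h'.not_gt, hs]
      · exact absurd (π.injective h') h.ne'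
      · simp [h, h.not_gt, h', h'.not_gt]
  · simp [hij]

theorem koszulSign_mul_self {r : ℕ} (f : Fin m → Fin r) :
    koszulSign d f * koszulSign d f = 1 := by
  simp only [koszulSign, ← Finset.prod_mul_distrib]
  refine Finset.prod_eq_one fun i _ => Finset.prod_eq_one fun j _ => ?_
  split_ifs
  · exact pairSign_mul_self d i j
  · rfl

theorem koszulSign_perm_mul (σ τ : Equiv.Perm (Fin m)) :
    koszulSign d (σ * τ).symm = koszulSign d σ.symm * koszulSign (d ∘ σ) τ.symm := by
  have h := koszulSign_perm_comp d (σ.symm : Fin m → Fin m) τ.symm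
  have e : (fun a => ∑ i with σ.symm i = a, (d i - 1) + 1) = d ∘ σ := by
    funext a
    have : (Finset.univ.filter fun i => σ.symm i = a) = {σ a} := by
      ext i; simp [Equiv.symm_apply_eq]
    rw [this]; simp
  rw [e] at h
  exact h

section Grassmann

variable {W W' : Type*} [AddCommGroup W] [Module ℝ W] [AddCommGroup W'] [Module ℝ W']

/-- Multiplication by the parameter which is paired with the element of index `i`, odd or even
according to the parity of `d i - 1`. An element `∑_U φ(U) θ_U` of the algebra generated by these
parameters, with coefficients in `W`, is encoded by the function `φ` on finite sets of indices,
where the factors of `θ_U` are in increasing order. The squares of the even parameters are zero as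
well, since only multilinear expressions matter. -/
def theta (i : Fin m) : (Finset (Fin m) → W) →ₗ[ℝ] (Finset (Fin m) → W) where
  toFun φ U := if i ∈ U then moveSign d (U.erase i) i • φ (U.erase i) else 0
  map_add' φ ψ := by
    funext U
    simp only [Pi.add_apply]
    split_ifs
    · exact smul_add _ _ _
    · simp
  map_smul' c φ := by
    funext U
    simp only [Pi.smul_apply, RingHom.id_apply]
    split_ifs
    · exact smul_comm _ _ _
    · simp

theorem theta_apply (i : Fin m) (φ : Finset (Fin m) → W) (U : Finset (Fin m)) :
    theta d i φ U = if i ∈ U then moveSign d (U.erase i) i • φ (U.erase i) else 0 := rfl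

theorem theta_apply_insert {i : Fin m} {U : Finset (Fin m)} (h : i ∉ U)
    (φ : Finset (Fin m) → W) : theta d i φ (insert i U) = moveSign d U i • φ U := by
  simp [theta_apply, h]

theorem theta_theta_self (i : Fin m) (φ : Finset (Fin m) → W) :
    theta d i (theta d i φ) = 0 := by
  funext U; simp [theta_apply]

theorem theta_theta (i j : Fin m) (hij : i ≠ j) (φ : Finset (Fin m) → W) :
    theta d i (theta d j φ) = pairSign d i j • theta d j (theta d i φ) := by
  funext U
  simp only [theta_apply, Pi.smul_apply, Finset.mem_erase]
  by_cases hi : i ∈ U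
  · by_cases hj : j ∈ U
    · simp only [hi, hj, hij, hij.symm, ne_eq, not_false_eq_true, and_self, if_true]
      obtain ⟨V, hV⟩ : ∃ V, V = (U.erase i).erase j := ⟨_, rfl⟩
      have h1 : U.erase i = insert j V := by
        rw [hV, Finset.insert_erase]; simp [hj, hij.symm]
      have h2 : U.erase j = insert i V := by
        rw [hV, Finset.erase_right_comm, Finset.insert_erase]; simp [hi, hij]
      have hjV : j ∉ V := by simp [hV]
      have hiV : i ∉ V := by simp [hV]
      rw [h1, h2, Finset.erase_insert hjV, Finset.erase_insert hiV, moveSign_insert d hjV,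
        moveSign_insert d hiV, smul_smul, smul_smul, smul_smul]
      congr 1
      rcases lt_or_gt_of_ne hij with h | h
      · simp only [h, h.not_gt, if_true, if_false, pairSign_comm d j i]; ring
      · have := pairSign_mul_self d i j
        simp only [h, h.not_gt, if_true, if_false]
        linear_combination (-moveSign d V i * moveSign d V j) * this
    · simp [hj]
  · simp [hi]

/-- A linear map, applied to all coefficients. -/
abbrev ptwise (A : W →ₗ[ℝ] W') : (Finset (Fin m) → W) →ₗ[ℝ] (Finset (Fin m) → W') :=
  A.compLeft (Finset (Fin m))

theorem theta_ptwise (A : W →ₗ[ℝ] W') (i : Fin m) (φ : Finset (Fin m) → W) :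
    theta d i (ptwise A φ) = ptwise A (theta d i φ) := by
  funext U
  simp only [theta_apply, LinearMap.compLeft_apply, Function.comp]
  split_ifs
  · rw [map_zsmul]
  · rw [map_zero]

/-- The product of the operators `theta d (g 0)`, …, `theta d (g (k - 1))`, where the first one is
applied first. -/
def thetaProd : {k : ℕ} → (Fin k → Fin m) → (Finset (Fin m) → W) →ₗ[ℝ] (Finset (Fin m) → W)
  | 0, _ => LinearMap.id
  | k + 1, g => theta d (g (Fin.last k)) ∘ₗ thetaProd (Fin.init g)

theorem thetaProd_snoc {k : ℕ} (g : Fin k → Fin m) (i : Fin m) (φ : Finset (Fin m) → W) :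
    thetaProd d (Fin.snoc g i : Fin (k + 1) → Fin m) φ = theta d i (thetaProd d g φ) := by
  simp [thetaProd]

/-- A constant, as an element of the algebra of parameters. -/
def constCoeff : W →ₗ[ℝ] (Finset (Fin m) → W) := LinearMap.single ℝ (fun _ => W) ∅

theorem constCoeff_empty (v : W) : constCoeff (m := m) v ∅ = v := by
  simp [constCoeff]

theorem constCoeff_apply_of_ne (v : W) {U : Finset (Fin m)} (h : U ≠ ∅) :
    constCoeff v U = 0 := by
  simp [constCoeff, h]

theorem ptwise_constCoeff (A : W →ₗ[ℝ] W') (v : W) :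
    ptwise A (constCoeff (m := m) v) = constCoeff (A v) := by
  funext U
  by_cases h : U = ∅
  · subst h; simp [constCoeff_empty]
  · simp [constCoeff_apply_of_ne _ h]

/-- The sign of sorting the elements with indices `g 0`, …, `g (k - 1)`. -/
def seqSign {k : ℕ} (g : Fin k → Fin m) : ℤ :=
  ∏ b, ∏ a, if a < b ∧ g b < g a then pairSign d (g a) (g b) else 1

theorem seqSign_succ {k : ℕ} (g : Fin (k + 1) → Fin m) (hg : Function.Injective g) :
    seqSign d g = seqSign d (Fin.init g)
      * moveSign d (Finset.univ.image (Fin.init g)) (g (Fin.last k)) := by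
  have hi : Function.Injective (Fin.init g) := fun a b h => Fin.castSucc_injective _ (hg h)
  rw [seqSign, Fin.prod_univ_castSucc]
  congr 1
  · refine Finset.prod_congr rfl fun b _ => ?_
    rw [Fin.prod_univ_castSucc]
    simp [Fin.init, (Fin.castSucc_lt_last b).not_gt]
    congr!
  · rw [Fin.prod_univ_castSucc, moveSign, Finset.prod_image fun a _ b _ h => hi h]
    simp [Fin.init, Fin.castSucc_lt_last]
    congr!

/-- The product of distinct parameters with a constant has a single coefficient, with the sign of
sorting. -/
theorem thetaProd_constCoeff {k : ℕ} (g : Fin k → Fin m) (v : W) (S : Finset (Fin m)) :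
    thetaProd d g (constCoeff v) S
      = if Function.Injective g ∧ Finset.univ.image g = S then seqSign d g • v else 0 := by
  induction k generalizing S with
  | zero =>
    have h : Finset.univ.image g = ∅ := by simp
    by_cases hS : S = ∅
    · subst hS
      simp [thetaProd, constCoeff_empty, Function.injective_of_subsingleton, seqSign]
    · simp [thetaProd, constCoeff_apply_of_ne v hS, Ne.symm hS]
  | succ k ih =>
    have hinj : Function.Injective g ↔ Function.Injective (Fin.init g)
        ∧ g (Fin.last k) ∉ Finset.univ.image (Fin.init g) := by
      have := Fin.snoc_injective_iff (x₀ := g (Fin.last k)) (x := Fin.init g)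
      rw [Fin.snoc_init_self] at this
      simpa using this
    have himg : Finset.univ.image g
        = insert (g (Fin.last k)) (Finset.univ.image (Fin.init g)) := by
      ext j
      simp only [Finset.mem_image, Finset.mem_univ, true_and, Finset.mem_insert, Fin.init]
      rw [Fin.exists_iff_castSucc, eq_comm]
    change theta d (g (Fin.last k)) (thetaProd d (Fin.init g) (constCoeff v)) S = _
    rw [theta_apply, ih]
    by_cases h : Function.Injective g ∧ Finset.univ.image g = S
    · obtain ⟨h1, h2⟩ := h
      obtain ⟨h3, h4⟩ := hinj.mp h1
      have h5 : S.erase (g (Fin.last k)) = Finset.univ.image (Fin.init g) := by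
        rw [← h2, himg, Finset.erase_insert h4]
      have h6 : g (Fin.last k) ∈ S := by rw [← h2, himg]; simp
      simp only [h1, h2, h3, h5, h6, and_self, if_true, seqSign_succ d g h1, smul_smul]
      rw [mul_comm]
    · rw [if_neg h]
      split_ifs with h1 h2
      · refine absurd ⟨hinj.mpr ⟨h2.1, ?_⟩, ?_⟩ h
        · rw [h2.2]; simp
        · rw [himg, h2.2, Finset.insert_erase h1]
      · simp
      · rfl

/-- The sum of `θ_{g 0} ⋯ θ_{g (k - 1)} f (g)` over all sequences of indices. -/
def seqSum (k : ℕ) (f : (Fin k → Fin m) → W) : Finset (Fin m) → W :=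
  ∑ g, thetaProd d g (constCoeff (f g))

theorem seqSum_zero (f : (Fin 0 → Fin m) → W) : seqSum d 0 f = constCoeff (f Fin.elim0) := by
  simp [seqSum, thetaProd, Subsingleton.elim _ (Fin.elim0 : Fin 0 → Fin m)]

theorem seqSum_succ (k : ℕ) (f : (Fin (k + 1) → Fin m) → W) :
    seqSum d (k + 1) f
      = ∑ i, theta d i (seqSum d k fun g => f (Fin.snoc g i : Fin (k + 1) → Fin m)) := by
  rw [seqSum, ← (Fin.snocEquiv fun _ : Fin (k + 1) => Fin m).sum_comp, Fintype.sum_prod_type]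
  refine Finset.sum_congr rfl fun i _ => ?_
  rw [seqSum, map_sum]
  exact Finset.sum_congr rfl fun g _ => thetaProd_snoc d g i _

theorem seqSum_add (k : ℕ) (f f' : (Fin k → Fin m) → W) :
    seqSum d k (fun g => f g + f' g) = seqSum d k f + seqSum d k f' := by
  simp only [seqSum, map_add, Finset.sum_add_distrib]

theorem seqSum_map (A : W →ₗ[ℝ] W') (k : ℕ) (f : (Fin k → Fin m) → W) :
    seqSum d k (fun g => A (f g)) = ptwise A (seqSum d k f) := by
  induction k with
  | zero => rw [seqSum_zero, seqSum_zero, ptwise_constCoeff]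
  | succ k ih =>
    rw [seqSum_succ, seqSum_succ, map_sum]
    refine Finset.sum_congr rfl fun i _ => ?_
    rw [← theta_ptwise, ← ih]

/-- The graded symmetrization of a family of maps. -/
def symmetrize {V : Type*} (f : GradedFamily V W) : GradedFamily V W := fun k d x =>
  ∑ σ : Equiv.Perm (Fin k), koszulSign d σ.symm • f k (d ∘ σ) (x ∘ σ)

theorem symmetrize_perm {V : Type*} (f : GradedFamily V W) {k : ℕ} (d : Fin k → ℤ)
    (x : Fin k → V) (σ : Equiv.Perm (Fin k)) :
    symmetrize f k (d ∘ σ) (x ∘ σ) = koszulSign d σ.symm • symmetrize f k d x := by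
  simp only [symmetrize]
  rw [Finset.smul_sum]
  refine Fintype.sum_equiv (Equiv.mulLeft σ) _ _ fun τ => ?_
  have h : koszulSign (d ∘ σ) τ.symm
      = koszulSign d σ.symm * koszulSign d (Equiv.mulLeft σ τ).symm := by
    change _ = _ * koszulSign d (σ * τ).symm
    rw [koszulSign_perm_mul, ← mul_assoc, koszulSign_mul_self, one_mul]
  rw [h, smul_smul]
  rfl

/-- The values of a family on the subtuples of `x`, with indices in increasing order. -/
def onSubtuples {V : Type*} (F : GradedFamily V W) (x : Fin m → V) (S : Finset (Fin m)) : W :=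
  F S.card (subtuple S d) (subtuple S x)

theorem seqSign_orderEmb {k : ℕ} (h : Fin k ↪o Fin m) (σ : Equiv.Perm (Fin k)) :
    koszulSign (d ∘ h) σ.symm = seqSign d (h ∘ σ) := by
  rw [koszulSign, ← Equiv.prod_comp σ]
  have e : ∀ a, ∏ j, (if σ a < j ∧ σ.symm j < σ.symm (σ a) then
      ((Int.negOnePow (((d ∘ h) (σ a) - 1) * ((d ∘ h) j - 1)) : ℤˣ) : ℤ) else 1)
      = ∏ b, (if σ a < σ b ∧ b < a then
      ((Int.negOnePow (((d ∘ h) (σ a) - 1) * ((d ∘ h) (σ b) - 1)) : ℤˣ) : ℤ) else 1) := by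
    intro a
    rw [← Equiv.prod_comp σ]
    simp
  rw [Finset.prod_congr rfl fun a _ => e a, seqSign]
  refine Finset.prod_congr rfl fun b _ => Finset.prod_congr rfl fun a _ => ?_
  simp only [Function.comp, h.lt_iff_lt, and_comm]
  rw [pairSign_comm]
  rfl

/-- The values of a symmetrized family on subtuples are the coefficients of a sum over sequences. -/
theorem onSubtuples_symmetrize {V : Type*} (f : GradedFamily V W) (x : Fin m → V)
    (S : Finset (Fin m)) :
    onSubtuples d (symmetrize f) x S
      = seqSum d S.card (fun g => f S.card (d ∘ g) (x ∘ g)) S := by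
  set h := S.orderEmbOfFin rfl with hh
  have himg : ∀ a, h a ∈ S := fun a => S.orderEmbOfFin_mem rfl a
  rw [seqSum, Finset.sum_apply]
  simp only [thetaProd_constCoeff]
  rw [onSubtuples, symmetrize]
  refine Finset.sum_of_injOn (fun σ : Equiv.Perm (Fin S.card) => h ∘ σ) ?_ (by simp) ?_ ?_
  · intro σ _ τ _ hst
    ext a
    exact congrArg Fin.val (h.injective (congrFun hst a))
  · intro g _ hg
    rw [if_neg]
    rintro ⟨h1, h2⟩
    apply hg
    have hgS : ∀ a, g a ∈ S := fun a => by rw [← h2]; simp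
    let e : Fin S.card → Fin S.card := fun a => (S.orderIsoOfFin rfl).symm ⟨g a, hgS a⟩
    have he : Function.Injective e := by
      intro a b hab
      have := (S.orderIsoOfFin rfl).symm.injective hab
      exact h1 (congrArg Subtype.val this)
    refine ⟨Equiv.ofBijective e (Finite.injective_iff_bijective.mp he), by simp, ?_⟩
    funext a
    change h (e a) = g a
    rw [hh, ← Finset.coe_orderIsoOfFin_apply]
    simp [e]
  · intro σ _
    have h1 : Function.Injective (h ∘ σ) := h.injective.comp σ.injective
    have h2 : Finset.univ.image (h ∘ σ) = S := by
      refine Finset.eq_of_subset_of_card_le ?_ ?_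
      · intro j hj
        obtain ⟨a, _, rfl⟩ := Finset.mem_image.mp hj
        exact himg _
      · rw [Finset.card_image_of_injective _ h1]; simp
    rw [if_pos ⟨h1, h2⟩]
    exact congrArg₂ _ (seqSign_orderEmb d h σ) rfl

end Grassmann

end Signs
/-! ### Cartan calculus with coefficients in the algebra of parameters -/

/-- An algebraic Cartan calculus: a Lie algebra `𝔤` with bracket `br`, a complex `Ω` with
differential `d`, and contractions `ι` satisfying Cartan's relations. The space `Ω` contains
subspaces `gr p`, and the involution `γ` is `(-1) ^ p` on `gr p`. For the forms on an `n`-plectic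
manifold, `gr p` consists of the forms of degree `n + p`, so that the `(n + 1)`-form `ϖ` lies in
`gr 1`, and a homogeneous form of degree `k` in one of the `L_∞`-algebras lies in `gr (k - 1)`. -/
structure CartanCalculus (𝔤 Ω : Type*) [AddCommGroup 𝔤] [Module ℝ 𝔤] [AddCommGroup Ω]
    [Module ℝ Ω] where
  /-- The differential. -/
  d : Module.End ℝ Ω
  /-- The contraction. -/
  ι : 𝔤 →ₗ[ℝ] Module.End ℝ Ω
  /-- The bracket. -/
  br : 𝔤 →ₗ[ℝ] 𝔤 →ₗ[ℝ] 𝔤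
  /-- The involution `(-1) ^ p` on the elements of degree `p`. -/
  γ : Module.End ℝ Ω
  /-- The elements of degree `p`. -/
  gr : ℤ → Submodule ℝ Ω
  d_d : d * d = 0
  γ_γ : γ * γ = 1
  γ_d : γ * d = -(d * γ)
  γ_ι : ∀ X, γ * ι X = -(ι X * γ)
  ι_ι : ∀ X Y, ι X * ι Y = -(ι Y * ι X)
  lie_ι : ∀ X Y, (d * ι X + ι X * d) * ι Y = ι (br X Y) + ι Y * (d * ι X + ι X * d)
  γ_gr : ∀ {p w}, w ∈ gr p → γ w = (Int.negOnePow p : ℤ) • w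
  d_mem : ∀ {p w}, w ∈ gr p → d w ∈ gr (p + 1)
  ι_mem : ∀ X {p w}, w ∈ gr p → ι X w ∈ gr (p - 1)
  br_swap : ∀ X Y, br X Y = -br Y X
  jacobi : ∀ X Y Z, br X (br Y Z) = br (br X Y) Z + br Y (br X Z)

section Ring

variable {A : Type*} [Ring A] {p r d : A}

/-- If `p` commutes with `r` and anticommutes with `d`, then it anticommutes with their commutator.
-/
theorem anticomm_commutator (hr : p * r = r * p) (hd : p * d = -(d * p)) :
    p * (r * d - d * r) = -((r * d - d * r) * p) := by
  rw [mul_sub, ← mul_assoc, ← mul_assoc, hr, hd, neg_mul, mul_assoc r, hd, mul_assoc d, hr]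
  noncomm_ring

theorem commutator_of_anticomm {t u : A} (h : t = -u) (a b : A) :
    u * a + u * b = u * a - t * b := by rw [h]; noncomm_ring

theorem rotate_of_anticomm {x y z : A} (h1 : y * z = -(z * y)) (h2 : x * z = -(z * x)) :
    x * y * z = z * x * y := by
  calc _ = x * (y * z) := mul_assoc _ _ _
    _ = -(x * z) * y := by rw [h1]; noncomm_ring
    _ = _ := by rw [h2]; noncomm_ring

end Ring

namespace CartanCalculus

variable {𝔤 Ω : Type*} [AddCommGroup 𝔤] [Module ℝ 𝔤] [AddCommGroup Ω] [Module ℝ Ω]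
  (C : CartanCalculus 𝔤 Ω)

/-- The contraction from the right: `ρ X β` is the Poisson bracket of `β` and `X`. The factor `γ`
has the effect that the Lie derivative is, up to `γ`, the commutator of `ρ X` and `d` instead of an
anticommutator. -/
def ρ : 𝔤 →ₗ[ℝ] Module.End ℝ Ω where
  toFun X := C.γ * C.ι X
  map_add' X Y := by rw [map_add, mul_add]
  map_smul' c X := by rw [map_smul, mul_smul_comm]; rfl

theorem ρ_eq (X : 𝔤) : C.ρ X = C.γ * C.ι X := rfl

theorem ρ_ρ (X Y : 𝔤) : C.ρ X * C.ρ Y = C.ι Y * C.ι X := by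
  calc C.γ * C.ι X * (C.γ * C.ι Y) = C.γ * (C.ι X * C.γ) * C.ι Y := by noncomm_ring
    _ = C.γ * (-(C.γ * C.ι X)) * C.ι Y := by rw [C.γ_ι, neg_neg]
    _ = -(C.γ * C.γ * (C.ι X * C.ι Y)) := by noncomm_ring
    _ = _ := by rw [C.γ_γ, one_mul, C.ι_ι X Y, neg_neg]

theorem γ_ρ (X : 𝔤) : C.γ * C.ρ X = -(C.ρ X * C.γ) := by
  rw [ρ_eq, mul_assoc C.γ, ← mul_neg, ← C.γ_ι]

/-- The Lie derivative, up to the parity. -/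
def lieR (X : 𝔤) : Module.End ℝ Ω := C.ρ X * C.d - C.d * C.ρ X

theorem lieR_eq (X : 𝔤) : C.lieR X = C.γ * (C.d * C.ι X + C.ι X * C.d) := by
  have h : C.d * C.γ = -(C.γ * C.d) := by rw [C.γ_d, neg_neg]
  rw [lieR, ρ_eq, ← mul_assoc C.d, h]
  noncomm_ring

theorem ρ_lieR (X Y : 𝔤) : C.ρ X * C.lieR Y + C.lieR Y * C.ρ X = C.ι (C.br Y X) := by
  have h : C.d * C.γ = -(C.γ * C.d) := by rw [C.γ_d, neg_neg]
  have h' : ∀ Z, C.ι Z * C.γ = -(C.γ * C.ι Z) := fun Z => by rw [C.γ_ι, neg_neg]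
  have h1 : (C.d * C.ι Y + C.ι Y * C.d) * C.γ = C.γ * (C.d * C.ι Y + C.ι Y * C.d) := by
    rw [add_mul, mul_assoc, h', mul_assoc, h, mul_neg, mul_neg, ← mul_assoc, ← mul_assoc, h, h',
      mul_add]
    noncomm_ring
  rw [lieR_eq, ρ_eq]
  calc _ = C.γ * (C.ι X * C.γ) * (C.d * C.ι Y + C.ι Y * C.d)
        + C.γ * ((C.d * C.ι Y + C.ι Y * C.d) * C.γ) * C.ι X := by noncomm_ring
    _ = C.γ * C.γ * ((C.d * C.ι Y + C.ι Y * C.d) * C.ι X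
        - C.ι X * (C.d * C.ι Y + C.ι Y * C.d)) := by rw [h1, h']; noncomm_ring
    _ = _ := by rw [C.γ_γ, one_mul, C.lie_ι, add_sub_cancel_right]

theorem ρ_ι (X Y : 𝔤) : C.ρ X * C.ι Y = C.ι Y * C.ρ X := by
  rw [ρ_eq, mul_assoc, C.ι_ι X Y, mul_neg, ← mul_assoc, C.γ_ι, neg_mul, neg_neg, mul_assoc]

variable {m : ℕ} (d : Fin m → ℤ)

section PtwiseRing

theorem ptwise_mul {W : Type*} [AddCommGroup W] [Module ℝ W] (A B : Module.End ℝ W) :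
    (ptwise (m := m) (A * B) : Module.End ℝ (Finset (Fin m) → W)) = ptwise A * ptwise B := rfl

theorem ptwise_add {W : Type*} [AddCommGroup W] [Module ℝ W] (A B : Module.End ℝ W) :
    (ptwise (m := m) (A + B) : Module.End ℝ (Finset (Fin m) → W)) = ptwise A + ptwise B := rfl

theorem ptwise_sub {W : Type*} [AddCommGroup W] [Module ℝ W] (A B : Module.End ℝ W) :
    (ptwise (m := m) (A - B) : Module.End ℝ (Finset (Fin m) → W)) = ptwise A - ptwise B := rfl

theorem ptwise_zero {W : Type*} [AddCommGroup W] [Module ℝ W] :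
    (ptwise (m := m) (0 : Module.End ℝ W) : Module.End ℝ (Finset (Fin m) → W)) = 0 := rfl

variable {W : Type*} [AddCommGroup W] [Module ℝ W]

/-- `theta` as an element of the ring of endomorphisms. -/
abbrev thetaEnd (i : Fin m) : Module.End ℝ (Finset (Fin m) → W) := theta d i

theorem ptwise_mul_theta (A : Module.End ℝ W) (i : Fin m) :
    (ptwise A : Module.End ℝ (Finset (Fin m) → W)) * thetaEnd d i = thetaEnd d i * ptwise A :=
  LinearMap.ext fun φ => (theta_ptwise d A i φ).symm

theorem thetaEnd_swap {i j : Fin m} (hi : d i = 0) (hj : d j = 0) :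
    (thetaEnd d i * thetaEnd d j : Module.End ℝ (Finset (Fin m) → W))
      = -(thetaEnd d j * thetaEnd d i) := by
  refine LinearMap.ext fun φ => ?_
  change theta d i (theta d j φ) = -theta d j (theta d i φ)
  by_cases h : i = j
  · subst h; simp [theta_theta_self]
  · rw [theta_theta d i j h]
    simp [pairSign, hi, hj]

end PtwiseRing

variable (X : Fin m → 𝔤)

/-- The contraction `R` with the generic vector field `∑ i, θ_i X_i`. It is an even operator, since
the parameters of vector fields are odd. -/
def contr : Module.End ℝ (Finset (Fin m) → Ω) := ∑ i, thetaEnd d i * ptwise (C.ρ (X i))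

/-- The differential, applied to coefficients in the algebra of parameters. -/
def diff : Module.End ℝ (Finset (Fin m) → Ω) := ptwise C.d

/-- The commutator of `contr` and `diff`. -/
def lieOp : Module.End ℝ (Finset (Fin m) → Ω) := C.contr d X * C.diff - C.diff * C.contr d X

/-- The commutator of `contr` and `lieOp`. -/
def curvOp : Module.End ℝ (Finset (Fin m) → Ω) :=
  C.contr d X * C.lieOp d X - C.lieOp d X * C.contr d X

theorem diff_diff : (C.diff * C.diff : Module.End ℝ (Finset (Fin m) → Ω)) = 0 := by
  rw [diff, ← ptwise_mul, C.d_d, ptwise_zero]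

theorem diff_contr : C.diff * C.contr d X = C.contr d X * C.diff - C.lieOp d X := by
  rw [lieOp]; abel

theorem lieOp_contr : C.lieOp d X * C.contr d X = C.contr d X * C.lieOp d X - C.curvOp d X := by
  rw [curvOp]; abel

theorem lieOp_eq : C.lieOp d X = ∑ i, thetaEnd d i * ptwise (C.lieR (X i)) := by
  rw [lieOp, contr, diff, Finset.sum_mul, Finset.mul_sum, ← Finset.sum_sub_distrib]
  refine Finset.sum_congr rfl fun i _ => ?_
  rw [mul_assoc, ← mul_assoc (ptwise C.d : Module.End ℝ (Finset (Fin m) → Ω)) (thetaEnd d i),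
    ptwise_mul_theta, mul_assoc, ← mul_sub, ← ptwise_mul, ← ptwise_mul, ← ptwise_sub]
  rfl

variable {d X}

theorem theta_mul_theta (i j : Fin m) (A B : Module.End ℝ Ω) :
    thetaEnd d i * ptwise A * (thetaEnd d j * ptwise B)
      = thetaEnd d i * thetaEnd d j * ptwise (A * B) := by
  rw [mul_assoc, ← mul_assoc (ptwise A : Module.End ℝ (Finset (Fin m) → Ω)) (thetaEnd d j),
    ptwise_mul_theta, mul_assoc, ← ptwise_mul, mul_assoc]

/-- The operator `Q = [R, [R, d]]` is the contraction with the bracket of the generic vector field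
with itself. -/
theorem curvOp_eq (hX : ∀ i, d i ≠ 0 → X i = 0) : C.curvOp d X
    = ∑ i, ∑ j, thetaEnd d i * thetaEnd d j * ptwise (C.ι (C.br (X j) (X i))) := by
  rw [curvOp, lieOp_eq, contr, Finset.sum_mul_sum, Finset.sum_mul_sum]
  rw [Finset.sum_comm (f := fun i j => thetaEnd d i * ptwise (C.lieR (X i)) * _)]
  rw [← Finset.sum_sub_distrib]
  refine Finset.sum_congr rfl fun i _ => ?_
  rw [← Finset.sum_sub_distrib]
  refine Finset.sum_congr rfl fun j _ => ?_
  rw [theta_mul_theta, theta_mul_theta, ← ρ_lieR, ptwise_add]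
  by_cases hi : d i = 0
  · by_cases hj : d j = 0
    · rw [mul_add]
      exact (commutator_of_anticomm (thetaEnd_swap d hj hi) _ _).symm
    · simp [hX j hj, lieR, ptwise_zero]
  · simp [hX i hi, lieR, ptwise_zero]

/-- `Q` commutes with `R`, since both are contractions with vector fields. -/
theorem curvOp_contr (hX : ∀ i, d i ≠ 0 → X i = 0) :
    C.curvOp d X * C.contr d X = C.contr d X * C.curvOp d X := by
  rw [curvOp_eq C hX, contr]
  refine Commute.sum_left _ _ _ fun i _ => Commute.sum_left _ _ _ fun j _ =>
    Commute.sum_right _ _ _ fun k _ => ?_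
  rw [Commute, SemiconjBy]
  have e1 : thetaEnd d i * thetaEnd d j * ptwise (C.ι (C.br (X j) (X i)))
      * (thetaEnd d k * ptwise (C.ρ (X k))) = thetaEnd d i * thetaEnd d j * thetaEnd d k
        * ptwise (C.ι (C.br (X j) (X i)) * C.ρ (X k)) := by
    rw [mul_assoc (thetaEnd d i), mul_assoc (thetaEnd d i), theta_mul_theta]
    simp only [mul_assoc]
  have e2 : thetaEnd d k * ptwise (C.ρ (X k))
      * (thetaEnd d i * thetaEnd d j * ptwise (C.ι (C.br (X j) (X i))))
      = thetaEnd d k * thetaEnd d i * thetaEnd d j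
        * ptwise (C.ρ (X k) * C.ι (C.br (X j) (X i))) := by
    calc _ = thetaEnd d k * (ptwise (C.ρ (X k)) * thetaEnd d i) * thetaEnd d j
          * ptwise (C.ι (C.br (X j) (X i))) := by simp only [mul_assoc]
      _ = thetaEnd d k * thetaEnd d i * (ptwise (C.ρ (X k)) * thetaEnd d j)
          * ptwise (C.ι (C.br (X j) (X i))) := by
        rw [ptwise_mul_theta]; simp only [mul_assoc]
      _ = _ := by rw [ptwise_mul_theta, ptwise_mul]; simp only [mul_assoc]
  rw [e1, e2, ρ_ι]
  by_cases hi : d i = 0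
  · by_cases hj : d j = 0
    · by_cases hk : d k = 0
      · exact congrArg (· * _) (rotate_of_anticomm (thetaEnd_swap d hj hk) (thetaEnd_swap d hi hk))
      · simp [hX k hk, ptwise_zero]
    · simp [hX j hj, ptwise_zero]
  · simp [hX i hi, ptwise_zero]

theorem contr_apply (φ : Finset (Fin m) → Ω) (S : Finset (Fin m)) :
    C.contr d X φ S = ∑ i ∈ S, moveSign d (S.erase i) i • C.ρ (X i) (φ (S.erase i)) := by
  simp only [contr, LinearMap.sum_apply, Finset.sum_apply, Module.End.mul_apply, theta_apply,
    LinearMap.compLeft_apply, Function.comp, ← Finset.sum_filter, Finset.filter_mem_eq_inter,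
    Finset.univ_inter]

theorem contr_pow_apply_of_card_lt (k : ℕ) (φ : Finset (Fin m) → Ω) {S : Finset (Fin m)}
    (h : S.card < k) : (C.contr d X ^ k) φ S = 0 := by
  induction k generalizing S with
  | zero => omega
  | succ k ih =>
    rw [pow_succ', Module.End.mul_apply, contr_apply]
    refine Finset.sum_eq_zero fun i hi => ?_
    rw [ih, map_zero, smul_zero]
    have := Finset.card_erase_lt_of_mem hi
    omega

/-- Each application of `contr` adds a parameter, of which there are only `m`. Power series in
`contr` may therefore be truncated after `m + 1` terms. -/
theorem contr_pow_eq_zero {N : ℕ} (h : m < N) : C.contr d X ^ N = 0 := by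
  refine LinearMap.ext fun φ => funext fun S => ?_
  refine C.contr_pow_apply_of_card_lt N φ ?_
  have := S.card_le_univ
  rw [Fintype.card_fin] at this
  omega

variable (d)

/-- The degree of the coefficient of the product `θ_S` in an element of total degree zero. For a set
of homogeneous elements, it is the sum of the shifted degrees. -/
def degSum (S : Finset (Fin m)) : ℤ := ∑ i ∈ S, (d i - 1)

theorem degSum_erase {S : Finset (Fin m)} {i : Fin m} (h : i ∈ S) :
    degSum d (S.erase i) = degSum d S - (d i - 1) := by
  rw [degSum, degSum, Finset.sum_erase_eq_sub h]

/-- The total parity of forms with coefficients in the algebra of parameters. -/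
def parity : Module.End ℝ (Finset (Fin m) → Ω) where
  toFun φ S := (Int.negOnePow (degSum d S) : ℤ) • C.γ (φ S)
  map_add' φ ψ := by funext S; simp
  map_smul' c φ := by funext S; simp only [Pi.smul_apply, map_smul, RingHom.id_apply]; module

theorem parity_apply (φ : Finset (Fin m) → Ω) (S : Finset (Fin m)) :
    C.parity d φ S = (Int.negOnePow (degSum d S) : ℤ) • C.γ (φ S) := rfl

theorem parity_diff : C.parity d * C.diff = -(C.diff * C.parity d) := by
  refine LinearMap.ext fun φ => funext fun S => ?_
  change (Int.negOnePow (degSum d S) : ℤ) • (C.γ * C.d) (φ S)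
    = -C.d ((Int.negOnePow (degSum d S) : ℤ) • C.γ (φ S))
  rw [C.γ_d, map_zsmul]
  exact smul_neg _ _

theorem parity_contr (hX : ∀ i, d i ≠ 0 → X i = 0) :
    C.parity d * C.contr d X = C.contr d X * C.parity d := by
  refine LinearMap.ext fun φ => funext fun S => ?_
  change (Int.negOnePow (degSum d S) : ℤ) • C.γ (C.contr d X φ S)
    = C.contr d X (C.parity d φ) S
  rw [contr_apply, contr_apply, map_sum, Finset.smul_sum]
  refine Finset.sum_congr rfl fun i hi => ?_
  have h : ∀ w, C.γ (C.ρ (X i) w) = -C.ρ (X i) (C.γ w) := LinearMap.congr_fun (C.γ_ρ (X i))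
  rw [map_zsmul, h, parity_apply, map_zsmul, smul_comm]
  congr 1
  by_cases hd : d i = 0
  · rw [degSum_erase d hi, hd, zero_sub, sub_neg_eq_add, Int.negOnePow_succ]
    simp
  · simp [hX i hd]

theorem parity_lieOp (hX : ∀ i, d i ≠ 0 → X i = 0) :
    C.parity d * C.lieOp d X = -(C.lieOp d X * C.parity d) :=
  anticomm_commutator (parity_contr C d hX) (parity_diff C d)

theorem parity_curvOp (hX : ∀ i, d i ≠ 0 → X i = 0) :
    C.parity d * C.curvOp d X = -(C.curvOp d X * C.parity d) :=
  anticomm_commutator (parity_contr C d hX) (parity_lieOp C d hX)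

section Projection

variable {W W' : Type*} [AddCommGroup W] [Module ℝ W] [AddCommGroup W'] [Module ℝ W']

/-- The part in which the product of the parameters has degree `p`, in the sense of `degSum`. For a
generic element and `p = -1`, it comes from the arguments of degree `0`. -/
def degProj (p : ℤ) : Module.End ℝ (Finset (Fin m) → W) where
  toFun φ S := if degSum d S = p then φ S else 0
  map_add' φ ψ := by funext S; simp only [Pi.add_apply]; split_ifs <;> simp
  map_smul' c φ := by
    funext S; simp only [Pi.smul_apply, RingHom.id_apply]; split_ifs <;> simp

theorem degProj_apply (p : ℤ) (φ : Finset (Fin m) → W) (S : Finset (Fin m)) :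
    degProj d p φ S = if degSum d S = p then φ S else 0 := rfl

theorem degProj_ptwise (p : ℤ) (A : W →ₗ[ℝ] W') (φ : Finset (Fin m) → W) :
    degProj d p (ptwise A φ) = ptwise A (degProj d p φ) := by
  funext S
  simp only [degProj_apply, LinearMap.compLeft_apply, Function.comp]
  split_ifs <;> simp

end Projection

theorem degProj_diff (p : ℤ) (φ : Finset (Fin m) → Ω) :
    degProj d p (C.diff φ) = C.diff (degProj d p φ) := degProj_ptwise d p C.d φ

theorem degProj_contr (hX : ∀ i, d i ≠ 0 → X i = 0) (p : ℤ) (φ : Finset (Fin m) → Ω) :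
    degProj d p (C.contr d X φ) = C.contr d X (degProj d (p + 1) φ) := by
  funext S
  rw [degProj_apply, contr_apply, contr_apply]
  by_cases h : degSum d S = p
  · rw [if_pos h]
    refine Finset.sum_congr rfl fun i hi => ?_
    by_cases hd : d i = 0
    · rw [degProj_apply, if_pos]
      rw [degSum_erase d hi, hd, h]; ring
    · simp [hX i hd]
  · rw [if_neg h]
    refine (Finset.sum_eq_zero fun i hi => ?_).symm
    by_cases hd : d i = 0
    · rw [degProj_apply, if_neg, map_zero, smul_zero]
      rw [degSum_erase d hi, hd]
      intro h'
      exact h (by linarith)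
    · simp [hX i hd]

theorem degProj_contr_pow (hX : ∀ i, d i ≠ 0 → X i = 0) (k : ℕ) (p : ℤ)
    (φ : Finset (Fin m) → Ω) :
    degProj d p ((C.contr d X ^ k) φ) = (C.contr d X ^ k) (degProj d (p + k) φ) := by
  induction k generalizing p with
  | zero => simp
  | succ k ih =>
    rw [pow_succ', Module.End.mul_apply, degProj_contr C d hX, ih, Module.End.mul_apply]
    push_cast
    rw [add_right_comm, add_assoc]

theorem degProj_lieOp (hX : ∀ i, d i ≠ 0 → X i = 0) (p : ℤ) (φ : Finset (Fin m) → Ω) :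
    degProj d p (C.lieOp d X φ) = C.lieOp d X (degProj d (p + 1) φ) := by
  simp only [lieOp, LinearMap.sub_apply, Module.End.mul_apply, map_sub, degProj_contr C d hX,
    degProj_diff]

theorem degProj_curvOp (hX : ∀ i, d i ≠ 0 → X i = 0) (p : ℤ) (φ : Finset (Fin m) → Ω) :
    degProj d p (C.curvOp d X φ) = C.curvOp d X (degProj d (p + 2) φ) := by
  simp only [curvOp, LinearMap.sub_apply, Module.End.mul_apply, map_sub, degProj_contr C d hX,
    degProj_lieOp C d hX, add_assoc]
  rfl

end CartanCalculus
/-! ### Insertion of an element in front of a tuple -/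

section Insertion

variable {m : ℕ} (d : Fin m → ℤ) {W W' V : Type*} [AddCommGroup W] [Module ℝ W]
  [AddCommGroup W'] [Module ℝ W'] [AddCommGroup V] [Module ℝ V]

theorem degSum_union {S T : Finset (Fin m)} (h : Disjoint S T) :
    CartanCalculus.degSum d (S ∪ T) = CartanCalculus.degSum d S + CartanCalculus.degSum d T :=
  Finset.sum_union h

open CartanCalculus (degSum degProj degProj_apply degProj_ptwise degSum_erase thetaEnd)

/-- The sum over all decompositions of a set of indices into two parts; the parameters in the first
part come first. -/
def comb : (Finset (Fin m) → Finset (Fin m) → W) →ₗ[ℝ] (Finset (Fin m) → W) where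
  toFun χ U := ∑ S ∈ U.powerset, mergeSign d S (U \ S) • χ S (U \ S)
  map_add' χ χ' := by funext U; simp [Finset.sum_add_distrib]
  map_smul' c χ := by
    funext U
    simp only [Pi.smul_apply, RingHom.id_apply, Finset.smul_sum]
    exact Finset.sum_congr rfl fun S _ => smul_comm _ _ _

theorem comb_apply (χ : Finset (Fin m) → Finset (Fin m) → W) (U : Finset (Fin m)) :
    comb d χ U = ∑ S ∈ U.powerset, mergeSign d S (U \ S) • χ S (U \ S) := rfl

theorem comb_ptwise (A : W →ₗ[ℝ] W') (χ : Finset (Fin m) → Finset (Fin m) → W) :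
    comb d (fun S => ptwise A (χ S)) = ptwise A (comb d χ) := by
  funext U
  simp [comb_apply]

theorem comb_theta (i : Fin m) (χ : Finset (Fin m) → Finset (Fin m) → W) :
    comb d (fun S => theta d i (χ S)) = theta d i (comb d χ) := by
  funext U
  rw [comb_apply, theta_apply]
  by_cases hi : i ∈ U
  · rw [if_pos hi, comb_apply, Finset.smul_sum]
    refine (Finset.sum_subset_zero_on_sdiff (Finset.powerset_mono.mpr (Finset.erase_subset i U))
      ?_ ?_).symm
    · intro S hS
      rw [Finset.mem_sdiff, Finset.mem_powerset, Finset.mem_powerset,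
        Finset.subset_erase] at hS
      have : i ∉ U \ S := by
        simp only [Finset.mem_sdiff, not_and, not_not]
        intro _
        by_contra h
        exact hS.2 ⟨hS.1, h⟩
      rw [theta_apply, if_neg this, smul_zero]
    · intro S hS
      rw [Finset.mem_powerset, Finset.subset_erase] at hS
      have h1 : i ∈ U \ S := by simp [hi, hS.2]
      have h2 : (U \ S).erase i = U.erase i \ S := by
        rw [← Finset.sdiff_singleton_eq_erase, ← Finset.sdiff_singleton_eq_erase,
          sdiff_right_comm]
      have h3 : U \ S = insert i (U.erase i \ S) := by rw [← h2, Finset.insert_erase h1]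
      have h4 : U.erase i = S ∪ (U.erase i \ S) := by
        rw [Finset.union_sdiff_of_subset (Finset.subset_erase.mpr hS)]
      rw [theta_apply, if_pos h1, h2, smul_smul, smul_smul]
      congr 1
      conv_lhs => rw [h4, moveSign_union d Finset.disjoint_sdiff, ← h4]
      rw [h3, mergeSign_insert_right d (by simp)]
      ring
  · rw [if_neg hi]
    refine Finset.sum_eq_zero fun S _ => ?_
    rw [theta_apply, if_neg (by simp [hi]), smul_zero]

theorem prod_pairSign (T : Finset (Fin m)) (i : Fin m) :
    ∏ t ∈ T, pairSign d t i = (Int.negOnePow ((d i - 1) * degSum d T) : ℤ) := by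
  rw [mul_comm, degSum, Finset.sum_mul, negOnePow_sum, Units.coe_prod]
  rfl

theorem mergeSign_insert_left {S T : Finset (Fin m)} {i : Fin m} (hS : i ∉ S) (hT : i ∉ T) :
    mergeSign d (insert i S) T
      = (Int.negOnePow ((d i - 1) * degSum d T) : ℤ) * moveSign d T i * mergeSign d S T := by
  simp only [mergeSign, moveSign_insert d hS, Finset.prod_mul_distrib]
  congr 1
  rw [← prod_pairSign]
  refine Eq.trans ?_ Finset.prod_mul_distrib
  refine Finset.prod_congr rfl fun t ht => ?_
  have hti : t ≠ i := fun h => hT (h ▸ ht)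
  rcases lt_or_gt_of_ne hti with h | h
  · simp [h, h.not_gt, pairSign_comm d i t]
  · simp [h, h.not_gt, pairSign_mul_self]

/-- The product of an element `v` of shifted degree `c` and an element `φ`, both with coefficients
in the algebra of parameters, with respect to the bilinear map `B`. The sign is that of moving `v S`
together with its parameters past those of `φ T`. -/
def rightMul (c : ℤ) (B : V →ₗ[ℝ] W →ₗ[ℝ] W') (v : Finset (Fin m) → V)
    (φ : Finset (Fin m) → W) : Finset (Fin m) → W' :=
  comb d fun S T => (Int.negOnePow ((degSum d S + c) * degSum d T) : ℤ) • B (v S) (φ T)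

theorem rightMul_theta (c : ℤ) (B : V →ₗ[ℝ] W →ₗ[ℝ] W') (v : Finset (Fin m) → V)
    (φ : Finset (Fin m) → W) (i : Fin m) :
    rightMul d c B (theta d i v) φ = theta d i (rightMul d c B v φ) := by
  funext U
  rw [rightMul, comb_apply, theta_apply]
  by_cases hi : i ∈ U
  · rw [if_pos hi, rightMul, comb_apply, Finset.smul_sum]
    symm
    refine Finset.sum_of_injOn (fun S => insert i S) ?_ ?_ ?_ ?_
    · intro S hS S' hS' h
      rw [Finset.mem_coe, Finset.mem_powerset, Finset.subset_erase] at hS hS'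
      have := congrArg (Finset.erase · i) h
      simpa [Finset.erase_insert hS.2, Finset.erase_insert hS'.2] using this
    · intro S hS
      rw [Finset.mem_coe, Finset.mem_powerset, Finset.subset_erase] at hS
      exact Finset.mem_coe.mpr (Finset.mem_powerset.mpr (Finset.insert_subset hi hS.1))
    · intro S hS hn
      rw [Finset.mem_powerset] at hS
      have : i ∉ S := by
        intro h
        refine hn ⟨S.erase i, ?_, Finset.insert_erase h⟩
        exact Finset.mem_coe.mpr (Finset.mem_powerset.mpr (Finset.erase_subset_erase i hS))
      rw [theta_apply, if_neg this, map_zero, LinearMap.zero_apply, smul_zero, smul_zero]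
    · intro S hS
      rw [Finset.mem_powerset, Finset.subset_erase] at hS
      have h2 : U.erase i \ S = U \ insert i S := by
        ext j; simp only [Finset.mem_sdiff, Finset.mem_erase, Finset.mem_insert]; tauto
      have h4 : U.erase i = S ∪ (U.erase i \ S) := by
        rw [Finset.union_sdiff_of_subset (Finset.subset_erase.mpr hS)]
      have h5 : i ∉ U.erase i \ S := by simp
      conv_lhs => rw [h4, moveSign_union d Finset.disjoint_sdiff, ← h4]
      rw [← h2]
      obtain ⟨T, hT⟩ : ∃ T, T = U.erase i \ S := ⟨_, rfl⟩
      rw [← hT] at h5 ⊢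
      rw [theta_apply_insert d hS.2, mergeSign_insert_left d hS.2 h5, map_zsmul,
        LinearMap.smul_apply]
      simp only [smul_smul]
      congr 1
      have e : degSum d (insert i S) = (d i - 1) + degSum d S := Finset.sum_insert hS.2
      have e2 : (Int.negOnePow ((degSum d (insert i S) + c) * degSum d T) : ℤ)
          = (Int.negOnePow ((d i - 1) * degSum d T) : ℤ)
            * (Int.negOnePow ((degSum d S + c) * degSum d T) : ℤ) := by
        rw [e, ← Units.val_mul, ← Int.negOnePow_add]
        congr 2
        ring
      have e3 : (Int.negOnePow ((d i - 1) * degSum d T) : ℤ)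
          * (Int.negOnePow ((d i - 1) * degSum d T) : ℤ) = 1 := by
        rw [← Units.val_mul, Int.units_mul_self, Units.val_one]
      rw [e2]
      linear_combination (-moveSign d S i * moveSign d T i * mergeSign d S T
        * (Int.negOnePow ((degSum d S + c) * degSum d T) : ℤ)) * e3
  · rw [if_neg hi]
    refine Finset.sum_eq_zero fun S hS => ?_
    have : i ∉ S := fun h => hi (Finset.mem_powerset.mp hS h)
    rw [theta_apply, if_neg this, map_zero, LinearMap.zero_apply, smul_zero, smul_zero]

theorem rightMul_constCoeff (c : ℤ) (B : V →ₗ[ℝ] W →ₗ[ℝ] W') (v : V)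
    (φ : Finset (Fin m) → W) (U : Finset (Fin m)) :
    rightMul d c B (constCoeff v) φ U = (Int.negOnePow (c * degSum d U) : ℤ) • B v (φ U) := by
  rw [rightMul, comb_apply, Finset.sum_eq_single ∅]
  · simp [mergeSign_empty_left, constCoeff_empty, degSum]
  · intro S _ hS
    simp [constCoeff_apply_of_ne _ hS]
  · simp

theorem rightMul_sum {ι : Type*} (s : Finset ι) (c : ℤ) (B : V →ₗ[ℝ] W →ₗ[ℝ] W')
    (v : ι → Finset (Fin m) → V) (φ : Finset (Fin m) → W) :
    rightMul d c B (∑ i ∈ s, v i) φ = ∑ i ∈ s, rightMul d c B (v i) φ := by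
  simp only [rightMul]
  rw [← map_sum]
  congr 1
  funext S T
  simp only [Finset.sum_apply, map_sum, LinearMap.sum_apply, Finset.smul_sum]

theorem rightMul_smul (r : ℝ) (c : ℤ) (B : V →ₗ[ℝ] W →ₗ[ℝ] W')
    (v : Finset (Fin m) → V) (φ : Finset (Fin m) → W) :
    rightMul d c B (r • v) φ = r • rightMul d c B v φ := by
  simp only [rightMul]
  rw [← map_smul]
  congr 1
  funext S T
  simp only [Pi.smul_apply, map_smul, LinearMap.smul_apply]
  rw [smul_comm]

/-- The degrees of a tuple of degrees `d`, preceded by an element of shifted degree `c` whose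
coefficient is the product of the parameters with indices in `S`. -/
def consDeg (c : ℤ) (S : Finset (Fin m)) : Fin (m + 1) → ℤ := Fin.cons (degSum d S + c + 1) d

/-- The indices in `T`, shifted by one. -/
abbrev upSet (T : Finset (Fin m)) : Finset (Fin (m + 1)) := T.map (Fin.succEmb m)

/-- The part without the first parameter, as an element of the algebra of the remaining parameters.
-/
def slice₀ : (Finset (Fin (m + 1)) → W) →ₗ[ℝ] (Finset (Fin m) → W) where
  toFun φ T := φ (upSet T)
  map_add' _ _ := rfl
  map_smul' _ _ := rfl

/-- The coefficient of the first parameter, as an element of the algebra of the remaining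
parameters. -/
def slice₁ : (Finset (Fin (m + 1)) → W) →ₗ[ℝ] (Finset (Fin m) → W) where
  toFun φ T := φ (insert 0 (upSet T))
  map_add' _ _ := rfl
  map_smul' _ _ := rfl

theorem zero_notMem_upSet (T : Finset (Fin m)) : (0 : Fin (m + 1)) ∉ upSet T := by
  simp [upSet, Fin.succ_ne_zero]

theorem upSet_erase (T : Finset (Fin m)) (i : Fin m) :
    (upSet T).erase i.succ = upSet (T.erase i) := by
  rw [upSet, upSet, Finset.map_erase]; rfl

theorem succ_mem_upSet (T : Finset (Fin m)) (i : Fin m) : i.succ ∈ upSet T ↔ i ∈ T := by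
  simp [upSet]

variable (c : ℤ) (S : Finset (Fin m))

theorem moveSign_upSet (T : Finset (Fin m)) (i : Fin m) :
    moveSign (consDeg d c S) (upSet T) i.succ = moveSign d T i := by
  simp only [moveSign, upSet, Finset.prod_map, Fin.coe_succEmb, Fin.succ_lt_succ_iff]
  rfl

theorem moveSign_insert_upSet (T : Finset (Fin m)) (i : Fin m) :
    moveSign (consDeg d c S) (insert 0 (upSet T)) i.succ = moveSign d T i := by
  rw [moveSign_insert _ (zero_notMem_upSet T), moveSign_upSet]
  simp

theorem moveSign_zero_upSet (T : Finset (Fin m)) :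
    moveSign (consDeg d c S) (upSet T) 0
      = (Int.negOnePow ((degSum d S + c) * degSum d T) : ℤ) := by
  have : moveSign (consDeg d c S) (upSet T) 0 = ∏ j ∈ upSet T, pairSign (consDeg d c S) j 0 := by
    refine Finset.prod_congr rfl fun j hj => ?_
    rw [if_pos]
    exact Fin.pos_of_ne_zero fun h => zero_notMem_upSet T (h ▸ hj)
  rw [this, prod_pairSign, degSum, upSet, Finset.sum_map]
  simp [consDeg, degSum]

theorem slice₀_theta_succ (i : Fin m) (φ : Finset (Fin (m + 1)) → W) :
    slice₀ (theta (consDeg d c S) i.succ φ) = theta d i (slice₀ φ) := by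
  funext T
  simp only [slice₀, LinearMap.coe_mk, AddHom.coe_mk, theta_apply, succ_mem_upSet, upSet_erase,
    moveSign_upSet]

theorem slice₁_theta_succ (i : Fin m) (φ : Finset (Fin (m + 1)) → W) :
    slice₁ (theta (consDeg d c S) i.succ φ) = theta d i (slice₁ φ) := by
  funext T
  have h : (insert 0 (upSet T)).erase i.succ = insert 0 (upSet (T.erase i)) := by
    rw [Finset.erase_insert_of_ne (Fin.succ_ne_zero i).symm, upSet_erase]
  have h2 : i.succ ∈ insert 0 (upSet T) ↔ i ∈ T := by
    rw [Finset.mem_insert, succ_mem_upSet]; simp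
  simp only [slice₁, LinearMap.coe_mk, AddHom.coe_mk, theta_apply, h2, h, moveSign_insert_upSet]

theorem slice₀_theta_zero (φ : Finset (Fin (m + 1)) → W) :
    slice₀ (theta (consDeg d c S) 0 φ) = 0 := by
  funext T
  simp only [slice₀, LinearMap.coe_mk, AddHom.coe_mk, theta_apply, zero_notMem_upSet, if_false]
  rfl

theorem slice₁_theta_zero (φ : Finset (Fin (m + 1)) → W) (T : Finset (Fin m)) :
    slice₁ (theta (consDeg d c S) 0 φ) T
      = (Int.negOnePow ((degSum d S + c) * degSum d T) : ℤ) • slice₀ φ T := by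
  simp only [slice₁, slice₀, LinearMap.coe_mk, AddHom.coe_mk,
    theta_apply_insert _ (zero_notMem_upSet T), moveSign_zero_upSet]

theorem slice₀_constCoeff (v : W) : slice₀ (m := m) (constCoeff v) = constCoeff v := by
  funext T
  by_cases h : T = ∅
  · subst h; simp [slice₀, constCoeff_empty, upSet]
  · simp [slice₀, constCoeff_apply_of_ne, upSet, h]

theorem slice₁_constCoeff (v : W) : slice₁ (m := m) (constCoeff v) = 0 := by
  funext T
  simp [slice₁, constCoeff_apply_of_ne]

theorem degSum_upSet (T : Finset (Fin m)) : degSum (consDeg d c S) (upSet T) = degSum d T := by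
  rw [degSum, upSet, Finset.sum_map]
  simp [consDeg, degSum]

theorem degSum_insert_upSet (T : Finset (Fin m)) :
    degSum (consDeg d c S) (insert 0 (upSet T)) = degSum d S + c + degSum d T := by
  rw [degSum, Finset.sum_insert (zero_notMem_upSet T)]
  change _ + degSum (consDeg d c S) (upSet T) = _
  rw [degSum_upSet]
  simp [consDeg]

/-- The behaviour of an expression in a generic element when an element `u` is inserted in front of
the tuple. For every `S`, the expression `Φ S` belongs to the tuple whose first element is the
coefficient `u S`, of shifted degree `degSum d S + c`. Then `φ` is the expression without the
inserted element, and `ψ`, obtained by multiplying the coefficient of the first parameter of `Φ S`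
by the product of the parameters in `S` and summing over `S`, is its derivative in the direction of
`u`. -/
structure IsInsertion (Φ : Finset (Fin m) → Finset (Fin (m + 1)) → W)
    (φ ψ : Finset (Fin m) → W) : Prop where
  left : ∀ S, slice₀ (Φ S) = φ
  right : comb d (fun S => slice₁ (Φ S)) = ψ

variable {d c}

theorem IsInsertion.congr_right {Φ : Finset (Fin m) → Finset (Fin (m + 1)) → W}
    {φ ψ ψ' : Finset (Fin m) → W} (h : IsInsertion d Φ φ ψ) (e : ψ = ψ') :
    IsInsertion d Φ φ ψ' := e ▸ h

theorem IsInsertion.add {Φ Φ' : Finset (Fin m) → Finset (Fin (m + 1)) → W}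
    {φ ψ φ' ψ' : Finset (Fin m) → W} (h : IsInsertion d Φ φ ψ) (h' : IsInsertion d Φ' φ' ψ') :
    IsInsertion d (Φ + Φ') (φ + φ') (ψ + ψ') where
  left S := by rw [Pi.add_apply, map_add, h.left, h'.left]
  right := by
    rw [← h.right, ← h'.right, ← map_add]
    rfl

theorem IsInsertion.smul {Φ : Finset (Fin m) → Finset (Fin (m + 1)) → W}
    {φ ψ : Finset (Fin m) → W} (r : ℝ) (h : IsInsertion d Φ φ ψ) :
    IsInsertion d (r • Φ) (r • φ) (r • ψ) where
  left S := by rw [Pi.smul_apply, map_smul, h.left]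
  right := by
    rw [← h.right, ← map_smul]
    rfl

theorem IsInsertion.neg {Φ : Finset (Fin m) → Finset (Fin (m + 1)) → W}
    {φ ψ : Finset (Fin m) → W} (h : IsInsertion d Φ φ ψ) : IsInsertion d (-Φ) (-φ) (-ψ) := by
  simpa using h.smul (-1)

theorem IsInsertion.sub {Φ Φ' : Finset (Fin m) → Finset (Fin (m + 1)) → W}
    {φ ψ φ' ψ' : Finset (Fin m) → W} (h : IsInsertion d Φ φ ψ) (h' : IsInsertion d Φ' φ' ψ') :
    IsInsertion d (Φ - Φ') (φ - φ') (ψ - ψ') := by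
  simpa only [sub_eq_add_neg] using h.add h'.neg

theorem IsInsertion.sum {ι : Type*} (s : Finset ι)
    {Φ : ι → Finset (Fin m) → Finset (Fin (m + 1)) → W} {φ ψ : ι → Finset (Fin m) → W}
    (h : ∀ i, IsInsertion d (Φ i) (φ i) (ψ i)) :
    IsInsertion d (∑ i ∈ s, Φ i) (∑ i ∈ s, φ i) (∑ i ∈ s, ψ i) := by
  classical
  induction s using Finset.induction_on with
  | empty =>
    simp only [Finset.sum_empty]
    exact ⟨fun S => by simp, by simp; exact map_zero (comb d)⟩
  | insert i s hi ih =>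
    simp only [Finset.sum_insert hi]
    exact (h i).add ih

theorem IsInsertion.ptwise {Φ : Finset (Fin m) → Finset (Fin (m + 1)) → W}
    {φ ψ : Finset (Fin m) → W} (A : W →ₗ[ℝ] W') (h : IsInsertion d Φ φ ψ) :
    IsInsertion d (fun S => _root_.ptwise A (Φ S)) (_root_.ptwise A φ) (_root_.ptwise A ψ) where
  left S := by rw [← h.left S]; rfl
  right := by
    rw [← h.right, ← comb_ptwise]
    rfl

theorem IsInsertion.degProj {Φ : Finset (Fin m) → Finset (Fin (m + 1)) → W}
    {φ ψ : Finset (Fin m) → W} (p : ℤ) (h : IsInsertion d Φ φ ψ) :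
    IsInsertion d (fun S => degProj (consDeg d c S) p (Φ S)) (degProj d p φ)
      (degProj d (p - c) ψ) where
  left S := by
    rw [← h.left S]
    funext T
    simp only [slice₀, LinearMap.coe_mk, AddHom.coe_mk, degProj_apply, degSum_upSet]
  right := by
    rw [← h.right]
    funext U
    rw [degProj_apply, comb_apply, comb_apply]
    have e : ∀ S ∈ U.powerset, (slice₁ (CartanCalculus.degProj (consDeg d c S) p (Φ S)) (U \ S))
        = if degSum d U = p - c then slice₁ (Φ S) (U \ S) else 0 := by
      intro S hS
      have hU : degSum d U = degSum d S + degSum d (U \ S) := by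
        rw [← degSum_union d Finset.disjoint_sdiff,
          Finset.union_sdiff_of_subset (Finset.mem_powerset.mp hS)]
      simp only [slice₁, LinearMap.coe_mk, AddHom.coe_mk, degProj_apply, degSum_insert_upSet, hU]
      congr 1
      exact propext ⟨fun h => by linarith, fun h => by linarith⟩
    rw [Finset.sum_congr rfl fun S hS => by rw [e S hS]]
    split_ifs <;> simp

variable (d) in
/-- The element `∑ i, θ_i φ_i`. -/
def generic (φ : Fin m → W) : Finset (Fin m) → W := ∑ i, theta d i (constCoeff (φ i))

theorem generic_apply (φ : Fin m → W) (T : Finset (Fin m)) :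
    generic d φ T = ∑ i, if T = {i} then φ i else 0 := by
  rw [generic, Finset.sum_apply]
  refine Finset.sum_congr rfl fun i _ => ?_
  rw [theta_apply]
  by_cases h : T = {i}
  · subst h; simp [constCoeff_empty, moveSign]
  · rw [if_neg h]
    split_ifs with h1
    · rw [constCoeff_apply_of_ne, smul_zero]
      intro h2
      rw [Finset.erase_eq_empty_iff] at h2
      rcases h2 with h2 | h2
      · simp [h2] at h1
      · exact h h2
    · rfl

/-- The derivative of the generic element in the direction of `u` is `u`. -/
theorem isInsertion_generic (u : Finset (Fin m) → W) (φ : Fin m → W) :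
    IsInsertion d (fun S => generic (consDeg d c S) (Fin.cons (u S) φ)) (generic d φ) u where
  left S := by
    simp only [generic, Fin.sum_univ_succ, map_add, map_sum, slice₀_theta_zero,
      slice₀_theta_succ, slice₀_constCoeff, Fin.cons_succ, zero_add]
  right := by
    funext U
    rw [comb_apply, Finset.sum_eq_single U]
    · simp only [generic, Fin.sum_univ_succ, map_add, map_sum, slice₁_theta_succ,
        slice₁_constCoeff, map_zero, Finset.sum_const_zero, add_zero, slice₁_theta_zero,
        Fin.cons_zero, slice₀_constCoeff, sdiff_self, Finset.bot_eq_empty, constCoeff_empty,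
        mergeSign_empty_right]
      simp [degSum]
    · intro S hS hne
      have : U \ S ≠ ∅ := by
        rw [Ne, Finset.sdiff_eq_empty_iff_subset]
        exact fun h => hne (Finset.Subset.antisymm (Finset.mem_powerset.mp hS) h)
      simp only [generic, Fin.sum_univ_succ, map_add, map_sum, slice₁_theta_succ,
        slice₁_constCoeff, map_zero, Finset.sum_const_zero, add_zero, slice₁_theta_zero,
        Fin.cons_zero, slice₀_constCoeff, constCoeff_apply_of_ne _ this, smul_zero]
    · simp

theorem isInsertion_constCoeff (v : W) :
    IsInsertion d (fun _ => constCoeff v) (constCoeff v) 0 where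
  left S := slice₀_constCoeff v
  right := by simp only [slice₁_constCoeff]; exact map_zero (comb d)

/-- The operator `∑ i, θ_i B (X_i)`. -/
def paramOp (d : Fin m → ℤ) (B : V →ₗ[ℝ] Module.End ℝ W) (X : Fin m → V) :
    Module.End ℝ (Finset (Fin m) → W) := ∑ i, thetaEnd d i * _root_.ptwise (B (X i))

/-- The Leibniz rule: the operator `∑ i, θ_i B (X_i)` is linear in `X`, and its own derivative is
the multiplication by the inserted element `v`. -/
theorem isInsertion_paramOp {Φ : Finset (Fin m) → Finset (Fin (m + 1)) → W}
    {φ ψ : Finset (Fin m) → W} (B : V →ₗ[ℝ] Module.End ℝ W) {X : Fin m → V}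
    (v : Finset (Fin m) → V) (h : IsInsertion d Φ φ ψ) :
    IsInsertion d (fun S => paramOp (consDeg d c S) B (Fin.cons (v S) X) (Φ S))
      (paramOp d B X φ) (paramOp d B X ψ + rightMul d c B v φ) where
  left S := by
    simp only [paramOp, Fin.sum_univ_succ, LinearMap.add_apply, LinearMap.sum_apply,
      Module.End.mul_apply, map_add, map_sum, slice₀_theta_zero, slice₀_theta_succ, zero_add,
      Fin.cons_succ]
    rw [← h.left S]
    rfl
  right := by
    have e : (fun S => slice₁ (paramOp (consDeg d c S) B (Fin.cons (v S) X) (Φ S)))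
        = (fun S T => (Int.negOnePow ((degSum d S + c) * degSum d T) : ℤ) • B (v S) (φ T))
          + ∑ i, fun S => theta d i (_root_.ptwise (B (X i)) (slice₁ (Φ S))) := by
      funext S T
      simp only [paramOp, Fin.sum_univ_succ, LinearMap.add_apply, LinearMap.sum_apply,
        Module.End.mul_apply, map_add, map_sum, slice₁_theta_succ, Fin.cons_succ, Fin.cons_zero,
        Pi.add_apply, Finset.sum_apply, slice₁_theta_zero]
      rw [← h.left S]
      rfl
    rw [e, map_add, map_sum, add_comm]
    simp only [comb_theta, comb_ptwise, h.right]
    simp [paramOp, rightMul]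

end Insertion

namespace CartanCalculus

variable {𝔤 Ω : Type*} [AddCommGroup 𝔤] [Module ℝ 𝔤] [AddCommGroup Ω] [Module ℝ Ω]
  (C : CartanCalculus 𝔤 Ω) {m : ℕ} {d : Fin m → ℤ} {c : ℤ} {X : Fin m → 𝔤}
  {v : Finset (Fin m) → 𝔤} {ν κ : Module.End ℝ (Finset (Fin m) → Ω)}
  {Φ : Finset (Fin m) → Finset (Fin (m + 1)) → Ω} {φ ψ : Finset (Fin m) → Ω}

/-- The derivative of `R φ`, if `ν` denotes the contraction with the inserted vector field `v`. -/
theorem isInsertion_contr (hν : ∀ φ, rightMul d c C.ρ v φ = ν φ) (h : IsInsertion d Φ φ ψ) :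
    IsInsertion d (fun S => C.contr (consDeg d c S) (Fin.cons (v S) X) (Φ S))
      (C.contr d X φ) (C.contr d X ψ + ν φ) :=
  (isInsertion_paramOp C.ρ v h).congr_right (congrArg (C.contr d X ψ + ·) (hν φ))

theorem isInsertion_diff (h : IsInsertion d Φ φ ψ) :
    IsInsertion d (fun S => C.diff (Φ S)) (C.diff φ) (C.diff ψ) := h.ptwise C.d

theorem isInsertion_lieOp (hν : ∀ φ, rightMul d c C.ρ v φ = ν φ) (h : IsInsertion d Φ φ ψ) :
    IsInsertion d (fun S => C.lieOp (consDeg d c S) (Fin.cons (v S) X) (Φ S))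
      (C.lieOp d X φ)
      (C.lieOp d X ψ + (ν * C.diff - C.diff * ν : Module.End ℝ (Finset (Fin m) → Ω)) φ) := by
  have h1 := (C.isInsertion_contr (X := X) hν (C.isInsertion_diff h)).sub
    (C.isInsertion_diff (C.isInsertion_contr (X := X) hν h))
  refine IsInsertion.congr_right h1 ?_
  simp only [lieOp, LinearMap.sub_apply, Module.End.mul_apply, map_add]
  rw [add_sub_add_comm]

/-- The derivative of `Q φ`: the operator `Q` itself does not change, if `ν` and its commutator `κ`
with `d` are compatible with `R` and `L`. This is the case for `v = [X, X] / 2`, by the Jacobi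
identity. -/
theorem isInsertion_curvOp (hν : ∀ φ, rightMul d c C.ρ v φ = ν φ)
    (hνd : ν * C.diff - C.diff * ν = κ) (hκ : κ * C.contr d X = C.contr d X * κ)
    (hL : ν * C.lieOp d X = C.lieOp d X * ν) (h : IsInsertion d Φ φ ψ) :
    IsInsertion d (fun S => C.curvOp (consDeg d c S) (Fin.cons (v S) X) (Φ S))
      (C.curvOp d X φ) (C.curvOp d X ψ) := by
  have h1 := (C.isInsertion_contr (X := X) hν (C.isInsertion_lieOp (X := X) hν h)).sub
    (C.isInsertion_lieOp (X := X) hν (C.isInsertion_contr (X := X) hν h))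
  refine IsInsertion.congr_right h1 ?_
  rw [hνd]
  have h2 : κ (C.contr d X φ) = C.contr d X (κ φ) := LinearMap.congr_fun hκ φ
  have h3 : ν (C.lieOp d X φ) = C.lieOp d X (ν φ) := LinearMap.congr_fun hL φ
  simp only [curvOp, LinearMap.sub_apply, Module.End.mul_apply, map_add, h2, h3]
  abel

/-- The derivative of `R ^ k φ`. The coefficient vanishes where the exponent `k - 1` is truncated.
-/
theorem isInsertion_contr_pow (hν : ∀ φ, rightMul d c C.ρ v φ = ν φ)
    (hR : ν * C.contr d X = C.contr d X * ν) (k : ℕ) (h : IsInsertion d Φ φ ψ) :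
    IsInsertion d (fun S => (C.contr (consDeg d c S) (Fin.cons (v S) X) ^ k) (Φ S))
      ((C.contr d X ^ k) φ)
      ((C.contr d X ^ k) ψ + (k • C.contr d X ^ (k - 1)) (ν φ)) := by
  induction k with
  | zero => simpa using h
  | succ k ih =>
    have h1 := C.isInsertion_contr (X := X) hν ih
    simp only [pow_succ', Module.End.mul_apply]
    refine IsInsertion.congr_right h1 ?_
    have h2 : ν ((C.contr d X ^ k) φ) = (C.contr d X ^ k) (ν φ) :=
      LinearMap.congr_fun (Commute.pow_right (show Commute ν (C.contr d X) from hR) k).eq φ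
    rw [h2, map_add, add_assoc]
    congr 1
    cases k with
    | zero => simp
    | succ k =>
      simp only [Nat.add_sub_cancel, LinearMap.smul_apply, map_nsmul]
      rw [succ_nsmul _ (k + 1), pow_succ', Module.End.mul_apply]

/-- The chain rule: the derivative of `f(R) φ` is `f(R) ψ + f'(R) ν φ`. The truncation has one term
more for the tuple with the inserted element, as that tuple is longer. -/
theorem isInsertion_evalSeries (hν : ∀ φ, rightMul d c C.ρ v φ = ν φ)
    (hR : ν * C.contr d X = C.contr d X * ν) (f : PowerSeries ℝ) (h : IsInsertion d Φ φ ψ) :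
    IsInsertion d
      (fun S => evalSeries (m + 2) (C.contr (consDeg d c S) (Fin.cons (v S) X)) f (Φ S))
      (evalSeries (m + 1) (C.contr d X) f φ)
      (evalSeries (m + 1) (C.contr d X) f ψ
        + evalSeries (m + 1) (C.contr d X) (PowerSeries.derivative ℝ f) (ν φ)) := by
  have h1 := IsInsertion.sum (Finset.range (m + 2)) fun k =>
    (C.isInsertion_contr_pow hν hR k h).smul (PowerSeries.coeff k f)
  convert h1 using 1
  · funext S
    simp [evalSeries, LinearMap.sum_apply]
  · rw [← evalSeries_eq_of_le (C.contr_pow_eq_zero (Nat.lt_succ_self m)) (Nat.le_succ (m + 1))]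
    simp [evalSeries, LinearMap.sum_apply]
  · rw [← sum_range_deriv,
      ← evalSeries_eq_of_le (C.contr_pow_eq_zero (Nat.lt_succ_self m)) (Nat.le_succ (m + 1)) f]
    simp only [evalSeries, LinearMap.sum_apply, LinearMap.smul_apply, smul_add,
      Finset.sum_add_distrib]

end CartanCalculus
/-! ### Nested brackets of the generic element -/

section SeqSum

variable {m : ℕ} (d : Fin m → ℤ) {W : Type*} [AddCommGroup W] [Module ℝ W]

theorem seqSum_one (f : (Fin 1 → Fin m) → W) :
    seqSum d 1 f = ∑ i, theta d i (constCoeff (f fun _ => i)) := by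
  rw [seqSum_succ]
  refine Finset.sum_congr rfl fun i _ => ?_
  rw [seqSum_zero]
  congr 3

theorem seqSum_two (f : (Fin 2 → Fin m) → W) :
    seqSum d 2 f = ∑ j, ∑ i, theta d j (theta d i (constCoeff (f ![i, j]))) := by
  rw [seqSum_succ]
  refine Finset.sum_congr rfl fun j _ => ?_
  rw [seqSum_one, map_sum]
  refine Finset.sum_congr rfl fun i _ => ?_
  congr 4
  funext a
  refine Fin.lastCases ?_ (fun b => ?_) a
  · rw [Fin.snoc_last]; rfl
  · rw [Fin.snoc_castSucc, Subsingleton.elim b 0]; rfl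

theorem seqSum_smul (r : ℝ) (k : ℕ) (f : (Fin k → Fin m) → W) :
    seqSum d k (fun g => r • f g) = r • seqSum d k f := by
  simp only [seqSum, map_smul, Finset.smul_sum]

theorem seqSum_const_zero (k : ℕ) : seqSum d k (fun _ => (0 : W)) = 0 := by
  simp [seqSum]

/-- Moving the parameter of an element of degree zero past another one. -/
theorem theta_theta_of_eq_zero {i : Fin m} (hi : d i = 0) (l : Fin m) (φ : Finset (Fin m) → W) :
    theta d i (theta d l φ) = (Int.negOnePow (d l - 1) : ℤ) • theta d l (theta d i φ) := by
  by_cases h : i = l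
  · subst h; simp [theta_theta_self]
  · rw [theta_theta d i l h, pairSign, hi, zero_sub, neg_one_mul, Int.negOnePow_neg]

theorem theta_theta_theta {i j : Fin m} (hi : d i = 0) (hj : d j = 0) (l : Fin m)
    (φ : Finset (Fin m) → W) :
    theta d j (theta d i (theta d l φ)) = theta d l (theta d j (theta d i φ)) := by
  rw [theta_theta_of_eq_zero d hi, map_zsmul, theta_theta_of_eq_zero d hj, smul_smul,
    ← Units.val_mul, Int.units_mul_self, Units.val_one, one_smul]

end SeqSum

namespace CartanCalculus

open PowerSeries (coeff)

variable {𝔤 Ω : Type*} [AddCommGroup 𝔤] [Module ℝ 𝔤] [AddCommGroup Ω] [Module ℝ Ω]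
  (C : CartanCalculus 𝔤 Ω)

/-- The Poisson bracket of pairs of a vector field and a form. -/
def poisson (e f : 𝔤 × Ω) : 𝔤 × Ω := (0, C.ι e.1 f.2 + C.ρ f.1 e.2)

/-- The Dorfman bracket of pairs of a vector field and a form, twisted by `ϖ`. -/
def dorfman (ϖ : Ω) (e f : 𝔤 × Ω) : 𝔤 × Ω :=
  (C.br e.1 f.1, C.d (C.ι e.1 f.2) + C.ι e.1 (C.d f.2) + C.ρ f.1 (C.d e.2)
    + C.ι e.1 (C.ι f.1 ϖ))

/-- The iterated bracket, beginning with a Dorfman bracket. -/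
def nested (ϖ : Ω) : (k : ℕ) → (Fin (k + 2) → 𝔤 × Ω) → 𝔤 × Ω
  | 0, e => C.dorfman ϖ (e 0) (e 1)
  | k + 1, e => C.poisson (nested ϖ k (Fin.init e)) (e (Fin.last (k + 2)))

/-- The family whose symmetrization is the `L_∞`-structure given by the nested brackets. -/
def vinBase (ϖ : Ω) : GradedFamily (𝔤 × Ω) (𝔤 × Ω)
  | 0, _, _ => 0
  | 1, d, e => if d 0 = 0 then 0 else (0, C.d (e 0).2)
  | k + 2, d, e => -coeff (k + 1) bernSeries • if d 0 = 0 then C.nested ϖ k e else 0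

/-- `ρ (X k) ⋯ ρ (X 1) y`. -/
def iterContr : (k : ℕ) → (Fin k → 𝔤) → Ω → Ω
  | 0, _, y => y
  | k + 1, X, y => C.ρ (X (Fin.last k)) (iterContr k (Fin.init X) y)

/-- The family whose symmetrization is the `L_∞`-structure given by the contractions of `ϖ`. -/
def obsBase (ϖ : Ω) : GradedFamily (𝔤 × Ω) Ω
  | 0, _, _ => 0
  | 1, d, e => if d 0 = 0 then 0 else C.d (e 0).2
  | k + 2, _, e => coeff (k + 2) obsSeries • C.iterContr (k + 2) (fun i => (e i).1) ϖ

/-- The family whose symmetrization is a morphism between the two `L_∞`-structures. -/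
def morBase : GradedFamily (𝔤 × Ω) (𝔤 × Ω)
  | 0, _, _ => 0
  | 1, _, e => e 0
  | k + 2, _, e => (0, coeff (k + 1) (bernSeries + PowerSeries.X)
      • C.iterContr (k + 1) (fun i => (e i.succ).1) (e 0).2)

/-- A tuple of homogeneous elements of the degrees `d i`: the vector part is zero except in degree
zero, the form part has the degree which belongs to `d i`, and there are no elements of positive
degree. -/
structure IsHomTuple {m : ℕ} (d : Fin m → ℤ) (e : Fin m → 𝔤 × Ω) : Prop where
  vec : ∀ i, d i ≠ 0 → (e i).1 = 0
  form : ∀ i, (e i).2 ∈ C.gr (d i - 1)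
  nonpos : ∀ i, 0 < d i → (e i).2 = 0

variable {m : ℕ} (d : Fin m → ℤ) (e : Fin m → 𝔤 × Ω)

theorem seqSum_ρ (X : Fin m → 𝔤) (k : ℕ) (f : (Fin k → Fin m) → Ω) :
    seqSum d (k + 1) (fun g => C.ρ (X (g (Fin.last k))) (f (Fin.init g)))
      = C.contr d X (seqSum d k f) := by
  rw [seqSum_succ, contr, LinearMap.sum_apply]
  refine Finset.sum_congr rfl fun i _ => ?_
  simp only [Fin.snoc_last, Fin.init_snoc, seqSum_map]
  rfl

theorem seqSum_iterContr (X : Fin m → 𝔤) (k : ℕ) (y : Ω) :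
    seqSum d k (fun g => C.iterContr k (fun i => X (g i)) y)
      = (C.contr d X ^ k) (constCoeff y) := by
  induction k with
  | zero => rw [seqSum_zero]; rfl
  | succ k ih =>
    rw [pow_succ', Module.End.mul_apply, ← ih]
    exact C.seqSum_ρ d X k fun g => C.iterContr k (fun i => X (g i)) y

theorem seqSum_iterContr_generic (X : Fin m → 𝔤) (φ : Fin m → Ω) (k : ℕ) :
    seqSum d (k + 1) (fun g => C.iterContr k (fun i => X (g i.succ)) (φ (g 0)))
      = (C.contr d X ^ k) (generic d φ) := by
  induction k with
  | zero => rw [seqSum_one]; rfl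
  | succ k ih =>
    rw [pow_succ', Module.End.mul_apply, ← ih]
    exact C.seqSum_ρ d X (k + 1) fun g => C.iterContr k (fun i => X (g i.succ)) (φ (g 0))

/-- The vector part of the structures on the generic element: half the bracket of the generic vector
field `∑ i, θ_i X_i` with itself. -/
def vecCurv (X : Fin m → 𝔤) : Finset (Fin m) → 𝔤 :=
  (1 / 2 : ℝ) • ∑ j, ∑ i, theta d j (theta d i (constCoeff (C.br (X i) (X j))))

variable {d e}

/-- The sum of all iterated brackets of length `k + 2` of the generic element. -/
def nestedSum (d : Fin m → ℤ) (e : Fin m → 𝔤 × Ω) (ϖ : Ω) (k : ℕ) : Finset (Fin m) → 𝔤 × Ω :=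
  seqSum d (k + 2) fun g => if d (g 0) = 0 then C.nested ϖ k (e ∘ g) else 0

theorem ptwise_nestedSum {W : Type*} [AddCommGroup W] [Module ℝ W] (A : 𝔤 × Ω →ₗ[ℝ] W) (ϖ : Ω)
    (k : ℕ) : ptwise A (C.nestedSum d e ϖ k)
      = seqSum d (k + 2) fun g => if d (g 0) = 0 then A (C.nested ϖ k (e ∘ g)) else 0 := by
  rw [nestedSum, ← seqSum_map]
  congr 1
  funext g
  split_ifs <;> simp

/-- The vector part of the Dorfman bracket of the generic element with itself. -/
theorem nestedSum_zero_fst (h : C.IsHomTuple d e) (ϖ : Ω) :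
    ptwise (LinearMap.fst ℝ 𝔤 Ω) (C.nestedSum d e ϖ 0)
      = (2 : ℝ) • C.vecCurv d fun i => (e i).1 := by
  rw [ptwise_nestedSum, vecCurv, smul_smul, seqSum_two]
  norm_num
  refine Finset.sum_congr rfl fun j _ => Finset.sum_congr rfl fun i _ => ?_
  by_cases hi : d i = 0
  · simp [hi, nested, dorfman]
  · simp [hi, h.vec i hi]

theorem nested_succ_snoc (ϖ : Ω) (k : ℕ) (g : Fin (k + 2) → Fin m) (l : Fin m) :
    C.nested ϖ (k + 1) (e ∘ (Fin.snoc g l : Fin (k + 3) → Fin m))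
      = C.poisson (C.nested ϖ k (e ∘ g)) (e l) := by
  rw [nested]
  congr 2
  · funext i; simp [Fin.init, Function.comp]
  · simp

theorem nestedSum_succ_fst (ϖ : Ω) (k : ℕ) :
    ptwise (LinearMap.fst ℝ 𝔤 Ω) (C.nestedSum d e ϖ (k + 1)) = 0 := by
  rw [ptwise_nestedSum]
  convert seqSum_const_zero d (k + 1 + 2) using 2
  funext g
  simp [nested, poisson]

/-- A further Poisson bracket with the generic element contracts with its vector part; in addition,
the vector part of the inner bracket contracts the form part of the generic element. -/
theorem nestedSum_succ_snd (ϖ : Ω) (k : ℕ) :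
    ptwise (LinearMap.snd ℝ 𝔤 Ω) (C.nestedSum d e ϖ (k + 1))
      = C.contr d (fun i => (e i).1) (ptwise (LinearMap.snd ℝ 𝔤 Ω) (C.nestedSum d e ϖ k))
        + ∑ l, theta d l (ptwise (C.ι.flip (e l).2)
          (ptwise (LinearMap.fst ℝ 𝔤 Ω) (C.nestedSum d e ϖ k))) := by
  rw [ptwise_nestedSum, seqSum_succ, contr, LinearMap.sum_apply, ← Finset.sum_add_distrib]
  refine Finset.sum_congr rfl fun l _ => ?_
  rw [Module.End.mul_apply, ← map_add]
  congr 1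
  rw [ptwise_nestedSum, ptwise_nestedSum, ← seqSum_map, ← seqSum_map, ← seqSum_add]
  congr 1
  funext g
  have h0 : (Fin.snoc g l : Fin (k + 3) → Fin m) 0 = g 0 := by
    rw [← Fin.castSucc_zero, Fin.snoc_castSucc]
  rw [h0, nested_succ_snoc]
  split_ifs with h
  · simp [poisson, add_comm]
  · simp

/-- The part of a generic element of degree `p` comes from the arguments of degree `p + 1`. -/
theorem degProj_generic (p : ℤ) (φ : Fin m → Ω) :
    degProj d p (generic d φ)
      = ∑ i, theta d i (constCoeff (if d i - 1 = p then φ i else 0)) := by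
  funext S
  rw [degProj_apply, generic_apply]
  change _ = generic d (fun i => if d i - 1 = p then φ i else 0) S
  rw [generic_apply]
  by_cases h : degSum d S = p
  · rw [if_pos h]
    refine Finset.sum_congr rfl fun i _ => ?_
    by_cases hS : S = {i}
    · subst hS
      rw [if_pos rfl, if_pos rfl, if_pos (by simpa [degSum] using h)]
    · rw [if_neg hS, if_neg hS]
  · rw [if_neg h]
    refine (Finset.sum_eq_zero fun i _ => ?_).symm
    by_cases hS : S = {i}
    · subst hS
      rw [if_pos rfl, if_neg (by simpa [degSum] using h)]
    · rw [if_neg hS]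

theorem lie_mem (X : 𝔤) {p : ℤ} {w : Ω} (h : w ∈ C.gr p) :
    C.d (C.ι X w) + C.ι X (C.d w) ∈ C.gr p := by
  have h1 := C.d_mem (C.ι_mem X h)
  have h2 := C.ι_mem X (C.d_mem h)
  rw [sub_add_cancel] at h1
  rw [add_sub_cancel_right] at h2
  exact add_mem h1 h2

/-- The form part of the Dorfman bracket of the generic element with itself, of which the first
entry has to be of degree zero. -/
theorem nestedSum_zero_snd (h : C.IsHomTuple d e) (ϖ : Ω) :
    ptwise (LinearMap.snd ℝ 𝔤 Ω) (C.nestedSum d e ϖ 0)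
      = (C.contr d (fun i => (e i).1) ^ 2) (constCoeff ϖ)
        + C.contr d (fun i => (e i).1)
          (C.diff (degProj d (-1) (generic d fun i => (e i).2)))
        + C.lieOp d (fun i => (e i).1) (generic d fun i => (e i).2) := by
  have e1 : (C.contr d (fun i => (e i).1) ^ 2) (constCoeff ϖ)
      = ∑ j, ∑ i, theta d j (theta d i (constCoeff (C.ρ (e j).1 (C.ρ (e i).1 ϖ)))) := by
    rw [← seqSum_iterContr, seqSum_two]
    rfl
  have e2 : C.contr d (fun i => (e i).1)
      (C.diff (degProj d (-1) (generic d fun i => (e i).2)))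
      = ∑ j, ∑ i, theta d j (theta d i (constCoeff
          (C.ρ (e j).1 (C.d (if d i = 0 then (e i).2 else 0))))) := by
    rw [degProj_generic, contr, LinearMap.sum_apply]
    refine Finset.sum_congr rfl fun j _ => ?_
    rw [Module.End.mul_apply, diff, map_sum, map_sum, map_sum]
    refine Finset.sum_congr rfl fun i _ => ?_
    rw [← theta_ptwise, ← theta_ptwise, ptwise_constCoeff, ptwise_constCoeff]
    have hi : d i - 1 = -1 ↔ d i = 0 := ⟨fun h => by omega, fun h => by omega⟩
    simp only [hi]
  have e3 : C.lieOp d (fun i => (e i).1) (generic d fun i => (e i).2)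
      = ∑ j, ∑ i, theta d j (theta d i (constCoeff
          (C.d (C.ι (e i).1 (e j).2) + C.ι (e i).1 (C.d (e j).2)))) := by
    rw [lieOp_eq, generic, map_sum]
    refine Finset.sum_congr rfl fun j _ => ?_
    rw [LinearMap.sum_apply]
    refine Finset.sum_congr rfl fun i _ => ?_
    rw [Module.End.mul_apply, ← theta_ptwise, ptwise_constCoeff]
    by_cases hi : d i = 0
    · have h1 : C.lieR (e i).1 (e j).2 = (Int.negOnePow (d j - 1) : ℤ)
          • (C.d (C.ι (e i).1 (e j).2) + C.ι (e i).1 (C.d (e j).2)) := by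
        rw [lieR_eq]
        exact C.γ_gr (C.lie_mem _ (h.form j))
      rw [thetaEnd, theta_theta_of_eq_zero d hi, h1, map_zsmul, map_zsmul, map_zsmul, smul_smul,
        ← Units.val_mul, Int.units_mul_self, Units.val_one, one_smul]
    · simp [h.vec i hi, lieR]
  rw [ptwise_nestedSum, seqSum_two, e1, e2, e3, ← Finset.sum_add_distrib,
    ← Finset.sum_add_distrib]
  refine Finset.sum_congr rfl fun j _ => ?_
  rw [← Finset.sum_add_distrib, ← Finset.sum_add_distrib]
  refine Finset.sum_congr rfl fun i _ => ?_
  rw [← map_add, ← map_add, ← map_add, ← map_add, ← map_add, ← map_add]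
  congr 3
  have hρ : C.ρ (e j).1 (C.ρ (e i).1 ϖ) = C.ι (e i).1 (C.ι (e j).1 ϖ) :=
    LinearMap.congr_fun (C.ρ_ρ (e j).1 (e i).1) ϖ
  by_cases hi : d i = 0
  · simp only [Matrix.cons_val_zero, hi, if_true, nested, dorfman, hρ]
    simp
    abel
  · simp [hi, h.vec i hi]

/-- The contraction of the form part of the generic element with the bracket of the vector parts. -/
theorem curvOp_generic (h : C.IsHomTuple d e) :
    C.curvOp d (fun i => (e i).1) (generic d fun i => (e i).2)
      = ∑ l, theta d l (ptwise (C.ι.flip (e l).2) ((2 : ℝ) • C.vecCurv d fun i => (e i).1)) := by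
  have e1 : ∀ l, theta d l (ptwise (C.ι.flip (e l).2)
      ((2 : ℝ) • C.vecCurv d fun i => (e i).1))
      = ∑ i, ∑ j, theta d l (theta d i (theta d j
        (constCoeff (C.ι (C.br (e j).1 (e i).1) (e l).2)))) := by
    intro l
    rw [vecCurv, smul_smul]
    norm_num
    simp only [← theta_ptwise, ptwise_constCoeff, LinearMap.flip_apply]
  simp only [e1]
  rw [curvOp_eq C h.vec, generic, map_sum]
  refine Finset.sum_congr rfl fun l _ => ?_
  simp only [LinearMap.sum_apply, Module.End.mul_apply, ← theta_ptwise, ptwise_constCoeff]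
  refine Finset.sum_congr rfl fun i _ => Finset.sum_congr rfl fun j _ => ?_
  by_cases hi : d i = 0
  · by_cases hj : d j = 0
    · exact theta_theta_theta d hj hi l _
    · simp [h.vec j hj]
  · simp [h.vec i hi]

/-- Only the innermost bracket has a vector part, and this enters through the bracket which follows;
all other brackets are contractions. -/
theorem nestedSum_snd (h : C.IsHomTuple d e) (ϖ : Ω) (k : ℕ) :
    ptwise (LinearMap.snd ℝ 𝔤 Ω) (C.nestedSum d e ϖ k)
      = (C.contr d (fun i => (e i).1) ^ k) (ptwise (LinearMap.snd ℝ 𝔤 Ω) (C.nestedSum d e ϖ 0))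
        + if k = 0 then 0 else (C.contr d (fun i => (e i).1) ^ (k - 1))
          (C.curvOp d (fun i => (e i).1) (generic d fun i => (e i).2)) := by
  induction k with
  | zero => simp
  | succ k ih =>
    rw [nestedSum_succ_snd, pow_succ', Module.End.mul_apply]
    cases k with
    | zero =>
      rw [curvOp_generic C h, nestedSum_zero_fst C h]
      simp
    | succ k =>
      rw [ih, nestedSum_succ_fst]
      simp [pow_succ', Module.End.mul_apply]

end CartanCalculus
/-! ### Closed formulas for the two structures and the morphism -/

section SeriesCoeff

open PowerSeries

theorem constantCoeff_bernSeries : constantCoeff bernSeries = 1 := by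
  rw [← coeff_zero_eq_constantCoeff_apply, coeff_bernSeries]
  simp

theorem coeff_lieSeries (k : ℕ) : coeff k lieSeries = -coeff (k + 1) bernSeries := by
  simp [lieSeries]

theorem coeff_curvSeries (k : ℕ) : coeff k curvSeries = -coeff (k + 2) bernSeries := by
  simp [curvSeries]

theorem coeff_one_obsSeries : coeff 1 obsSeries = 0 := by
  simp [obsSeries, evalNegHom, coeff_one, coeff_X, coeff_exp, coeff_rescale]

theorem coeff_X_mul_one_sub (k : ℕ) :
    coeff (k + 2) (X * (1 - bernSeries)) = -coeff (k + 1) bernSeries := by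
  rw [coeff_succ_X_mul, map_sub, coeff_one]
  simp

end SeriesCoeff

namespace CartanCalculus

open PowerSeries (coeff)

variable {𝔤 Ω : Type*} [AddCommGroup 𝔤] [Module ℝ 𝔤] [AddCommGroup Ω] [Module ℝ Ω]
  (C : CartanCalculus 𝔤 Ω) {m : ℕ} {d : Fin m → ℤ} {e : Fin m → 𝔤 × Ω} {X : Fin m → 𝔤}

section CardSupp

variable {W : Type*} [AddCommGroup W] [Module ℝ W]

/-- `φ` is homogeneous of degree `j` in the parameters. -/
def CardSupp (j : ℕ) (φ : Finset (Fin m) → W) : Prop := ∀ S, S.card ≠ j → φ S = 0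

theorem cardSupp_constCoeff (v : W) : CardSupp (m := m) 0 (constCoeff v) := fun S hS =>
  constCoeff_apply_of_ne v fun h => hS (by simp [h])

theorem cardSupp_generic (d : Fin m → ℤ) (φ : Fin m → W) : CardSupp 1 (generic d φ) := by
  intro S hS
  rw [generic_apply]
  refine Finset.sum_eq_zero fun i _ => if_neg ?_
  rintro rfl
  simp at hS

theorem CardSupp.ptwise {W' : Type*} [AddCommGroup W'] [Module ℝ W'] {j : ℕ}
    {φ : Finset (Fin m) → W} (h : CardSupp j φ) (A : W →ₗ[ℝ] W') :
    CardSupp j (_root_.ptwise A φ) := fun S hS => by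
  rw [LinearMap.compLeft_apply, Function.comp, h S hS, map_zero]

theorem CardSupp.degProj {j : ℕ} {φ : Finset (Fin m) → W} (h : CardSupp j φ) (p : ℤ) :
    CardSupp j (degProj d p φ) := fun S hS => by
  rw [degProj_apply, h S hS, ite_self]

variable {φ : Finset (Fin m) → Ω} {j : ℕ}

theorem CardSupp.contr (h : CardSupp j φ) : CardSupp (j + 1) (C.contr d X φ) := fun S hS => by
  rw [contr_apply]
  refine Finset.sum_eq_zero fun i hi => ?_
  rw [h, map_zero, smul_zero]
  have := Finset.card_erase_add_one hi
  omega

theorem CardSupp.diff (h : CardSupp j φ) : CardSupp j (C.diff φ) := h.ptwise C.d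

theorem CardSupp.lieOp (h : CardSupp j φ) : CardSupp (j + 1) (C.lieOp d X φ) :=
  fun S hS => by
    simp only [CartanCalculus.lieOp, LinearMap.sub_apply, Module.End.mul_apply, Pi.sub_apply]
    rw [(h.diff C).contr C S hS, (h.contr C).diff C S hS, sub_zero]

theorem CardSupp.curvOp (h : CardSupp j φ) : CardSupp (j + 2) (C.curvOp d X φ) :=
  fun S hS => by
    simp only [CartanCalculus.curvOp, LinearMap.sub_apply, Module.End.mul_apply, Pi.sub_apply]
    rw [(h.lieOp C).contr C S hS, (h.contr C).lieOp C S hS, sub_zero]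

theorem CardSupp.contr_pow (h : CardSupp j φ) (k : ℕ) :
    CardSupp (j + k) ((C.contr d X ^ k) φ) := by
  induction k with
  | zero => exact h
  | succ k ih =>
    rw [pow_succ']
    exact ih.contr C

/-- In a coefficient with a fixed number of parameters, only one term of the power series
contributes. -/
theorem evalSeries_apply (h : CardSupp j φ) (f : PowerSeries ℝ) {S : Finset (Fin m)} {k : ℕ}
    (hk : S.card = j + k) :
    evalSeries (m + 1) (C.contr d X) f φ S = coeff k f • (C.contr d X ^ k) φ S := by
  simp only [evalSeries, LinearMap.sum_apply, Finset.sum_apply, LinearMap.smul_apply,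
    Pi.smul_apply]
  refine Finset.sum_eq_single k ?_ ?_
  · intro l _ hl
    rw [h.contr_pow C l S (by omega), smul_zero]
  · intro hn
    have := S.card_le_univ
    rw [Fintype.card_fin] at this
    simp only [Finset.mem_range] at hn
    omega

theorem evalSeries_apply_of_lt (h : CardSupp j φ) (f : PowerSeries ℝ) {S : Finset (Fin m)}
    (hS : S.card < j) : evalSeries (m + 1) (C.contr d X) f φ S = 0 := by
  simp only [evalSeries, LinearMap.sum_apply, Finset.sum_apply, LinearMap.smul_apply,
    Pi.smul_apply]
  refine Finset.sum_eq_zero fun l _ => ?_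
  rw [h.contr_pow C l S (by omega), smul_zero]

end CardSupp

variable (d e)

/-- The form part of the `L_∞`-structure given by the nested brackets, on the generic element. -/
def vinForm (ϖ : Ω) : Finset (Fin m) → Ω :=
  bernConn (m + 1) (C.contr d fun i => (e i).1) C.diff (C.lieOp d fun i => (e i).1)
      (C.curvOp d fun i => (e i).1) (generic d fun i => (e i).2)
    - evalSeries (m + 1) (C.contr d fun i => (e i).1) bernSeries
      (C.diff (degProj d (-1) (generic d fun i => (e i).2)))
    + evalSeries (m + 1) (C.contr d fun i => (e i).1) (PowerSeries.X * (1 - bernSeries))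
      (constCoeff ϖ)

/-- The `L_∞`-structure given by the contractions of `ϖ`, on the generic element. -/
def obsForm (ϖ : Ω) : Finset (Fin m) → Ω :=
  evalSeries (m + 1) (C.contr d fun i => (e i).1) obsSeries (constCoeff ϖ)
    + C.diff (generic d fun i => (e i).2)
    - C.diff (degProj d (-1) (generic d fun i => (e i).2))

/-- The form part of the morphism, on the generic element. -/
def morForm : Finset (Fin m) → Ω :=
  evalSeries (m + 1) (C.contr d fun i => (e i).1) (bernSeries + PowerSeries.X)
    (generic d fun i => (e i).2)

variable {d e}

theorem seqSum_diff : (seqSum d 1 fun g => if d (g 0) = 0 then 0 else C.d (e (g 0)).2)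
    = C.diff (generic d fun i => (e i).2)
      - C.diff (degProj d (-1) (generic d fun i => (e i).2)) := by
  rw [seqSum_one, degProj_generic, generic, diff, map_sum, map_sum, ← Finset.sum_sub_distrib]
  refine Finset.sum_congr rfl fun i _ => ?_
  have hi : d i - 1 = -1 ↔ d i = 0 := ⟨fun h => by omega, fun h => by omega⟩
  rw [← theta_ptwise, ← theta_ptwise, ptwise_constCoeff, ptwise_constCoeff, ← map_sub, ← map_sub]
  simp only [hi]
  split_ifs <;> simp

/-- The form part of the structure given by the nested brackets, summed up over all numbers of
arguments by means of the generating function of the Bernoulli numbers. -/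
theorem onSubtuples_vinBase_snd (h : C.IsHomTuple d e) (ϖ : Ω) {S : Finset (Fin m)}
    (hS : S.Nonempty) :
    (onSubtuples d (symmetrize (C.vinBase ϖ)) e S).2 = C.vinForm d e ϖ S := by
  rw [onSubtuples_symmetrize]
  have hφ := cardSupp_generic d fun i => (e i).2
  have hθ := (hφ.degProj (d := d) (-1)).diff C
  have hL := hφ.lieOp C (d := d) (X := fun i => (e i).1)
  have hQ := hφ.curvOp C (d := d) (X := fun i => (e i).1)
  have hϖ := cardSupp_constCoeff (m := m) ϖ
  have hd := hφ.diff C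
  rw [vinForm, bernConn]
  simp only [LinearMap.add_apply, Module.End.mul_apply, Pi.add_apply, Pi.sub_apply]
  obtain ⟨k, hk⟩ : ∃ k, S.card = k + 1 := ⟨S.card - 1, by have := hS.card_pos; omega⟩
  rw [hk]
  cases k with
  | zero =>
    rw [C.evalSeries_apply_of_lt hL _ (by omega), C.evalSeries_apply_of_lt hQ _ (by omega),
      C.evalSeries_apply hθ _ (k := 0) (by omega), C.evalSeries_apply hϖ _ (k := 1) (by omega)]
    have h1 := congrFun (C.seqSum_diff (d := d) (e := e)) S
    have h2 : ∀ φ : Finset (Fin m) → 𝔤 × Ω, (φ S).2 = ptwise (LinearMap.snd ℝ 𝔤 Ω) φ S :=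
      fun _ => rfl
    rw [h2, ← seqSum_map]
    have h3 : ∀ g : Fin 1 → Fin m, LinearMap.snd ℝ 𝔤 Ω (C.vinBase ϖ 1 (d ∘ g) (e ∘ g))
        = if d (g 0) = 0 then 0 else C.d (e (g 0)).2 := by
      intro g
      simp only [vinBase, Function.comp]
      split_ifs <;> simp
    simp only [h3]
    rw [h1]
    simp [constantCoeff_bernSeries, PowerSeries.coeff_succ_X_mul]
  | succ k =>
    rw [hd S (by omega), C.evalSeries_apply hL _ (k := k) (by omega),
      C.evalSeries_apply hθ _ (k := k + 1) (by omega),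
      C.evalSeries_apply hϖ _ (k := k + 2) (by omega), coeff_X_mul_one_sub]
    have h2 : ∀ φ : Finset (Fin m) → 𝔤 × Ω, (φ S).2 = ptwise (LinearMap.snd ℝ 𝔤 Ω) φ S :=
      fun _ => rfl
    have h3 : (seqSum d (k + 1 + 1) fun g => C.vinBase ϖ (k + 1 + 1) (d ∘ g) (e ∘ g))
        = -coeff (k + 1) bernSeries • C.nestedSum d e ϖ k := by
      rw [nestedSum, ← seqSum_smul]
      rfl
    rw [h2, h3, map_smul, nestedSum_snd C h, nestedSum_zero_snd C h]
    have hl : coeff k lieSeries = -coeff (k + 1) bernSeries := coeff_lieSeries k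
    have hc : evalSeries (m + 1) (C.contr d fun i => (e i).1) curvSeries
        (C.curvOp d (fun i => (e i).1) (generic d fun i => (e i).2)) S
        = -coeff (k + 1) bernSeries • (if k = 0 then 0 else
          (C.contr d (fun i => (e i).1) ^ (k - 1))
          (C.curvOp d (fun i => (e i).1) (generic d fun i => (e i).2))) S := by
      cases k with
      | zero => rw [C.evalSeries_apply_of_lt hQ _ (by omega)]; simp
      | succ k =>
        rw [C.evalSeries_apply hQ _ (k := k) (by omega), coeff_curvSeries]
        simp
    rw [hl, hc]
    have hR : ∀ y, (C.contr d (fun i => (e i).1) ^ k) (C.contr d (fun i => (e i).1) y)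
        = (C.contr d (fun i => (e i).1) ^ (k + 1)) y := fun y => by
      rw [pow_succ, Module.End.mul_apply]
    have hR2 : ∀ y, (C.contr d (fun i => (e i).1) ^ k) ((C.contr d (fun i => (e i).1) ^ 2) y)
        = (C.contr d (fun i => (e i).1) ^ (k + 2)) y := fun y => by
      rw [pow_add, Module.End.mul_apply]
    simp only [map_add, hR, hR2, Pi.add_apply, Pi.smul_apply, smul_add]
    module

/-- Only the product of two arguments has a vector part, where the first Bernoulli number `- 1 / 2`
cancels the factor from the symmetrization. -/
theorem onSubtuples_vinBase_fst (h : C.IsHomTuple d e) (ϖ : Ω) {S : Finset (Fin m)}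
    (hS : S.Nonempty) :
    (onSubtuples d (symmetrize (C.vinBase ϖ)) e S).1 = C.vecCurv d (fun i => (e i).1) S := by
  have hV : CardSupp 2 (C.vecCurv d fun i => (e i).1) := by
    intro S hS
    have h1 := seqSum_two d fun g => C.br (e (g 0)).1 (e (g 1)).1
    simp only [Matrix.cons_val_zero, Matrix.cons_val_one] at h1
    rw [vecCurv, Pi.smul_apply, ← h1, seqSum, Finset.sum_apply]
    simp only [thetaProd_constCoeff]
    rw [Finset.sum_eq_zero, smul_zero]
    rintro g -
    refine if_neg ?_
    rintro ⟨h1, rfl⟩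
    rw [Finset.card_image_of_injective _ h1] at hS
    simp at hS
  rw [onSubtuples_symmetrize]
  have h2 : ∀ φ : Finset (Fin m) → 𝔤 × Ω, (φ S).1 = ptwise (LinearMap.fst ℝ 𝔤 Ω) φ S :=
    fun _ => rfl
  obtain ⟨k, hk⟩ : ∃ k, S.card = k + 1 := ⟨S.card - 1, by have := hS.card_pos; omega⟩
  rw [hk]
  cases k with
  | zero =>
    rw [hV S (by omega), h2, ← seqSum_map]
    have h3 : ∀ g : Fin 1 → Fin m, LinearMap.fst ℝ 𝔤 Ω (C.vinBase ϖ 1 (d ∘ g) (e ∘ g)) = 0 := by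
      intro g
      simp only [vinBase, Function.comp]
      split_ifs <;> simp
    simp only [h3, seqSum_const_zero]
    rfl
  | succ k =>
    have h3 : (seqSum d (k + 1 + 1) fun g => C.vinBase ϖ (k + 1 + 1) (d ∘ g) (e ∘ g))
        = -coeff (k + 1) bernSeries • C.nestedSum d e ϖ k := by
      rw [nestedSum, ← seqSum_smul]
      rfl
    rw [h2, h3, map_smul]
    cases k with
    | zero =>
      rw [nestedSum_zero_fst C h, smul_smul]
      norm_num [coeff_bernSeries]
    | succ k =>
      rw [nestedSum_succ_fst, hV S (by omega), smul_zero]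
      rfl

/-- The structure of the local observables on the generic element. -/
theorem onSubtuples_obsBase (ϖ : Ω) {S : Finset (Fin m)} (hS : S.Nonempty) :
    onSubtuples d (symmetrize (C.obsBase ϖ)) e S = C.obsForm d e ϖ S := by
  rw [onSubtuples_symmetrize]
  have hφ := cardSupp_generic d fun i => (e i).2
  have hθ := (hφ.degProj (d := d) (-1)).diff C
  have hϖ := cardSupp_constCoeff (m := m) ϖ
  have hd := hφ.diff C
  rw [obsForm]
  simp only [Pi.add_apply, Pi.sub_apply]
  obtain ⟨k, hk⟩ : ∃ k, S.card = k + 1 := ⟨S.card - 1, by have := hS.card_pos; omega⟩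
  rw [hk, C.evalSeries_apply hϖ _ (k := k + 1) (by omega)]
  cases k with
  | zero =>
    have h1 := congrFun (C.seqSum_diff (d := d) (e := e)) S
    refine h1.trans ?_
    simp [coeff_one_obsSeries]
  | succ k =>
    rw [hd S (by omega), hθ S (by omega), ← seqSum_iterContr]
    change seqSum d (k + 2) (fun g => coeff (k + 2) obsSeries • C.iterContr (k + 2) _ ϖ) S = _
    rw [seqSum_smul, add_zero, sub_zero]
    rfl

/-- The form part of the morphism on the generic element. -/
theorem onSubtuples_morBase_snd {S : Finset (Fin m)} (hS : S.Nonempty) :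
    (onSubtuples d (symmetrize C.morBase) e S).2 = C.morForm d e S := by
  rw [onSubtuples_symmetrize]
  have hφ := cardSupp_generic d fun i => (e i).2
  rw [morForm]
  obtain ⟨k, hk⟩ : ∃ k, S.card = k + 1 := ⟨S.card - 1, by have := hS.card_pos; omega⟩
  rw [hk, C.evalSeries_apply hφ _ (k := k) (by omega), ← seqSum_iterContr_generic]
  have h2 : ∀ φ : Finset (Fin m) → 𝔤 × Ω, (φ S).2 = ptwise (LinearMap.snd ℝ 𝔤 Ω) φ S :=
    fun _ => rfl
  rw [h2, ← seqSum_map, ← Pi.smul_apply, ← seqSum_smul]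
  congr 1
  cases k with
  | zero => simp [morBase, constantCoeff_bernSeries, iterContr]
  | succ k => rfl

theorem onSubtuples_morBase_fst {S : Finset (Fin m)} (hS : S.card ≠ 1) :
    (onSubtuples d (symmetrize C.morBase) e S).1 = 0 := by
  rw [onSubtuples_symmetrize]
  have h2 : ∀ φ : Finset (Fin m) → 𝔤 × Ω, (φ S).1 = ptwise (LinearMap.fst ℝ 𝔤 Ω) φ S :=
    fun _ => rfl
  rw [h2, ← seqSum_map]
  obtain ⟨k, hk⟩ : ∃ k, k = S.card := ⟨_, rfl⟩
  rw [← hk] at hS ⊢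
  match k with
  | 0 => simp [morBase, seqSum_const_zero]
  | 1 => exact absurd rfl hS
  | k + 2 => simp [morBase, seqSum_const_zero]

end CartanCalculus
/-! ### Degrees -/

namespace CartanCalculus

open PowerSeries (coeff)

variable {𝔤 Ω : Type*} [AddCommGroup 𝔤] [Module ℝ 𝔤] [AddCommGroup Ω] [Module ℝ Ω]
  (C : CartanCalculus 𝔤 Ω) {m : ℕ} {d : Fin m → ℤ} {e : Fin m → 𝔤 × Ω} {X : Fin m → 𝔤}

section Degrees

variable (d)

/-- The elements of total degree `c`: the coefficient of `θ_S` lies in `gr (degSum d S + c)`. -/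
def homSub (c : ℤ) : Submodule ℝ (Finset (Fin m) → Ω) :=
  Submodule.pi Set.univ fun S => C.gr (degSum d S + c)

theorem mem_homSub {c : ℤ} {φ : Finset (Fin m) → Ω} :
    φ ∈ C.homSub d c ↔ ∀ S, φ S ∈ C.gr (degSum d S + c) := by
  simp [homSub, Submodule.mem_pi]

/-- The elements whose coefficient of `θ_S` vanishes if `degSum d S` is larger than `p`. -/
def degLE (W : Type*) [AddCommGroup W] [Module ℝ W] (p : ℤ) :
    Submodule ℝ (Finset (Fin m) → W) where
  carrier := {φ | ∀ S, p < degSum d S → φ S = 0}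
  zero_mem' _ _ := rfl
  add_mem' hφ hψ S hS := by simp [hφ S hS, hψ S hS]
  smul_mem' c φ hφ S hS := by simp [hφ S hS]

variable {d}

variable {φ : Finset (Fin m) → Ω} {c c' p q : ℤ}

theorem ρ_mem (Y : 𝔤) {p : ℤ} {w : Ω} (h : w ∈ C.gr p) : C.ρ Y w ∈ C.gr (p - 1) := by
  have h1 : C.ρ Y w = C.γ (C.ι Y w) := rfl
  rw [h1, C.γ_gr (C.ι_mem Y h)]
  exact (C.gr (p - 1)).smul_of_tower_mem _ (C.ι_mem Y h)

theorem contr_mem_homSub (hX : ∀ i, d i ≠ 0 → X i = 0) (h : φ ∈ C.homSub d c) :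
    C.contr d X φ ∈ C.homSub d c := by
  rw [mem_homSub] at h ⊢
  intro S
  rw [contr_apply]
  refine sum_mem fun i hi => (C.gr _).smul_of_tower_mem _ ?_
  by_cases hd : d i = 0
  · have h1 := C.ρ_mem (X i) (h (S.erase i))
    rw [degSum_erase d hi, hd] at h1
    convert h1 using 2
    ring
  · rw [hX i hd, map_zero]
    exact zero_mem _

theorem contr_mem_degLE (hX : ∀ i, d i ≠ 0 → X i = 0) (h : φ ∈ degLE d Ω p) (hq : p ≤ q + 1) :
    C.contr d X φ ∈ degLE d Ω q := by
  intro S hS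
  rw [contr_apply]
  refine Finset.sum_eq_zero fun i hi => ?_
  by_cases hd : d i = 0
  · rw [h (S.erase i) (by rw [degSum_erase d hi, hd]; linarith), map_zero, smul_zero]
  · simp [hX i hd]

theorem diff_mem_homSub (h : φ ∈ C.homSub d c) (hc : c + 1 = c') :
    C.diff φ ∈ C.homSub d c' := by
  subst hc
  rw [mem_homSub] at h ⊢
  intro S
  rw [← add_assoc]
  exact C.d_mem (h S)

theorem diff_mem_degLE (h : φ ∈ degLE d Ω p) : C.diff φ ∈ degLE d Ω p := fun S hS => by
  change C.d (φ S) = 0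
  rw [h S hS, map_zero]

theorem lieOp_mem_homSub (hX : ∀ i, d i ≠ 0 → X i = 0) (h : φ ∈ C.homSub d c)
    (hc : c + 1 = c') : C.lieOp d X φ ∈ C.homSub d c' :=
  sub_mem (C.contr_mem_homSub hX (C.diff_mem_homSub h hc))
    (C.diff_mem_homSub (C.contr_mem_homSub hX h) hc)

theorem lieOp_mem_degLE (hX : ∀ i, d i ≠ 0 → X i = 0) (h : φ ∈ degLE d Ω p) (hq : p ≤ q + 1) :
    C.lieOp d X φ ∈ degLE d Ω q :=
  sub_mem (C.contr_mem_degLE hX (C.diff_mem_degLE h) hq)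
    (C.diff_mem_degLE (C.contr_mem_degLE hX h hq))

theorem curvOp_mem_homSub (hX : ∀ i, d i ≠ 0 → X i = 0) (h : φ ∈ C.homSub d c)
    (hc : c + 1 = c') : C.curvOp d X φ ∈ C.homSub d c' :=
  sub_mem (C.contr_mem_homSub hX (C.lieOp_mem_homSub hX h hc))
    (C.lieOp_mem_homSub hX (C.contr_mem_homSub hX h) hc)

theorem curvOp_mem_degLE (hX : ∀ i, d i ≠ 0 → X i = 0) (h : φ ∈ degLE d Ω p) (hq : p ≤ q + 2) :
    C.curvOp d X φ ∈ degLE d Ω q :=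
  have h1 : p ≤ (q + 1) + 1 := by omega
  sub_mem (C.contr_mem_degLE hX (C.lieOp_mem_degLE hX h h1) le_rfl)
    (C.lieOp_mem_degLE hX (C.contr_mem_degLE hX h h1) le_rfl)

theorem degProj_mem_homSub (h : φ ∈ C.homSub d c) : degProj d p φ ∈ C.homSub d c := by
  rw [mem_homSub] at h ⊢
  intro S
  rw [degProj_apply]
  split_ifs
  · exact h S
  · exact zero_mem _

theorem evalSeries_mem_homSub (hX : ∀ i, d i ≠ 0 → X i = 0) (N : ℕ) (f : PowerSeries ℝ)
    (h : φ ∈ C.homSub d c) : evalSeries N (C.contr d X) f φ ∈ C.homSub d c := by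
  rw [evalSeries, LinearMap.sum_apply]
  refine sum_mem fun k _ => Submodule.smul_mem _ _ ?_
  clear * - h hX
  induction k with
  | zero => exact h
  | succ k ih => rw [pow_succ']; exact C.contr_mem_homSub hX ih

theorem evalSeries_mem_degLE (hX : ∀ i, d i ≠ 0 → X i = 0) (N : ℕ) (f : PowerSeries ℝ)
    (h : φ ∈ degLE d Ω p) : evalSeries N (C.contr d X) f φ ∈ degLE d Ω p := by
  rw [evalSeries, LinearMap.sum_apply]
  refine sum_mem fun k _ => Submodule.smul_mem _ _ ?_
  clear * - h hX
  induction k with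
  | zero => exact h
  | succ k ih =>
    rw [pow_succ']
    exact C.contr_mem_degLE hX ih (by omega)

theorem IsHomTuple.generic_mem_homSub (h : C.IsHomTuple d e) :
    generic d (fun i => (e i).2) ∈ C.homSub d 0 := by
  rw [mem_homSub]
  intro S
  rw [generic_apply]
  refine sum_mem fun i _ => ?_
  split_ifs with hS
  · subst hS
    simpa [degSum] using h.form i
  · exact zero_mem _

theorem IsHomTuple.generic_mem_degLE (h : C.IsHomTuple d e) :
    generic d (fun i => (e i).2) ∈ degLE d Ω (-1) := by
  intro S hS
  rw [generic_apply]
  refine Finset.sum_eq_zero fun i _ => ?_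
  split_ifs with hi
  · subst hi
    exact h.nonpos i (by simp [degSum] at hS; omega)
  · rfl

theorem constCoeff_mem_homSub {ϖ : Ω} (hϖ : ϖ ∈ C.gr c) :
    constCoeff ϖ ∈ C.homSub d c := by
  rw [mem_homSub]
  intro S
  by_cases h : S = ∅
  · subst h
    simpa [degSum, constCoeff_empty] using hϖ
  · rw [constCoeff_apply_of_ne _ h]
    exact zero_mem _

theorem constCoeff_mem_degLE (ϖ : Ω) : constCoeff ϖ ∈ degLE d Ω 0 := by
  intro S hS
  rw [constCoeff_apply_of_ne]
  rintro rfl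
  simp [degSum] at hS

/-- Without its part of degree `-1`, the generic element has only parts of degree at most `-2`. -/
theorem IsHomTuple.sub_degProj_mem (h : C.IsHomTuple d e) :
    generic d (fun i => (e i).2) - degProj d (-1) (generic d fun i => (e i).2)
      ∈ degLE d Ω (-2) := by
  intro S hS
  rw [Pi.sub_apply, degProj_apply]
  split_ifs with h1
  · rw [sub_self]
  · rw [sub_zero]
    exact h.generic_mem_degLE C S (by omega)

/-- The form part of the structure, arranged such that every term has parameters of degree at most
`-2`. Since `F = 1 - t a`, the terms `d φ` and `- F(R) d π φ` of `vinForm` combine to `d (φ - π φ)`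
and `a(R) R d π φ`. -/
theorem vinForm_eq (ϖ : Ω) : C.vinForm d e ϖ
    = C.diff (generic d (fun i => (e i).2) - degProj d (-1) (generic d fun i => (e i).2))
      + evalSeries (m + 1) (C.contr d fun i => (e i).1) lieSeries
        (C.lieOp d (fun i => (e i).1) (generic d fun i => (e i).2))
      + evalSeries (m + 1) (C.contr d fun i => (e i).1) curvSeries
        (C.curvOp d (fun i => (e i).1) (generic d fun i => (e i).2))
      + evalSeries (m + 1) (C.contr d fun i => (e i).1) lieSeries (C.contr d (fun i => (e i).1)
        (C.diff (degProj d (-1) (generic d fun i => (e i).2))))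
      + evalSeries (m + 1) (C.contr d fun i => (e i).1) lieSeries
        (C.contr d (fun i => (e i).1) (C.contr d (fun i => (e i).1) (constCoeff ϖ))) := by
  have hR := C.contr_pow_eq_zero (d := d) (X := fun i => (e i).1) (Nat.lt_succ_self m)
  have hX : ∀ f, evalSeries (m + 1) (C.contr d fun i => (e i).1) (f * PowerSeries.X)
      = evalSeries (m + 1) (C.contr d fun i => (e i).1) f * C.contr d fun i => (e i).1 := by
    intro f
    rw [evalSeries_mul hR, evalSeries_X hR]
  have h1 : bernSeries = 1 - lieSeries * PowerSeries.X := by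
    rw [mul_comm, X_mul_lieSeries]; ring
  have h2 : PowerSeries.X * (1 - bernSeries) = lieSeries * PowerSeries.X * PowerSeries.X := by
    rw [← X_mul_lieSeries]; ring
  have h3 : evalSeries (m + 1) (C.contr d fun i => (e i).1) bernSeries
      = 1 - evalSeries (m + 1) (C.contr d fun i => (e i).1) lieSeries
        * C.contr d fun i => (e i).1 := by
    rw [← hX, h1]
    exact (map_sub (evalSeriesHom hR) _ _).trans (by rw [map_one]; rfl)
  rw [vinForm, bernConn, h2, hX, hX, h3]
  simp only [LinearMap.add_apply, LinearMap.sub_apply, Module.End.mul_apply,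
    Module.End.one_apply, map_sub]
  abel

theorem IsHomTuple.vinForm_mem_homSub (h : C.IsHomTuple d e) {ϖ : Ω} (hϖ : ϖ ∈ C.gr 1) :
    C.vinForm d e ϖ ∈ C.homSub d 1 := by
  have hφ := h.generic_mem_homSub C
  rw [vinForm_eq]
  refine add_mem (add_mem (add_mem (add_mem ?_ ?_) ?_) ?_) ?_
  · exact C.diff_mem_homSub (sub_mem hφ (C.degProj_mem_homSub hφ)) (zero_add 1)
  · exact C.evalSeries_mem_homSub h.vec _ _ (C.lieOp_mem_homSub h.vec hφ (zero_add 1))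
  · exact C.evalSeries_mem_homSub h.vec _ _ (C.curvOp_mem_homSub h.vec hφ (zero_add 1))
  · exact C.evalSeries_mem_homSub h.vec _ _
      (C.contr_mem_homSub h.vec (C.diff_mem_homSub (C.degProj_mem_homSub hφ) (zero_add 1)))
  · exact C.evalSeries_mem_homSub h.vec _ _
      (C.contr_mem_homSub h.vec (C.contr_mem_homSub h.vec (C.constCoeff_mem_homSub hϖ)))

/-- The structure has no values in positive degrees. -/
theorem IsHomTuple.vinForm_mem_degLE (h : C.IsHomTuple d e) (ϖ : Ω) :
    C.vinForm d e ϖ ∈ degLE d Ω (-2) := by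
  have hφ := h.generic_mem_degLE C
  rw [vinForm_eq]
  refine add_mem (add_mem (add_mem (add_mem ?_ ?_) ?_) ?_) ?_
  · exact C.diff_mem_degLE (h.sub_degProj_mem C)
  · exact C.evalSeries_mem_degLE h.vec _ _ (C.lieOp_mem_degLE h.vec hφ (by norm_num))
  · exact C.evalSeries_mem_degLE h.vec _ _ (C.curvOp_mem_degLE h.vec hφ (by norm_num))
  · refine C.evalSeries_mem_degLE h.vec _ _
      (C.contr_mem_degLE (p := -1) h.vec (C.diff_mem_degLE ?_) (by norm_num))
    intro S hS
    rw [degProj_apply, if_neg (by omega)]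
  · exact C.evalSeries_mem_degLE h.vec _ _
      (C.contr_mem_degLE (p := -1) h.vec
      (C.contr_mem_degLE h.vec (constCoeff_mem_degLE ϖ) (by norm_num)) (by norm_num))

/-- The structure of the local observables, arranged such that every term has parameters of degree
at most `-2`. -/
theorem obsForm_eq (ϖ : Ω) : C.obsForm d e ϖ
    = evalSeries (m + 1) (C.contr d fun i => (e i).1) (PowerSeries.mk fun k => coeff (k + 2)
        obsSeries) (C.contr d (fun i => (e i).1) (C.contr d (fun i => (e i).1) (constCoeff ϖ)))
      + C.diff (generic d (fun i => (e i).2) - degProj d (-1) (generic d fun i => (e i).2)) := by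
  have hR := C.contr_pow_eq_zero (d := d) (X := fun i => (e i).1) (Nat.lt_succ_self m)
  have h0 : obsSeries = (PowerSeries.mk fun k => coeff (k + 2) obsSeries) * PowerSeries.X ^ 2 := by
    ext k
    match k with
    | 0 =>
      rw [PowerSeries.coeff_mul_X_pow', if_neg (by norm_num), obsSeries, map_sub, map_sub,
        PowerSeries.evalNegHom, PowerSeries.coeff_rescale]
      simp
    | 1 => rw [coeff_one_obsSeries, PowerSeries.coeff_mul_X_pow']; simp
    | k + 2 => rw [PowerSeries.coeff_mul_X_pow]; simp
  rw [obsForm]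
  nth_rewrite 1 [h0]
  rw [evalSeries_mul hR, sq, evalSeries_mul hR, evalSeries_X hR, map_sub]
  simp only [Module.End.mul_apply]
  abel

theorem IsHomTuple.obsForm_mem_homSub (h : C.IsHomTuple d e) {ϖ : Ω} (hϖ : ϖ ∈ C.gr 1) :
    C.obsForm d e ϖ ∈ C.homSub d 1 := by
  have hφ := h.generic_mem_homSub C
  rw [obsForm_eq]
  refine add_mem ?_ ?_
  · exact C.evalSeries_mem_homSub h.vec _ _
      (C.contr_mem_homSub h.vec (C.contr_mem_homSub h.vec (C.constCoeff_mem_homSub hϖ)))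
  · exact C.diff_mem_homSub (sub_mem hφ (C.degProj_mem_homSub hφ)) (zero_add 1)

theorem IsHomTuple.obsForm_mem_degLE (h : C.IsHomTuple d e) (ϖ : Ω) :
    C.obsForm d e ϖ ∈ degLE d Ω (-2) := by
  rw [obsForm_eq]
  refine add_mem ?_ (C.diff_mem_degLE (h.sub_degProj_mem C))
  exact C.evalSeries_mem_degLE h.vec _ _
    (C.contr_mem_degLE (p := -1) h.vec
      (C.contr_mem_degLE h.vec (constCoeff_mem_degLE ϖ) (by norm_num)) (by norm_num))

theorem IsHomTuple.morForm_mem_homSub (h : C.IsHomTuple d e) :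
    C.morForm d e ∈ C.homSub d 0 :=
  C.evalSeries_mem_homSub h.vec _ _ (h.generic_mem_homSub C)

theorem IsHomTuple.morForm_mem_degLE (h : C.IsHomTuple d e) :
    C.morForm d e ∈ degLE d Ω (-1) :=
  C.evalSeries_mem_degLE h.vec _ _ (h.generic_mem_degLE C)

theorem vecCurv_apply_eq_zero (hX : ∀ i, d i ≠ 0 → X i = 0) {S : Finset (Fin m)}
    (h : degSum d S ≠ -2) : C.vecCurv d X S = 0 := by
  rw [vecCurv, Pi.smul_apply, Finset.sum_apply, Finset.sum_eq_zero, smul_zero]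
  intro j _
  rw [Finset.sum_apply]
  refine Finset.sum_eq_zero fun i _ => ?_
  by_cases hi : d i = 0
  · by_cases hj : d j = 0
    · rw [theta_apply]
      split_ifs with h1
      · rw [theta_apply]
        split_ifs with h2
        · rw [constCoeff_apply_of_ne, smul_zero, smul_zero]
          intro h3
          have h4 := degSum_erase d h2
          rw [h3, degSum_erase d h1, hi, hj] at h4
          simp [degSum] at h4 h
          omega
        · rw [smul_zero]
      · rfl
    · simp [hX j hj]
  · simp [hX i hi]

theorem vecCurv_empty : C.vecCurv d X ∅ = 0 := by
  simp [vecCurv, theta_apply]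

theorem IsHomTuple.cons (h : C.IsHomTuple d e) (c : ℤ) (S : Finset (Fin m)) {u : 𝔤 × Ω}
    (h1 : degSum d S + c + 1 ≠ 0 → u.1 = 0) (h2 : u.2 ∈ C.gr (degSum d S + c))
    (h3 : 0 ≤ degSum d S + c → u.2 = 0) : C.IsHomTuple (consDeg d c S) (Fin.cons u e) where
  vec i := by
    refine Fin.cases ?_ (fun i => ?_) i
    · exact h1
    · exact h.vec i
  form i := by
    refine Fin.cases ?_ (fun i => ?_) i
    · simpa [consDeg] using h2
    · exact h.form i
  nonpos i := by
    refine Fin.cases ?_ (fun i => ?_) i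
    · intro h0
      exact h3 (by simp [consDeg] at h0; omega)
    · exact h.nonpos i

end Degrees

end CartanCalculus
/-! ### The vector part: bracket of the generic vector field with itself -/

section Ring

variable {A : Type*} [Ring A] [Algebra ℝ A] {P R D L Q : A}

theorem halfCurv_comm_contr (hPR : P * R = R * P) (hQR : Q * R = R * Q) :
    (-(1 / 2 : ℝ)) • (Q * P) * R = R * ((-(1 / 2 : ℝ)) • (Q * P)) := by
  rw [smul_mul_assoc, mul_smul_comm, mul_assoc, hPR, ← mul_assoc, hQR, mul_assoc]

theorem halfCurv_comm_lie (hPL : P * L = -(L * P)) (hLQ : L * Q = -(Q * L)) :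
    (-(1 / 2 : ℝ)) • (Q * P) * L = L * ((-(1 / 2 : ℝ)) • (Q * P)) := by
  rw [smul_mul_assoc, mul_smul_comm, mul_assoc, hPL, ← mul_assoc, hLQ, mul_neg, neg_mul, mul_assoc]

theorem halfCurv_commutator (hPD : P * D = -(D * P)) :
    (-(1 / 2 : ℝ)) • (Q * P) * D - D * ((-(1 / 2 : ℝ)) • (Q * P))
      = (1 / 2 : ℝ) • ((Q * D + D * Q) * P) := by
  rw [smul_mul_assoc, mul_smul_comm, mul_assoc, hPD, add_mul, mul_neg, mul_assoc, mul_assoc]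
  module

theorem halfAnticomm_comm_contr (hPR : P * R = R * P) (hD : D * R = R * D - L)
    (hQR : Q * R = R * Q) (hLQ : L * Q = -(Q * L)) :
    (1 / 2 : ℝ) • ((Q * D + D * Q) * P) * R = R * ((1 / 2 : ℝ) • ((Q * D + D * Q) * P)) := by
  have h : (Q * D + D * Q) * R = R * (Q * D + D * Q) := by
    rw [add_mul, mul_assoc, hD, mul_assoc, hQR, ← mul_assoc D, hD, mul_sub, ← mul_assoc, hQR,
      sub_mul, hLQ]
    noncomm_ring
  rw [smul_mul_assoc, mul_smul_comm, mul_assoc, hPR, ← mul_assoc, h, mul_assoc]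

theorem halfCurv_mul_curv (hPQ : P * Q = -(Q * P)) (hQQ : Q * Q = 0) :
    (-(1 / 2 : ℝ)) • (Q * P) * Q = 0 := by
  rw [smul_mul_assoc, mul_assoc, hPQ, mul_neg, ← mul_assoc, hQQ]
  simp

end Ring

namespace CartanCalculus

open PowerSeries (coeff derivative)

variable {𝔤 Ω : Type*} [AddCommGroup 𝔤] [Module ℝ 𝔤] [AddCommGroup Ω] [Module ℝ Ω]
  (C : CartanCalculus 𝔤 Ω) {m : ℕ} {d : Fin m → ℤ} {e : Fin m → 𝔤 × Ω} {X : Fin m → 𝔤}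

variable (d X) in
/-- The contraction with the vector fields `vecCurv`, see `rightMul_vecCurv`. -/
def halfCurv : Module.End ℝ (Finset (Fin m) → Ω) :=
  (-(1 / 2 : ℝ)) • (C.curvOp d X * C.parity d)

/-- The contraction with half the bracket of the generic vector field with itself is `- Q / 2`, up
to the parity. -/
theorem rightMul_vecCurv (hX : ∀ i, d i ≠ 0 → X i = 0) (φ : Finset (Fin m) → Ω) :
    rightMul d 1 C.ρ (C.vecCurv d X) φ = C.halfCurv d X φ := by
  have h1 : ∀ Y : 𝔤, rightMul d 1 C.ρ (constCoeff Y) φ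
      = -ptwise (C.ι Y) (C.parity d φ) := by
    intro Y
    funext U
    have h : ∀ w, C.ι Y (C.γ w) = -C.ρ Y w := fun w => by
      have := LinearMap.congr_fun (C.γ_ι Y) w
      exact (neg_eq_iff_eq_neg.mpr this).symm
    rw [rightMul_constCoeff, one_mul, Pi.neg_apply, LinearMap.compLeft_apply, Function.comp,
      parity_apply, map_zsmul, h, smul_neg, neg_neg]
  rw [vecCurv, rightMul_smul, rightMul_sum, halfCurv, curvOp_eq C hX,
    LinearMap.smul_apply, neg_smul, ← smul_neg]
  congr 1
  simp only [Module.End.mul_apply, LinearMap.sum_apply]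
  rw [← Finset.sum_neg_distrib]
  refine Finset.sum_congr rfl fun j _ => ?_
  rw [rightMul_sum, ← Finset.sum_neg_distrib]
  refine Finset.sum_congr rfl fun i _ => ?_
  rw [rightMul_theta, rightMul_theta, h1, map_neg, map_neg]

/-- The derivative of the bracket of the generic vector field with itself is a bracket with the
inserted vector field. -/
theorem isInsertion_vecCurv (hX : ∀ i, d i ≠ 0 → X i = 0) {c : ℤ} (v : Finset (Fin m) → 𝔤)
    (hv : ∀ S, degSum d S + c + 1 ≠ 0 → v S = 0) :
    IsInsertion d (fun S => C.vecCurv (consDeg d c S) (Fin.cons (v S) X)) (C.vecCurv d X)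
      ((-(1 / 2 : ℝ)) • (paramOp d C.br X v + rightMul d c C.br v (generic d X))) := by
  have h1 : ∀ {m : ℕ} {d : Fin m → ℤ} {X : Fin m → 𝔤}, (∀ i, d i ≠ 0 → X i = 0) →
      C.vecCurv d X = (-(1 / 2 : ℝ)) • paramOp d C.br X (generic d X) := by
    intro m d X hX
    rw [vecCurv, neg_smul, ← smul_neg, paramOp, LinearMap.sum_apply, ← Finset.sum_neg_distrib]
    congr 1
    rw [Finset.sum_comm]
    refine Finset.sum_congr rfl fun i _ => ?_
    rw [generic, map_sum, ← Finset.sum_neg_distrib]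
    refine Finset.sum_congr rfl fun j _ => ?_
    rw [Module.End.mul_apply, ← theta_ptwise, ptwise_constCoeff]
    by_cases hi : d i = 0
    · by_cases hj : d j = 0
      · rw [thetaEnd, theta_theta_of_eq_zero d hi, hj]
        simp
      · simp [hX j hj]
    · simp [hX i hi]
  have h2 := (isInsertion_paramOp (c := c) C.br (X := X) v
    (isInsertion_generic (d := d) (c := c) v X)).smul (-(1 / 2 : ℝ))
  rw [← h1 hX] at h2
  convert h2 using 1
  funext S
  rw [h1]
  · rfl
  · intro i
    refine Fin.cases ?_ (fun i => ?_) i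
    · exact hv S
    · exact hX i

/-- The Jacobi identity for the generic vector field `∑ i, θ_i X_i`. -/
theorem vecCurv_jacobi (hX : ∀ i, d i ≠ 0 → X i = 0) :
    paramOp d C.br X (C.vecCurv d X) + rightMul d 1 C.br (C.vecCurv d X) (generic d X) = 0 := by
  have e1 : paramOp d C.br X (C.vecCurv d X) = (1 / 2 : ℝ) • ∑ l, ∑ j, ∑ i,
      theta d l (theta d j (theta d i (constCoeff (C.br (X l) (C.br (X i) (X j)))))) := by
    rw [vecCurv, map_smul, paramOp, LinearMap.sum_apply]
    congr 1
    refine Finset.sum_congr rfl fun l _ => ?_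
    simp only [Module.End.mul_apply, map_sum, ← theta_ptwise, ptwise_constCoeff]
  have e2 : rightMul d 1 C.br (C.vecCurv d X) (generic d X) = (1 / 2 : ℝ) • ∑ l, ∑ j, ∑ i,
      theta d l (theta d j (theta d i (constCoeff (C.br (X l) (C.br (X i) (X j)))))) := by
    have h1 : ∀ Y : 𝔤, rightMul d 1 C.br (constCoeff Y) (generic d X)
        = ∑ l, theta d l (constCoeff (C.br (X l) Y)) := by
      intro Y
      funext U
      change _ = generic d (fun l => C.br (X l) Y) U
      rw [rightMul_constCoeff, one_mul, generic_apply, generic_apply, map_sum, Finset.smul_sum]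
      refine Finset.sum_congr rfl fun l _ => ?_
      split_ifs with hU
      · subst hU
        by_cases hl : d l = 0
        · rw [C.br_swap (X l) Y]; simp [degSum, hl]
        · simp [hX l hl]
      · simp
    rw [vecCurv, rightMul_smul, rightMul_sum]
    congr 1
    rw [Finset.sum_comm (γ := Fin m) (f := fun l j => ∑ i,
      theta d l (theta d j (theta d i (constCoeff (C.br (X l) (C.br (X i) (X j)))))))]
    refine Finset.sum_congr rfl fun j _ => ?_
    rw [rightMul_sum, Finset.sum_comm (γ := Fin m)]
    refine Finset.sum_congr rfl fun i _ => ?_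
    rw [rightMul_theta, rightMul_theta, h1, map_sum, map_sum]
    refine Finset.sum_congr rfl fun l _ => ?_
    by_cases hi : d i = 0
    · by_cases hj : d j = 0
      · exact theta_theta_theta d hi hj l _
      · simp [hX j hj]
    · simp [hX i hi]
  rw [e1, e2, ← add_smul]
  norm_num
  obtain ⟨T, hT⟩ : ∃ T : Fin m → Fin m → Fin m → Finset (Fin m) → 𝔤, T = fun l j i =>
    theta d l (theta d j (theta d i (constCoeff (C.br (X l) (C.br (X i) (X j)))))) := ⟨_, rfl⟩
  have hcyc : ∀ l j i, T l j i + T j i l + T i l j = 0 := by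
    intro l j i
    by_cases hl : d l = 0
    · by_cases hj : d j = 0
      · by_cases hi : d i = 0
        · have h1 : T j i l = theta d l (theta d j (theta d i
              (constCoeff (C.br (X j) (C.br (X l) (X i)))))) := by
            rw [hT]; exact theta_theta_theta d hi hj l _
          have h2 : T i l j = theta d l (theta d j (theta d i
              (constCoeff (C.br (X i) (C.br (X j) (X l)))))) := by
            rw [hT]; exact (theta_theta_theta d hj hl i _).symm
          rw [h1, h2, hT]
          simp only [← map_add]
          have h3 : C.br (X l) (C.br (X i) (X j)) + C.br (X j) (C.br (X l) (X i))
              + C.br (X i) (C.br (X j) (X l)) = 0 := by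
            rw [C.jacobi (X l) (X i) (X j), C.br_swap (X j) (C.br (X l) (X i)),
              C.br_swap (X j) (X l), map_neg]
            abel
          rw [h3]
          simp
        · simp [hT, hX i hi]
      · simp [hT, hX j hj]
    · simp [hT, hX l hl]
  have hsum : (3 : ℝ) • ∑ l, ∑ j, ∑ i, T l j i = 0 := by
    have h1 : ∑ l, ∑ j, ∑ i, T l j i = ∑ l, ∑ j, ∑ i, T j i l := by
      symm
      rw [Finset.sum_comm]
      exact Finset.sum_congr rfl fun j _ => Finset.sum_comm
    have h2 : ∑ l, ∑ j, ∑ i, T l j i = ∑ l, ∑ j, ∑ i, T i l j :=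
      ((Finset.sum_congr rfl fun l _ => Finset.sum_comm).trans Finset.sum_comm).symm
    have : (3 : ℝ) • ∑ l, ∑ j, ∑ i, T l j i = ∑ l, ∑ j, ∑ i, (T l j i + T j i l + T i l j) := by
      simp only [Finset.sum_add_distrib]
      rw [← h1, ← h2]
      module
    rw [this]
    simp [hcyc]
  rw [hT] at hsum
  exact (smul_eq_zero.mp hsum).resolve_left (by norm_num)

end CartanCalculus
/-! ### Homotopy Jacobi identities and the morphism equation in closed form -/

namespace CartanCalculus

section Cons

variable {𝔤 Ω : Type*} {m : ℕ}

theorem fst_cons (a : 𝔤 × Ω) (e : Fin m → 𝔤 × Ω) :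
    (fun i => ((Fin.cons a e : Fin (m + 1) → 𝔤 × Ω) i).1) = Fin.cons a.1 fun i => (e i).1 :=
  funext fun i => Fin.cases rfl (fun _ => rfl) i

theorem snd_cons (a : 𝔤 × Ω) (e : Fin m → 𝔤 × Ω) :
    (fun i => ((Fin.cons a e : Fin (m + 1) → 𝔤 × Ω) i).2) = Fin.cons a.2 fun i => (e i).2 :=
  funext fun i => Fin.cases rfl (fun _ => rfl) i

end Cons

open PowerSeries (coeff derivative)

variable {𝔤 Ω : Type*} [AddCommGroup 𝔤] [Module ℝ 𝔤] [AddCommGroup Ω] [Module ℝ Ω]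
  (C : CartanCalculus 𝔤 Ω) {m : ℕ} {d : Fin m → ℤ} {e : Fin m → 𝔤 × Ω} {X : Fin m → 𝔤}
  {c : ℤ} {u : Finset (Fin m) → 𝔤 × Ω} {ν κ : Module.End ℝ (Finset (Fin m) → Ω)}

/-- The derivative of the form part of the structure. The first two terms come from the insertion of
the form part, the others from the change of `L` and of the series in `R` caused by the vector part.
-/
theorem isInsertion_vinForm (hν : ∀ φ, rightMul d c C.ρ (fun S => (u S).1) φ = ν φ)
    (hνd : ν * C.diff - C.diff * ν = κ)
    (hκ : κ * (C.contr d fun i => (e i).1) = (C.contr d fun i => (e i).1) * κ)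
    (hL : ν * (C.lieOp d fun i => (e i).1) = (C.lieOp d fun i => (e i).1) * ν)
    (hR : ν * (C.contr d fun i => (e i).1) = (C.contr d fun i => (e i).1) * ν) (ϖ : Ω) :
    IsInsertion d (fun S => C.vinForm (consDeg d c S) (Fin.cons (u S) e) ϖ) (C.vinForm d e ϖ)
      (bernConn (m + 1) (C.contr d fun i => (e i).1) C.diff (C.lieOp d fun i => (e i).1)
          (C.curvOp d fun i => (e i).1) (fun S => (u S).2)
        - evalSeries (m + 1) (C.contr d fun i => (e i).1) bernSeries
          (C.diff (degProj d (-1 - c) fun S => (u S).2))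
        + evalSeries (m + 1) (C.contr d fun i => (e i).1) lieSeries
          (κ (generic d fun i => (e i).2))
        + evalSeries (m + 1) (C.contr d fun i => (e i).1) (derivative ℝ lieSeries)
          (ν (C.lieOp d (fun i => (e i).1) (generic d fun i => (e i).2)))
        + evalSeries (m + 1) (C.contr d fun i => (e i).1) (derivative ℝ curvSeries)
          (ν (C.curvOp d (fun i => (e i).1) (generic d fun i => (e i).2)))
        - evalSeries (m + 1) (C.contr d fun i => (e i).1) (derivative ℝ bernSeries)
          (ν (C.diff (degProj d (-1) (generic d fun i => (e i).2))))
        + evalSeries (m + 1) (C.contr d fun i => (e i).1)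
          (derivative ℝ (PowerSeries.X * (1 - bernSeries))) (ν (constCoeff ϖ))) := by
  have h0 := isInsertion_generic (d := d) (c := c) (fun S => (u S).2) fun i => (e i).2
  have h1 := C.isInsertion_diff h0
  have h2 := C.isInsertion_evalSeries hν hR lieSeries
    (C.isInsertion_lieOp (X := fun i => (e i).1) hν h0)
  have h3 := C.isInsertion_evalSeries hν hR curvSeries (C.isInsertion_curvOp hν hνd hκ hL h0)
  have h4 := C.isInsertion_evalSeries hν hR bernSeries
    (C.isInsertion_diff (h0.degProj (c := c) (-1)))
  have h5 := C.isInsertion_evalSeries hν hR (PowerSeries.X * (1 - bernSeries))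
    (isInsertion_constCoeff (d := d) ϖ)
  have h := (((h1.add h2).add h3).sub h4).add h5
  convert h using 1
  · funext S
    rw [vinForm, bernConn, fst_cons, snd_cons]
    rfl
  · rfl
  · rw [hνd, bernConn]
    simp only [LinearMap.add_apply, Module.End.mul_apply, map_add, map_zero]
    abel

theorem parity_apply_of_mem {φ : Finset (Fin m) → Ω} (h : φ ∈ C.homSub d c) :
    C.parity d φ = (Int.negOnePow c : ℤ) • φ := by
  rw [mem_homSub] at h
  funext S
  rw [parity_apply, C.γ_gr (h S), smul_smul, Int.negOnePow_add, Units.val_mul, ← mul_assoc,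
    ← Units.val_mul, Int.units_mul_self, Units.val_one, one_mul]
  rfl

theorem degProj_eq_zero {W : Type*} [AddCommGroup W] [Module ℝ W] {p q : ℤ}
    {φ : Finset (Fin m) → W} (h : φ ∈ degLE d W q) (hp : q < p) : degProj d p φ = 0 := by
  funext S
  rw [degProj_apply]
  split_ifs with hS
  · exact h S (by omega)
  · rfl

/-- Only the constant term of a power series in `R` contributes to the part of highest degree,
because `R` lowers the degree. -/
theorem degProj_evalSeries (hX : ∀ i, d i ≠ 0 → X i = 0) (f : PowerSeries ℝ) {p : ℤ}
    {φ : Finset (Fin m) → Ω} (h : φ ∈ degLE d Ω p) :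
    degProj d p (evalSeries (m + 1) (C.contr d X) f φ)
      = PowerSeries.constantCoeff f • degProj d p φ := by
  rw [evalSeries, LinearMap.sum_apply, map_sum, Finset.sum_eq_single 0]
  · simp
  · intro k _ hk
    rw [LinearMap.smul_apply, map_smul, C.degProj_contr_pow d hX,
      degProj_eq_zero h (by omega), map_zero, smul_zero]
  · simp

theorem constantCoeff_lieSeries : PowerSeries.constantCoeff lieSeries = 1 / 2 := by
  rw [← PowerSeries.coeff_zero_eq_constantCoeff_apply, coeff_lieSeries, coeff_bernSeries]
  norm_num

theorem diff_contr_apply (φ : Finset (Fin m) → Ω) :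
    C.diff (C.contr d X φ) = C.contr d X (C.diff φ) - C.lieOp d X φ :=
  LinearMap.congr_fun (C.diff_contr d X) φ

theorem lieOp_contr_apply (φ : Finset (Fin m) → Ω) :
    C.lieOp d X (C.contr d X φ) = C.contr d X (C.lieOp d X φ) - C.curvOp d X φ :=
  LinearMap.congr_fun (C.lieOp_contr d X) φ

theorem diff_diff_apply (φ : Finset (Fin m) → Ω) : C.diff (C.diff φ) = 0 :=
  LinearMap.congr_fun C.diff_diff φ

theorem diff_constCoeff {ϖ : Ω} (h : C.d ϖ = 0) : C.diff (constCoeff (m := m) ϖ) = 0 := by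
  rw [diff, ptwise_constCoeff, h, map_zero]

theorem diff_lieOp_apply (φ : Finset (Fin m) → Ω) :
    C.diff (C.lieOp d X φ) = -C.lieOp d X (C.diff φ) :=
  LinearMap.congr_fun (anticomm_of_sq C.diff_diff (C.diff_contr d X)) φ

theorem diff_contr_contr {ϖ : Ω} (hϖ : C.d ϖ = 0) :
    C.diff (C.contr d X (C.contr d X (constCoeff ϖ)))
      = -(2 : ℝ) • C.contr d X (C.lieOp d X (constCoeff ϖ)) + C.curvOp d X (constCoeff ϖ) := by
  rw [diff_contr_apply, diff_contr_apply, lieOp_contr_apply, C.diff_constCoeff hϖ, map_zero,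
    zero_sub, map_neg]
  module

theorem degProj_contr_contr (hX : ∀ i, d i ≠ 0 → X i = 0) (ϖ : Ω) :
    degProj d (-2) (C.contr d X (C.contr d X (constCoeff ϖ)))
      = C.contr d X (C.contr d X (constCoeff ϖ)) := by
  rw [C.degProj_contr d hX, C.degProj_contr d hX]
  norm_num
  congr 2
  funext S
  rw [degProj_apply]
  split_ifs with hS
  · rfl
  · rw [constCoeff_apply_of_ne]
    rintro rfl
    simp [degSum] at hS

/-- The differential of the part of degree `-2`, which consists of the values of degree zero: this
term enters when the structure is inserted into itself. -/
theorem IsHomTuple.diff_degProj_vinForm (h : C.IsHomTuple d e) {ϖ : Ω} (hϖ : C.d ϖ = 0) :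
    C.diff (degProj d (-2) (C.vinForm d e ϖ))
      = -C.lieOp d (fun i => (e i).1) (C.diff (degProj d (-1) (generic d fun i => (e i).2)))
        - C.contr d (fun i => (e i).1) (C.lieOp d (fun i => (e i).1) (constCoeff ϖ))
        + (1 / 2 : ℝ) • C.curvOp d (fun i => (e i).1) (constCoeff ϖ) := by
  have hφ := h.generic_mem_degLE C
  have hL := C.lieOp_mem_degLE (q := -2) h.vec hφ (by norm_num)
  have hQ := C.curvOp_mem_degLE (q := -2) h.vec hφ (by norm_num)
  have hπ : degProj d (-1) (generic d fun i => (e i).2) ∈ degLE d Ω (-1) := by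
    intro S hS
    rw [degProj_apply, if_neg (by omega)]
  have hθ := C.contr_mem_degLE (q := -2) h.vec (C.diff_mem_degLE hπ) (by norm_num)
  have hϖ2 := C.contr_mem_degLE (q := -2) h.vec (C.contr_mem_degLE (q := -1) h.vec
    (constCoeff_mem_degLE (d := d) ϖ) (by norm_num)) (by norm_num)
  have e1 : degProj d (-2) (C.lieOp d (fun i => (e i).1) (generic d fun i => (e i).2))
      = C.lieOp d (fun i => (e i).1) (degProj d (-1) (generic d fun i => (e i).2)) := by
    rw [C.degProj_lieOp d h.vec]; norm_num
  have e2 : degProj d (-2) (C.curvOp d (fun i => (e i).1) (generic d fun i => (e i).2)) = 0 := by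
    rw [C.degProj_curvOp d h.vec, degProj_eq_zero hφ (by norm_num), map_zero]
  have e3 : ∀ φ : Finset (Fin m) → Ω, degProj d (-1) (degProj d (-1) φ) = degProj d (-1) φ := by
    intro φ
    funext S
    simp only [degProj_apply]
    split_ifs <;> rfl
  have e4 : degProj d (-2) (C.contr d (fun i => (e i).1)
      (C.diff (degProj d (-1) (generic d fun i => (e i).2))))
      = C.contr d (fun i => (e i).1) (C.diff (degProj d (-1) (generic d fun i => (e i).2))) := by
    rw [C.degProj_contr d h.vec, degProj_diff]
    norm_num [e3]
  have e5 := C.degProj_contr_contr h.vec ϖ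
  rw [vinForm_eq]
  simp only [map_add, C.degProj_evalSeries h.vec _ hL, C.degProj_evalSeries h.vec _ hQ,
    C.degProj_evalSeries h.vec _ hθ, C.degProj_evalSeries h.vec _ hϖ2, degProj_diff,
    diff_diff_apply, constantCoeff_lieSeries, map_smul, e1, e2, e4, e5, C.diff_contr_contr hϖ,
    diff_contr_apply, diff_lieOp_apply, map_zero, smul_zero]
  module

/-- The values of the structure are again homogeneous and can be inserted. -/
theorem IsHomTuple.cons_vinForm (h : C.IsHomTuple d e) {ϖ : Ω} (hϖ : ϖ ∈ C.gr 1)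
    (S : Finset (Fin m)) : C.IsHomTuple (consDeg d 1 S)
      (Fin.cons (C.vecCurv d (fun i => (e i).1) S, C.vinForm d e ϖ S) e) := by
  refine h.cons C 1 S (fun h1 => C.vecCurv_apply_eq_zero h.vec (by omega)) ?_ ?_
  · exact (C.mem_homSub d).mp (h.vinForm_mem_homSub C hϖ) S
  · intro h1
    exact h.vinForm_mem_degLE C ϖ S (by omega)

/-- The homotopy Jacobi identities with values in vector fields. -/
theorem isInsertion_vecCurv_self (hX : ∀ i, d i ≠ 0 → X i = 0) :
    IsInsertion d (fun S => C.vecCurv (consDeg d 1 S) (Fin.cons (C.vecCurv d X S) X))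
      (C.vecCurv d X) 0 := by
  refine (C.isInsertion_vecCurv hX (c := 1) (C.vecCurv d X) fun S hS =>
    C.vecCurv_apply_eq_zero hX (by omega)).congr_right ?_
  rw [vecCurv_jacobi C hX, smul_zero]

theorem halfCurv_apply_of_mem {φ : Finset (Fin m) → Ω} (h : φ ∈ C.homSub d c) :
    C.halfCurv d X φ = (-(1 / 2 : ℝ)) • (Int.negOnePow c : ℤ) • C.curvOp d X φ := by
  change (-(1 / 2 : ℝ)) • C.curvOp d X (C.parity d φ) = _
  rw [C.parity_apply_of_mem h, map_zsmul]

/-- The homotopy Jacobi identities with values in forms, for the structure given by the nested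
brackets. -/
theorem isInsertion_vinForm_self (h : C.IsHomTuple d e) {ϖ : Ω} (hϖ : ϖ ∈ C.gr 1)
    (hdϖ : C.d ϖ = 0) :
    IsInsertion d (fun S => C.vinForm (consDeg d 1 S)
      (Fin.cons (C.vecCurv d (fun i => (e i).1) S, C.vinForm d e ϖ S) e) ϖ)
      (C.vinForm d e ϖ) 0 := by
  have hQR := C.curvOp_contr h.vec
  have hLQ := anticomm_curv C.diff_diff (C.diff_contr d fun i => (e i).1)
    (C.lieOp_contr d fun i => (e i).1) hQR
  have hQQ := sq_curv C.diff_diff (C.diff_contr d fun i => (e i).1)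
    (C.lieOp_contr d fun i => (e i).1) hQR
  have hφ := h.generic_mem_homSub C
  refine (C.isInsertion_vinForm (c := 1)
    (u := fun S => (C.vecCurv d (fun i => (e i).1) S, C.vinForm d e ϖ S))
    (C.rightMul_vecCurv h.vec) (halfCurv_commutator (C.parity_diff d))
    (halfAnticomm_comm_contr (C.parity_contr d h.vec) (C.diff_contr d _) hQR hLQ)
    (halfCurv_comm_lie (C.parity_lieOp d h.vec) hLQ)
    (halfCurv_comm_contr (C.parity_contr d h.vec) hQR) ϖ).congr_right ?_
  have e1 := C.halfCurv_apply_of_mem (X := fun i => (e i).1)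
    (C.lieOp_mem_homSub h.vec hφ (zero_add 1))
  have e2 : C.halfCurv d (fun i => (e i).1)
      (C.curvOp d (fun i => (e i).1) (generic d fun i => (e i).2)) = 0 :=
    LinearMap.congr_fun (halfCurv_mul_curv (C.parity_curvOp d h.vec) hQQ) _
  have e3 := C.halfCurv_apply_of_mem (X := fun i => (e i).1)
    (C.diff_mem_homSub (C.degProj_mem_homSub (p := -1) hφ) (zero_add 1))
  have e4 := C.halfCurv_apply_of_mem (X := fun i => (e i).1) (C.constCoeff_mem_homSub (d := d) hϖ)
  have e5 := C.parity_apply_of_mem hφ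
  have e6 := h.diff_degProj_vinForm C hdϖ
  simp only [Int.negOnePow_one, Int.negOnePow_zero, Units.val_neg, Units.val_one, one_smul,
    neg_smul, smul_neg, neg_neg] at e1 e3 e4 e5
  have key := bernConn_square (C.contr_pow_eq_zero (d := d) (X := fun i => (e i).1)
    (Nat.lt_succ_self m)) C.diff_diff (C.diff_contr d _) (C.lieOp_contr d _) hQR
    (v := generic d fun i => (e i).2)
    (C.diff_diff_apply (degProj d (-1) (generic d fun i => (e i).2)))
    (C.diff_constCoeff (m := m) hdϖ)
  rw [show (-1 - 1 : ℤ) = -2 by norm_num, e6, e1, e2, e3, e4]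
  simp only [LinearMap.smul_apply, Module.End.mul_apply, LinearMap.add_apply, e5, map_smul,
    map_zero, add_zero]
  refine Eq.trans ?_ key
  change bernConn (m + 1) (C.contr d fun i => (e i).1) C.diff (C.lieOp d fun i => (e i).1)
    (C.curvOp d fun i => (e i).1) (C.vinForm d e ϖ) - _ + _ + _ - _ + _ = _
  rw [vinForm]
  abel

/-- The differential of the part of degree `-2`, which consists of the values of degree zero. -/
theorem IsHomTuple.diff_degProj_obsForm (h : C.IsHomTuple d e) {ϖ : Ω} (hdϖ : C.d ϖ = 0)
    (hLϖ : C.lieOp d (fun i => (e i).1) (constCoeff ϖ) = 0) :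
    C.diff (degProj d (-2) (C.obsForm d e ϖ))
      = -((1 / 2 : ℝ) • C.curvOp d (fun i => (e i).1) (constCoeff ϖ)) := by
  have hϖ2 := C.contr_mem_degLE (q := -2) h.vec (C.contr_mem_degLE (q := -1) h.vec
    (constCoeff_mem_degLE (d := d) ϖ) (by norm_num)) (by norm_num)
  have hr : PowerSeries.constantCoeff (PowerSeries.mk fun k => coeff (k + 2) obsSeries)
      = -(1 / 2 : ℝ) := by
    rw [← PowerSeries.coeff_zero_eq_constantCoeff_apply, PowerSeries.coeff_mk, coeff_obsSeries]
    norm_num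
  rw [obsForm_eq]
  simp only [map_add, C.degProj_evalSeries h.vec _ hϖ2, degProj_diff, diff_diff_apply, hr,
    map_smul, C.degProj_contr_contr h.vec, C.diff_contr_contr hdϖ, hLϖ, map_zero, smul_zero,
    zero_add, add_zero]
  rw [neg_smul]

/-- The homotopy Jacobi identities of the local observables. -/
theorem isInsertion_obsForm_self (h : C.IsHomTuple d e) {ϖ : Ω} (hϖ : ϖ ∈ C.gr 1)
    (hdϖ : C.d ϖ = 0) (hLϖ : C.lieOp d (fun i => (e i).1) (constCoeff ϖ) = 0) :
    IsInsertion d (fun S => C.obsForm (consDeg d 1 S)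
      (Fin.cons (C.vecCurv d (fun i => (e i).1) S, C.obsForm d e ϖ S) e) ϖ)
      (C.obsForm d e ϖ) 0 := by
  have hQR := C.curvOp_contr h.vec
  have h0 := isInsertion_generic (d := d) (c := 1) (C.obsForm d e ϖ) fun i => (e i).2
  have h1 := C.isInsertion_evalSeries (C.rightMul_vecCurv h.vec)
    (halfCurv_comm_contr (C.parity_contr d h.vec) hQR) obsSeries
    (isInsertion_constCoeff (d := d) ϖ)
  have h2 := ((h1.add (C.isInsertion_diff h0)).sub (C.isInsertion_diff (h0.degProj (c := 1) (-1))))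
  convert h2 using 1
  · funext S
    rw [obsForm, fst_cons, snd_cons]
    rfl
  · rfl
  · have e4 := C.halfCurv_apply_of_mem (X := fun i => (e i).1)
      (C.constCoeff_mem_homSub (d := d) hϖ)
    simp only [Int.negOnePow_one, Units.val_neg, Units.val_one, one_smul, neg_smul, smul_neg,
      neg_neg] at e4
    have e5 : C.diff (C.obsForm d e ϖ) = C.diff
        (evalSeries (m + 1) (C.contr d fun i => (e i).1) obsSeries (constCoeff ϖ)) := by
      simp only [obsForm, map_add, map_sub, diff_diff_apply, add_zero, sub_zero]
    have key := evalSeries_obs_square (C.contr_pow_eq_zero (d := d) (X := fun i => (e i).1)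
      (Nat.lt_succ_self m)) C.diff_diff (C.diff_contr d _) (C.lieOp_contr d _) hQR
      (C.diff_constCoeff (m := m) hdϖ) hLϖ
    rw [show (-1 - 1 : ℤ) = -2 by norm_num, h.diff_degProj_obsForm C hdϖ hLϖ, e4, e5, map_zero,
      map_smul]
    refine key.symm.trans ?_
    abel

theorem rightMul_constCoeff_right {V W W' : Type*} [AddCommGroup V] [Module ℝ V] [AddCommGroup W]
    [Module ℝ W] [AddCommGroup W'] [Module ℝ W'] (B : V →ₗ[ℝ] W →ₗ[ℝ] W')
    (v : Finset (Fin m) → V) (w : W) (U : Finset (Fin m)) :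
    rightMul d c B v (constCoeff w) U = B (v U) w := by
  rw [rightMul, comb_apply, Finset.sum_eq_single U]
  · simp [mergeSign_empty_right, constCoeff_empty, degSum]
  · intro S hS hne
    have : U \ S ≠ ∅ := by
      rw [Ne, Finset.sdiff_eq_empty_iff_subset]
      exact fun h => hne (Finset.Subset.antisymm (Finset.mem_powerset.mp hS) h)
    rw [constCoeff_apply_of_ne _ this, map_zero, smul_zero, smul_zero]
  · simp

/-- The contraction of `ϖ` with the vector part of the structure. -/
theorem curvOp_constCoeff (hX : ∀ i, d i ≠ 0 → X i = 0) {ϖ : Ω} (hϖ : ϖ ∈ C.gr 1)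
    (U : Finset (Fin m)) :
    ((1 / 2 : ℝ) • C.curvOp d X (constCoeff ϖ)) U = C.ι (C.vecCurv d X U) ϖ := by
  have e4 := C.halfCurv_apply_of_mem (X := X) (C.constCoeff_mem_homSub (d := d) hϖ)
  simp only [Int.negOnePow_one, Units.val_neg, Units.val_one, one_smul, neg_smul, smul_neg,
    neg_neg] at e4
  rw [← e4, ← C.rightMul_vecCurv hX, rightMul_constCoeff_right]
  have h1 : C.ρ (C.vecCurv d X U) ϖ = C.γ (C.ι (C.vecCurv d X U) ϖ) := rfl
  rw [h1, C.γ_gr (C.ι_mem _ hϖ)]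
  simp

/-- The value of the structure given by the contractions of `ϖ` is Hamiltonian, with the bracket of
the Hamiltonian vector fields as its Hamiltonian vector field. -/
theorem IsHomTuple.d_obsForm (h : C.IsHomTuple d e) {ϖ : Ω} (hϖ : ϖ ∈ C.gr 1)
    (hdϖ : C.d ϖ = 0) (hLϖ : C.lieOp d (fun i => (e i).1) (constCoeff ϖ) = 0)
    {S : Finset (Fin m)} (hS : degSum d S = -2) :
    C.d (C.obsForm d e ϖ S) = -C.ι (C.vecCurv d (fun i => (e i).1) S) ϖ := by
  have h1 := congrFun (h.diff_degProj_obsForm C hdϖ hLϖ) S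
  rw [Pi.neg_apply, C.curvOp_constCoeff h.vec hϖ] at h1
  rw [← h1]
  change _ = C.d (degProj d (-2) (C.obsForm d e ϖ) S)
  rw [degProj_apply, if_pos hS]

/-- The value of the structure on Hamiltonian pairs is a Hamiltonian pair: the form part is
Hamiltonian, and its Hamiltonian vector field is the vector part. -/
theorem IsHomTuple.d_vinForm (h : C.IsHomTuple d e) {ϖ : Ω} (hϖ : ϖ ∈ C.gr 1)
    (hdϖ : C.d ϖ = 0) (hLϖ : C.lieOp d (fun i => (e i).1) (constCoeff ϖ) = 0)
    (hham : C.diff (degProj d (-1) (generic d fun i => (e i).2))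
      = -C.contr d (fun i => (e i).1) (constCoeff ϖ))
    {S : Finset (Fin m)} (hS : degSum d S = -2) :
    C.d (C.vinForm d e ϖ S) = -C.ι (C.vecCurv d (fun i => (e i).1) S) ϖ := by
  have h1 := h.diff_degProj_vinForm C hdϖ
  rw [hham, map_neg, lieOp_contr_apply, hLϖ, map_zero] at h1
  have h2 : C.diff (degProj d (-2) (C.vinForm d e ϖ))
      = -((1 / 2 : ℝ) • C.curvOp d (fun i => (e i).1) (constCoeff ϖ)) := by
    rw [h1]; module
  have h3 := congrFun h2 S
  rw [Pi.neg_apply, C.curvOp_constCoeff h.vec hϖ] at h3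
  rw [← h3]
  change _ = C.d (degProj d (-2) (C.vinForm d e ϖ) S)
  rw [degProj_apply, if_pos hS]

/-- The composition of the morphism with the structure of the local observables, on the generic
element. -/
theorem isInsertion_morForm (h : C.IsHomTuple d e) (ϖ : Ω) :
    IsInsertion d (fun S => C.morForm (consDeg d 1 S)
      (Fin.cons (C.vecCurv d (fun i => (e i).1) S, C.obsForm d e ϖ S) e))
      (C.morForm d e)
      (evalSeries (m + 1) (C.contr d fun i => (e i).1) (bernSeries + PowerSeries.X)
          (C.obsForm d e ϖ)
        - (1 / 2 : ℝ) • evalSeries (m + 1) (C.contr d fun i => (e i).1)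
          (derivative ℝ (bernSeries + PowerSeries.X))
          (C.curvOp d (fun i => (e i).1) (generic d fun i => (e i).2))) := by
  have hQR := C.curvOp_contr h.vec
  have h0 := isInsertion_generic (d := d) (c := 1) (C.obsForm d e ϖ) fun i => (e i).2
  have h1 := C.isInsertion_evalSeries (C.rightMul_vecCurv h.vec)
    (halfCurv_comm_contr (C.parity_contr d h.vec) hQR) (bernSeries + PowerSeries.X) h0
  convert h1 using 1
  · funext S
    rw [morForm, fst_cons, snd_cons]
  · rfl
  · have e4 := C.halfCurv_apply_of_mem (X := fun i => (e i).1) (h.generic_mem_homSub C)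
    simp only [Int.negOnePow_zero, Units.val_one, one_smul] at e4
    rw [e4, map_smul, neg_smul, sub_eq_add_neg]

theorem rightMul_zero (φ : Finset (Fin m) → Ω) :
    rightMul d c C.ρ (fun _ => 0) φ = (0 : Module.End ℝ (Finset (Fin m) → Ω)) φ := by
  funext U
  simp [rightMul, comb_apply]

/-- The insertion of the components of the morphism with at least two arguments into the structure
given by the nested brackets. Their sum has no vector part, and no part of degree `-1`. -/
theorem isInsertion_vinForm_mor (h : C.IsHomTuple d e) (ϖ : Ω) :
    IsInsertion d (fun S => C.vinForm (consDeg d 0 S)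
      (Fin.cons (0, C.morForm d e S - generic d (fun i => (e i).2) S) e) ϖ)
      (C.vinForm d e ϖ)
      (bernConn (m + 1) (C.contr d fun i => (e i).1) C.diff (C.lieOp d fun i => (e i).1)
          (C.curvOp d fun i => (e i).1) (C.morForm d e - generic d (fun i => (e i).2))) := by
  refine (C.isInsertion_vinForm (c := 0) (ν := 0) (κ := 0)
    (u := fun S => (0, C.morForm d e S - generic d (fun i => (e i).2) S))
    C.rightMul_zero (by simp) (by simp) (by simp) (by simp) ϖ).congr_right ?_
  have e1 : degProj d (-1) (C.morForm d e - generic d (fun i => (e i).2)) = 0 := by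
    rw [map_sub, morForm, C.degProj_evalSeries h.vec _ (h.generic_mem_degLE C), map_add,
      constantCoeff_bernSeries]
    simp
  have e2 : degProj d (-1 - 0) (fun S => C.morForm d e S - generic d (fun i => (e i).2) S) = 0 := by
    rw [sub_zero]; exact e1
  rw [e2]
  simp only [map_zero, LinearMap.zero_apply, add_zero, sub_zero]
  rfl

/-- The form part of the compatibility of the morphism with the two structures. -/
theorem morForm_comm (h : C.IsHomTuple d e) {ϖ : Ω}
    (hham : C.diff (degProj d (-1) (generic d fun i => (e i).2))
      = -C.contr d (fun i => (e i).1) (constCoeff ϖ)) :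
    evalSeries (m + 1) (C.contr d fun i => (e i).1) (bernSeries + PowerSeries.X)
          (C.obsForm d e ϖ)
        - (1 / 2 : ℝ) • evalSeries (m + 1) (C.contr d fun i => (e i).1)
          (derivative ℝ (bernSeries + PowerSeries.X))
          (C.curvOp d (fun i => (e i).1) (generic d fun i => (e i).2))
      = C.vinForm d e ϖ
        + bernConn (m + 1) (C.contr d fun i => (e i).1) C.diff (C.lieOp d fun i => (e i).1)
          (C.curvOp d fun i => (e i).1) (C.morForm d e - generic d (fun i => (e i).2)) := by
  have key := bernConn_intertwine (C.contr_pow_eq_zero (d := d) (X := fun i => (e i).1)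
    (Nat.lt_succ_self m)) C.diff_diff (C.diff_contr d _) (C.lieOp_contr d _)
    (C.curvOp_contr h.vec) (v := generic d fun i => (e i).2) hham
  rw [obsForm, ← key, map_sub, vinForm, morForm]
  abel

end CartanCalculus
/-! ### Unshuffles and partitions -/

section Subtuples

variable {m : ℕ} (d : Fin m → ℤ) {V W U : Type*}

theorem onSubtuples_orderEmb (F : GradedFamily V W) (x : Fin m → V) {k : ℕ} (h : Fin k ↪o Fin m)
    {S : Finset (Fin m)} (hS : Finset.univ.map h.toEmbedding = S) :
    onSubtuples d F x S = F k (d ∘ h) (x ∘ h) := by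
  have hc : S.card = k := by rw [← hS, Finset.card_map, Finset.card_univ, Fintype.card_fin]
  subst hc
  have e : h = S.orderEmbOfFin rfl := by
    refine Finset.orderEmbOfFin_unique' rfl fun a => ?_
    have := Finset.mem_map_of_mem h.toEmbedding (Finset.mem_univ a)
    rwa [hS] at this
  conv_rhs => rw [e]
  rfl

theorem onSubtuples_univ (F : GradedFamily V W) (x : Fin m → V) :
    onSubtuples d F x Finset.univ = F m d x :=
  onSubtuples_orderEmb d F x (RelEmbedding.refl _) (by ext; simp)

theorem onSubtuples_singleton (F : GradedFamily V W) (x : Fin m → V) (i : Fin m) :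
    onSubtuples d F x {i} = F 1 (fun _ => d i) (fun _ => x i) :=
  onSubtuples_orderEmb d F x
    (OrderEmbedding.ofStrictMono (fun _ => i) (Subsingleton.strictMono _)) (by ext; simp [eq_comm])

/-- The subtuples which contain the first element of a tuple. -/
theorem onSubtuples_insert_upSet (F : GradedFamily V W) (x : Fin m → V) (d₀ : ℤ) (x₀ : V)
    (T : Finset (Fin m)) :
    onSubtuples (Fin.cons d₀ d : Fin (m + 1) → ℤ) F (Fin.cons x₀ x) (insert 0 (upSet T))
      = F (T.card + 1) (Fin.cons d₀ (subtuple T d)) (Fin.cons x₀ (subtuple T x)) := by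
  have hmono : StrictMono
      (Fin.cons 0 fun a => (T.orderEmbOfFin rfl a).succ : Fin (T.card + 1) → Fin (m + 1)) := by
    intro a b hab
    induction b using Fin.cases with
    | zero => exact absurd hab (Fin.not_lt_zero a)
    | succ b =>
      induction a using Fin.cases with
      | zero => simp
      | succ a => simpa using hab
  refine (onSubtuples_orderEmb _ F _ (OrderEmbedding.ofStrictMono _ hmono) ?_).trans ?_
  · ext j
    rw [Finset.mem_map, Finset.mem_insert]
    simp only [Finset.mem_univ, true_and,
      RelEmbedding.coe_toEmbedding, OrderEmbedding.coe_ofStrictMono, Fin.exists_fin_succ]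
    induction j using Fin.cases with
    | zero => simp
    | succ j =>
      rw [succ_mem_upSet]
      have := Finset.range_orderEmbOfFin T rfl
      rw [Set.ext_iff] at this
      have := this j
      simp only [Set.mem_range, Finset.mem_coe] at this
      simp [← this, Fin.succ_ne_zero, (Fin.succ_ne_zero _).symm]
  · congr 1
    · funext a
      induction a using Fin.cases with
      | zero => rfl
      | succ a => rfl
    · funext a
      induction a using Fin.cases with
      | zero => rfl
      | succ a => rfl

variable [AddCommGroup V] [Module ℝ V] [AddCommGroup W] [Module ℝ W] [AddCommGroup U] [Module ℝ U]

/-- The sum over all nonempty sets `S` of indices of the values of `F` on the element `u S` and the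
elements with indices not in `S`, where `u S` has shifted degree `c` relative to the elements with
indices in `S`. -/
def insertSum (F : GradedFamily V W) (c : ℤ) (u : Finset (Fin m) → V) (x : Fin m → V) : W :=
  ∑ S : Finset (Fin m) with S.Nonempty, mergeSign d S Sᶜ •
    F (Sᶜ.card + 1) (Fin.cons (CartanCalculus.degSum d S + c + 1) (subtuple Sᶜ d))
      (Fin.cons (u S) (subtuple Sᶜ x))

/-- The composition of codifferentials inserts the values of `D`, which raises the degree by one,
into `F`. -/
theorem unshuffleSum_eq_insertSum (F : GradedFamily V W) (D : GradedFamily V V) (x : Fin m → V) :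
    unshuffleSum F D d x = insertSum d F 1 (onSubtuples d D x) x := by
  refine Finset.sum_congr rfl fun S _ => ?_
  rw [mergeSign_compl, add_assoc]
  rfl

/-- A sum over unshuffles is the derivative of an expression in the generic element, in the sense of
`IsInsertion.right`. -/
theorem insertSum_eq_comb (F : GradedFamily V W)
    (hF : ∀ (k : ℕ) (δ : Fin (k + 1) → ℤ) (y : Fin k → V), F (k + 1) δ (Fin.cons 0 y) = 0) (c : ℤ)
    {u : Finset (Fin m) → V} (hu : u ∅ = 0) (x : Fin m → V) :
    insertSum d F c u x = comb d (fun S => slice₁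
      (onSubtuples (consDeg d c S) F (Fin.cons (u S) x))) Finset.univ := by
  have e : ∀ S, slice₁ (onSubtuples (consDeg d c S) F (Fin.cons (u S) x)) Sᶜ
      = F (Sᶜ.card + 1) (Fin.cons (CartanCalculus.degSum d S + c + 1) (subtuple Sᶜ d))
      (Fin.cons (u S) (subtuple Sᶜ x)) := fun S => onSubtuples_insert_upSet d F x _ _ _
  rw [insertSum, comb_apply, Finset.powerset_univ, Finset.sum_filter]
  refine Finset.sum_congr rfl fun S _ => ?_
  rw [← Finset.compl_eq_univ_sdiff, e]
  split_ifs with hS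
  · rfl
  · rw [Finset.not_nonempty_iff_eq_empty.mp hS, hu, hF, smul_zero]

end Subtuples

section Partition

variable {m : ℕ}

/-- Two numberings of the blocks of the same partition differ by a permutation. -/
theorem exists_perm_comp_eq {r : ℕ} {f g : Fin m → Fin r} (hf : Function.Surjective f)
    (hg : Function.Surjective g) (h : ∀ i j, f i = f j ↔ g i = g j) :
    ∃ π : Equiv.Perm (Fin r), f = π ∘ g := by
  obtain ⟨s, hs⟩ := hg.hasRightInverse
  have hi : Function.Injective (f ∘ s) := by
    intro a b hab
    have := (h _ _).mp hab
    rwa [hs, hs] at this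
  refine ⟨Equiv.ofBijective (f ∘ s) (Finite.injective_iff_bijective.mp hi), ?_⟩
  funext i
  exact (h _ _).mpr (hs (g i)).symm

/-- The number of blocks is determined by the partition. -/
theorem eq_of_surjective_of_ker_eq {r s : ℕ} {f : Fin m → Fin r} {g : Fin m → Fin s}
    (hf : Function.Surjective f) (hg : Function.Surjective g)
    (h : ∀ i j, f i = f j ↔ g i = g j) : r = s := by
  obtain ⟨a, ha⟩ := hf.hasRightInverse
  obtain ⟨b, hb⟩ := hg.hasRightInverse
  refine le_antisymm ?_ ?_
  · refine Fin.le_of_injective (g ∘ a) fun p q hpq => ?_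
    have := (h _ _).mpr hpq
    rwa [ha, ha] at this
  · refine Fin.le_of_injective (f ∘ b) fun p q hpq => ?_
    have := (h _ _).mp hpq
    rwa [hb, hb] at this

open Classical in
/-- All numberings of the blocks of a given partition contribute equally, so that the sum over them
cancels the factorial. -/
theorem sum_surjective_ker_eq {U : Type*} [AddCommGroup U] [Module ℝ U]
    (t : (r : ℕ) → (Fin m → Fin r) → U) {s : ℕ} {g : Fin m → Fin s} (hg : Function.Surjective g)
    (ht : ∀ π : Equiv.Perm (Fin s), t s (π ∘ g) = t s g) :
    ∑ r ∈ Finset.range (m + 1), ((r.factorial : ℝ)⁻¹) •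
      ∑ f : Fin m → Fin r with Function.Surjective f,
        (if ∀ i j, f i = f j ↔ g i = g j then t r f else 0) = t s g := by
  have hs : s ≤ m := by simpa using Fintype.card_le_of_surjective g hg
  rw [Finset.sum_eq_single s]
  · have e : ∑ f : Fin m → Fin s with Function.Surjective f,
        (if ∀ i j, f i = f j ↔ g i = g j then t s f else 0)
        = ∑ π : Equiv.Perm (Fin s), t s (π ∘ g) := by
      symm
      refine Finset.sum_of_injOn (fun π : Equiv.Perm (Fin s) => (π ∘ g : Fin m → Fin s)) ?_ ?_ ?_ ?_
      · intro π _ π' _ h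
        refine Equiv.ext fun a => ?_
        obtain ⟨i, rfl⟩ := hg a
        exact congrFun h i
      · intro π _
        simpa using π.surjective.comp hg
      · intro f hf hn
        rw [Finset.mem_filter] at hf
        refine if_neg fun h => hn ?_
        obtain ⟨π, rfl⟩ := exists_perm_comp_eq hf.2 hg h
        exact ⟨π, by simp, rfl⟩
      · intro π _
        simp
    rw [e]
    simp only [ht, Finset.sum_const, Finset.card_univ, Fintype.card_perm, Fintype.card_fin]
    rw [← Nat.cast_smul_eq_nsmul ℝ, smul_smul, inv_mul_cancel₀ (by positivity), one_smul]
  · intro r _ hr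
    rw [Finset.sum_eq_zero, smul_zero]
    intro f hf
    rw [Finset.mem_filter] at hf
    exact if_neg fun h => hr (eq_of_surjective_of_ker_eq hf.2 hg h)
  · intro h
    exact absurd (Finset.mem_range.mpr (Nat.lt_succ_of_le hs)) h

/-- The numbering of the blocks of the partition into `S` and singletons, where `S` comes first. -/
def blockMap (S : Finset (Fin m)) (i : Fin m) : Fin (Sᶜ.card + 1) :=
  if h : i ∈ Sᶜ then ((Sᶜ.orderIsoOfFin rfl).symm ⟨i, h⟩).succ else 0

theorem blockMap_of_mem {S : Finset (Fin m)} {i : Fin m} (h : i ∈ S) : blockMap S i = 0 :=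
  dif_neg (by simpa using h)

theorem blockMap_orderEmb (S : Finset (Fin m)) (a : Fin Sᶜ.card) :
    blockMap S (Sᶜ.orderEmbOfFin rfl a) = a.succ := by
  rw [blockMap, dif_pos (Finset.orderEmbOfFin_mem _ rfl a)]
  congr 1
  rw [OrderIso.symm_apply_eq]
  rfl

/-- Every index outside `S` occurs in the increasing enumeration of the complement of `S`. -/
theorem exists_orderEmb {S : Finset (Fin m)} {i : Fin m} (h : i ∉ S) :
    ∃ a, Sᶜ.orderEmbOfFin rfl a = i := by
  have := Finset.range_orderEmbOfFin Sᶜ rfl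
  rw [Set.ext_iff] at this
  exact (this i).mpr (by simpa using h)

theorem blockMap_surjective {S : Finset (Fin m)} (hS : S.Nonempty) :
    Function.Surjective (blockMap S) := by
  intro a
  induction a using Fin.cases with
  | zero => exact ⟨hS.choose, blockMap_of_mem hS.choose_spec⟩
  | succ a => exact ⟨_, blockMap_orderEmb S a⟩

theorem blockMap_eq_iff (S : Finset (Fin m)) (i j : Fin m) :
    blockMap S i = blockMap S j ↔ i = j ∨ (i ∈ S ∧ j ∈ S) := by
  by_cases hi : i ∈ S
  · by_cases hj : j ∈ S
    · simp [blockMap_of_mem, hi, hj]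
    · obtain ⟨b, rfl⟩ := exists_orderEmb hj
      rw [blockMap_of_mem hi, blockMap_orderEmb]
      simp only [hj, and_false, or_false, (Fin.succ_ne_zero b).symm, false_iff]
      rintro rfl
      exact hj hi
  · obtain ⟨a, rfl⟩ := exists_orderEmb hi
    by_cases hj : j ∈ S
    · rw [blockMap_of_mem hj, blockMap_orderEmb]
      simp only [hi, false_and, or_false, Fin.succ_ne_zero, false_iff]
      rintro rfl
      exact hi hj
    · obtain ⟨b, rfl⟩ := exists_orderEmb hj
      rw [blockMap_orderEmb, blockMap_orderEmb]
      simp [hi]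

theorem filter_blockMap_zero (S : Finset (Fin m)) :
    (Finset.univ.filter fun i => blockMap S i = 0) = S := by
  ext i
  by_cases hi : i ∈ S
  · simp [blockMap_of_mem, hi]
  · obtain ⟨a, rfl⟩ := exists_orderEmb hi
    simp [blockMap_orderEmb, hi, Fin.succ_ne_zero]

theorem filter_blockMap_succ (S : Finset (Fin m)) (a : Fin Sᶜ.card) :
    (Finset.univ.filter fun i => blockMap S i = a.succ) = {Sᶜ.orderEmbOfFin rfl a} := by
  ext i
  by_cases hi : i ∈ S
  · simp only [Finset.mem_filter, Finset.mem_univ, true_and, blockMap_of_mem hi,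
      Finset.mem_singleton, (Fin.succ_ne_zero a).symm, false_iff]
    rintro rfl
    exact Finset.mem_compl.mp (Finset.orderEmbOfFin_mem Sᶜ rfl a) hi
  · obtain ⟨b, rfl⟩ := exists_orderEmb hi
    simp [blockMap_orderEmb]

/-- The Koszul sign of the partition into `S` and singletons is that of the unshuffle given by `S`.
-/
theorem koszulSign_blockMap (d : Fin m → ℤ) (S : Finset (Fin m)) :
    koszulSign d (blockMap S) = mergeSign d S Sᶜ := by
  rw [← mergeSign_compl, koszulSign, koszulSign]
  refine Finset.prod_congr rfl fun i _ => Finset.prod_congr rfl fun j _ => ?_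
  refine if_congr (and_congr_right fun hij => ?_) rfl rfl
  by_cases hi : i ∈ S
  · simp [blockMap_of_mem, hi]
  · obtain ⟨a, rfl⟩ := exists_orderEmb hi
    by_cases hj : j ∈ S
    · simp [blockMap_of_mem, hj, hi, blockMap_orderEmb]
    · obtain ⟨b, rfl⟩ := exists_orderEmb hj
      rw [OrderEmbedding.lt_iff_lt] at hij
      simp [hi, hj, blockMap_orderEmb, hij.le]

end Partition

section PartitionSum

variable {m : ℕ} (d : Fin m → ℤ) {V W U : Type*} [AddCommGroup V] [Module ℝ V]
  [AddCommGroup W] [Module ℝ W] [AddCommGroup U] [Module ℝ U]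

open CartanCalculus (degSum)

/-- If `symmetrize f` vanishes as soon as two of its arguments satisfy `N`, which holds for the
values of `Ψ` on at least two elements, then only the partitions with at most one block of at least
two elements contribute to the composition. -/
theorem partitionSum_symmetrize (f : GradedFamily W U) (Ψ : GradedFamily V W) (x : Fin m → V)
    (N : W → Prop) (hN : ∀ S : Finset (Fin m), 2 ≤ S.card → N (onSubtuples d Ψ x S))
    (hF : ∀ (r : ℕ) (δ : Fin r → ℤ) (y : Fin r → W) (a b : Fin r), a ≠ b → N (y a) → N (y b) →
      symmetrize f r δ y = 0) :
    partitionSum (symmetrize f) Ψ d x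
      = symmetrize f m d (fun i => onSubtuples d Ψ x {i})
        + ∑ S : Finset (Fin m) with 2 ≤ S.card, mergeSign d S Sᶜ •
          symmetrize f (Sᶜ.card + 1) (Fin.cons (degSum d S + 1) (subtuple Sᶜ d))
            (Fin.cons (onSubtuples d Ψ x S) (subtuple Sᶜ fun i => onSubtuples d Ψ x {i})) := by
  classical
  set t : (r : ℕ) → (Fin m → Fin r) → U := fun r g => koszulSign d g •
    symmetrize f r (fun a => ∑ i with g i = a, (d i - 1) + 1)
      (fun a => onSubtuples d Ψ x (Finset.univ.filter fun i => g i = a)) with ht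
  have htπ : ∀ (r : ℕ) (g : Fin m → Fin r) (π : Equiv.Perm (Fin r)), t r (π ∘ g) = t r g := by
    intro r g π
    have e : ∀ a, (Finset.univ.filter fun i => (π ∘ g) i = a)
        = Finset.univ.filter fun i => g i = π.symm a := by
      intro a; ext i; simp [Equiv.eq_symm_apply]
    simp only [ht, e]
    have h := symmetrize_perm f (fun a => ∑ i with g i = a, (d i - 1) + 1)
      (fun a => onSubtuples d Ψ x (Finset.univ.filter fun i => g i = a)) π.symm
    rw [Equiv.symm_symm] at h
    refine (congrArg (fun z => koszulSign d (π ∘ g) • z) h).trans ?_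
    rw [koszulSign_perm_comp, smul_smul, mul_assoc, koszulSign_mul_self, mul_one]
  -- A numbering of blocks belongs to the partition into singletons, or to one with a single block
  -- of at least two elements, or it has two such blocks, and then its contribution vanishes.
  have hsplit : ∀ (r : ℕ) (g : Fin m → Fin r),
      t r g = (if ∀ i j, g i = g j ↔ (id i : Fin m) = id j then t r g else 0)
        + ∑ S : Finset (Fin m) with 2 ≤ S.card,
          if ∀ i j, g i = g j ↔ blockMap S i = blockMap S j then t r g else 0 := by
    intro r g
    -- The only possible block with at least two elements: the indices which `g` does not separate
    -- from all others.
    set S₀ : Finset (Fin m) := Finset.univ.filter fun i => ∃ j, j ≠ i ∧ g j = g i with hS₀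
    have hmem : ∀ i, i ∈ S₀ ↔ ∃ j, j ≠ i ∧ g j = g i := by intro i; simp [hS₀]
    have huniq : ∀ S : Finset (Fin m), 2 ≤ S.card →
        (∀ i j, g i = g j ↔ blockMap S i = blockMap S j) → S = S₀ := by
      intro S hS h
      simp only [blockMap_eq_iff] at h
      ext i
      rw [hmem]
      constructor
      · intro hi
        obtain ⟨j, hj, hne⟩ := Finset.exists_mem_ne (by omega : 1 < S.card) i
        exact ⟨j, hne, (h j i).mpr (Or.inr ⟨hj, hi⟩)⟩
      · rintro ⟨j, hne, hj⟩
        rcases (h j i).mp hj with h1 | h1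
        · exact absurd h1 hne
        · exact h1.2
    by_cases hinj : Function.Injective g
    · have hid : ∀ i j, g i = g j ↔ (id i : Fin m) = id j := fun i j => hinj.eq_iff
      rw [if_pos hid, Finset.sum_eq_zero, add_zero]
      intro S hS
      rw [Finset.mem_filter] at hS
      refine if_neg fun h => ?_
      have h0 := huniq S hS.2 h
      have : S₀ = ∅ := by
        rw [Finset.eq_empty_iff_forall_notMem]
        intro i hi
        obtain ⟨j, hne, hj⟩ := (hmem i).mp hi
        exact hne (hinj hj)
      rw [h0, this] at hS
      simp at hS
    · rw [if_neg fun h => hinj fun i j hij => (h i j).mp hij, zero_add]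
      have hcard : 2 ≤ S₀.card := by
        simp only [Function.Injective, not_forall] at hinj
        obtain ⟨i, j, hij, hne⟩ := hinj
        have : 1 < S₀.card := Finset.one_lt_card.mpr
          ⟨i, (hmem i).mpr ⟨j, Ne.symm hne, hij.symm⟩, j, (hmem j).mpr ⟨i, hne, hij⟩, hne⟩
        omega
      rw [Finset.sum_eq_single S₀]
      · split_ifs with h
        · rfl
        · simp only [blockMap_eq_iff, not_forall] at h
          obtain ⟨i, j, hij⟩ := h
          have key : i ∈ S₀ ∧ j ∈ S₀ ∧ g i ≠ g j := by
            by_cases hg : g i = g j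
            · exfalso
              refine hij ⟨fun _ => ?_, fun _ => hg⟩
              by_cases hne : i = j
              · exact Or.inl hne
              · exact Or.inr ⟨(hmem i).mpr ⟨j, Ne.symm hne, hg.symm⟩, (hmem j).mpr ⟨i, hne, hg⟩⟩
            · by_contra hn
              refine hij ⟨fun h => absurd h hg, ?_⟩
              rintro (rfl | h)
              · exact absurd rfl hg
              · exact absurd ⟨h.1, h.2, hg⟩ hn
          have hblock : ∀ i ∈ S₀, 2 ≤ (Finset.univ.filter fun l => g l = g i).card := by
            intro i hi
            obtain ⟨j, hne, hj⟩ := (hmem i).mp hi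
            have : 1 < (Finset.univ.filter fun l => g l = g i).card :=
              Finset.one_lt_card.mpr ⟨i, by simp, j, by simp [hj], hne.symm⟩
            omega
          simp only [ht]
          rw [hF r _ _ (g i) (g j) key.2.2 (hN _ (hblock i key.1)) (hN _ (hblock j key.2.1)),
            smul_zero]
      · intro S hS hne
        rw [Finset.mem_filter] at hS
        exact if_neg fun h => hne (huniq S hS.2 h)
      · intro h
        exact absurd (Finset.mem_filter.mpr ⟨Finset.mem_univ S₀, hcard⟩) h
  have h1 : partitionSum (symmetrize f) Ψ d x = ∑ r ∈ Finset.range (m + 1),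
      ((r.factorial : ℝ)⁻¹) • ∑ g : Fin m → Fin r with Function.Surjective g, t r g := by
    rw [partitionSum]
    refine Finset.sum_congr rfl fun r _ => ?_
    congr 1
  have h2 : ∀ r, ∑ g : Fin m → Fin r with Function.Surjective g, t r g
      = (∑ g : Fin m → Fin r with Function.Surjective g,
          if ∀ i j, g i = g j ↔ (id i : Fin m) = id j then t r g else 0)
        + ∑ S : Finset (Fin m) with 2 ≤ S.card,
          ∑ g : Fin m → Fin r with Function.Surjective g,
            if ∀ i j, g i = g j ↔ blockMap S i = blockMap S j then t r g else 0 := by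
    intro r
    rw [Finset.sum_comm, ← Finset.sum_add_distrib]
    exact Finset.sum_congr rfl fun g _ => hsplit r g
  rw [h1]
  simp only [h2, smul_add, Finset.sum_add_distrib, Finset.smul_sum (s := Finset.univ.filter
    fun S : Finset (Fin m) => 2 ≤ S.card)]
  rw [Finset.sum_comm, sum_surjective_ker_eq t Function.surjective_id fun π => htπ m id π]
  congr 1
  · simp only [ht, id]
    have e1 : koszulSign d (fun i : Fin m => i) = 1 := by
      refine Finset.prod_eq_one fun i _ => Finset.prod_eq_one fun j _ => if_neg ?_
      exact fun h => lt_asymm h.1 h.2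
    have e2 : ∀ a : Fin m, (Finset.univ.filter fun i => i = a) = {a} := by intro a; ext; simp
    rw [show koszulSign d (id : Fin m → Fin m) = 1 from e1, one_smul]
    simp [e2]
  · refine Finset.sum_congr rfl fun S hS => ?_
    rw [Finset.mem_filter] at hS
    have hne : S.Nonempty := Finset.card_pos.mp (by omega)
    rw [sum_surjective_ker_eq t (blockMap_surjective hne) fun π => htπ _ _ π]
    simp only [ht, koszulSign_blockMap]
    congr 2
    · funext a
      induction a using Fin.cases with
      | zero => rw [filter_blockMap_zero]; rfl
      | succ a => rw [filter_blockMap_succ]; simp [subtuple]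
    · funext a
      induction a using Fin.cases with
      | zero => rw [filter_blockMap_zero]; rfl
      | succ a => rw [filter_blockMap_succ]; rfl

end PartitionSum
/-! ### From closed formulas to the structure equations -/

section Multilinear

variable {k m : ℕ} {V W U U' : Type*} [AddCommGroup V] [Module ℝ V] [AddCommGroup W] [Module ℝ W]
  [AddCommGroup U] [Module ℝ U] [AddCommGroup U'] [Module ℝ U']

/-- The function underlies a multilinear map. -/
def IsMultilin (f : (Fin k → V) → W) : Prop :=
  ∃ A : MultilinearMap ℝ (fun _ : Fin k => V) W, ∀ x, A x = f x

theorem isMultilin_zero : IsMultilin (fun _ : Fin k → V => (0 : W)) := ⟨0, fun _ => rfl⟩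

theorem isMultilin_const (w : W) : IsMultilin (fun _ : Fin 0 → V => w) :=
  ⟨MultilinearMap.constOfIsEmpty ℝ _ w, fun _ => rfl⟩

theorem isMultilin_one (A : V →ₗ[ℝ] W) : IsMultilin (fun x : Fin 1 → V => A (x 0)) :=
  ⟨A.compMultilinearMap (MultilinearMap.ofSubsingleton ℝ V V (0 : Fin 1) LinearMap.id),
    fun _ => rfl⟩

theorem IsMultilin.linear {f : (Fin k → V) → W} (h : IsMultilin f) (A : W →ₗ[ℝ] U) :
    IsMultilin fun x => A (f x) := by
  obtain ⟨F, hF⟩ := h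
  exact ⟨A.compMultilinearMap F, fun x => by simp [hF]⟩

theorem IsMultilin.smul {f : (Fin k → V) → W} (h : IsMultilin f) (r : ℝ) :
    IsMultilin fun x => r • f x := h.linear (r • LinearMap.id)

theorem IsMultilin.zsmul {f : (Fin k → V) → W} (h : IsMultilin f) (r : ℤ) :
    IsMultilin fun x => r • f x := h.linear (r • LinearMap.id)

theorem IsMultilin.ite {f : (Fin k → V) → W} (h : IsMultilin f) (p : Prop) [Decidable p] :
    IsMultilin fun x => if p then f x else 0 := by
  split_ifs
  · exact h
  · exact isMultilin_zero

theorem IsMultilin.ite_zero {f : (Fin k → V) → W} (h : IsMultilin f) (p : Prop) [Decidable p] :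
    IsMultilin fun x => if p then 0 else f x := by
  split_ifs
  · exact isMultilin_zero
  · exact h

theorem IsMultilin.snoc {f : (Fin k → V) → W} (h : IsMultilin f) (B : W →ₗ[ℝ] V →ₗ[ℝ] U) :
    IsMultilin fun x : Fin (k + 1) → V => B (f (Fin.init x)) (x (Fin.last k)) := by
  obtain ⟨F, hF⟩ := h
  refine ⟨MultilinearMap.uncurryRight (M := fun _ : Fin (k + 1) => V)
    (B.compMultilinearMap F), fun x => ?_⟩
  simp [hF]

theorem IsMultilin.perm {f : (Fin k → V) → W} (h : IsMultilin f) (σ : Equiv.Perm (Fin k)) :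
    IsMultilin fun x => f (x ∘ σ) := by
  obtain ⟨F, hF⟩ := h
  exact ⟨F.domDomCongr σ, fun x => by rw [MultilinearMap.domDomCongr_apply, hF]; rfl⟩

theorem IsMultilin.sum {ι : Type*} (s : Finset ι) {f : ι → (Fin k → V) → W}
    (h : ∀ i, IsMultilin (f i)) : IsMultilin fun x => ∑ i ∈ s, f i x := by
  choose F hF using h
  exact ⟨∑ i ∈ s, F i, fun x => by simp [hF]⟩

theorem IsMultilin.map_update_add {f : (Fin k → V) → W} (h : IsMultilin f) (x : Fin k → V)
    (i : Fin k) (u v : V) : f (Function.update x i (u + v))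
      = f (Function.update x i u) + f (Function.update x i v) := by
  obtain ⟨F, hF⟩ := h
  simp only [← hF, F.map_update_add]

theorem IsMultilin.map_update_smul {f : (Fin k → V) → W} (h : IsMultilin f) (x : Fin k → V)
    (i : Fin k) (c : ℝ) (u : V) : f (Function.update x i (c • u))
      = c • f (Function.update x i u) := by
  obtain ⟨F, hF⟩ := h
  simp only [← hF, F.map_update_smul]

theorem IsMultilin.map_zero {f : (Fin k → V) → W} (h : IsMultilin f) {x : Fin k → V}
    {i : Fin k} (hx : x i = 0) : f x = 0 := by
  obtain ⟨F, hF⟩ := h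
  rw [← hF, F.map_coord_zero i hx]

theorem IsMultilin.symmetrize {f : GradedFamily V W} (h : ∀ k d, IsMultilin (f k d)) (k : ℕ)
    (d : Fin k → ℤ) : IsMultilin (symmetrize f k d) :=
  IsMultilin.sum _ fun σ => ((h k (d ∘ σ)).perm σ).zsmul _

end Multilinear

namespace CartanCalculus

open PowerSeries (coeff)

variable {𝔤 Ω : Type*} [AddCommGroup 𝔤] [Module ℝ 𝔤] [AddCommGroup Ω] [Module ℝ Ω]
  (C : CartanCalculus 𝔤 Ω)

/-- The Poisson bracket as a bilinear map. -/
def poissonLM : 𝔤 × Ω →ₗ[ℝ] 𝔤 × Ω →ₗ[ℝ] 𝔤 × Ω :=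
  LinearMap.mk₂ ℝ C.poisson
    (fun a b c => by simp [poisson]; abel)
    (fun r a b => by simp [poisson])
    (fun a b c => by simp [poisson]; abel)
    (fun r a b => by simp [poisson])

/-- The Dorfman bracket as a bilinear map. -/
def dorfmanLM (ϖ : Ω) : 𝔤 × Ω →ₗ[ℝ] 𝔤 × Ω →ₗ[ℝ] 𝔤 × Ω :=
  LinearMap.mk₂ ℝ (C.dorfman ϖ)
    (fun a b c => by simp [dorfman]; abel)
    (fun r a b => by simp [dorfman])
    (fun a b c => by simp [dorfman]; abel)
    (fun r a b => by simp [dorfman])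

theorem isMultilin_nested (ϖ : Ω) (k : ℕ) : IsMultilin (C.nested ϖ k) := by
  induction k with
  | zero => exact (isMultilin_one LinearMap.id).snoc (C.dorfmanLM ϖ)
  | succ k ih => exact ih.snoc C.poissonLM

theorem isMultilin_vinBase (ϖ : Ω) (k : ℕ) (d : Fin k → ℤ) : IsMultilin (C.vinBase ϖ k d) := by
  match k with
  | 0 => exact isMultilin_const 0
  | 1 =>
    exact (isMultilin_one (LinearMap.inr ℝ 𝔤 Ω ∘ₗ C.d ∘ₗ LinearMap.snd ℝ 𝔤 Ω)).ite_zero (d 0 = 0)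
  | k + 2 => exact ((C.isMultilin_nested ϖ k).ite _).smul _

theorem isMultilin_iterContr (k : ℕ) (ϖ : Ω) :
    IsMultilin fun e : Fin k → 𝔤 × Ω => C.iterContr k (fun i => (e i).1) ϖ := by
  induction k with
  | zero => exact isMultilin_const ϖ
  | succ k ih => exact ih.snoc (C.ρ ∘ₗ LinearMap.fst ℝ 𝔤 Ω).flip

theorem isMultilin_iterContr_succ (k : ℕ) : IsMultilin fun e : Fin (k + 1) → 𝔤 × Ω =>
    C.iterContr k (fun i => (e i.succ).1) (e 0).2 := by
  induction k with
  | zero => exact isMultilin_one (LinearMap.snd ℝ 𝔤 Ω)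
  | succ k ih => exact ih.snoc (C.ρ ∘ₗ LinearMap.fst ℝ 𝔤 Ω).flip

theorem isMultilin_obsBase (ϖ : Ω) (k : ℕ) (d : Fin k → ℤ) : IsMultilin (C.obsBase ϖ k d) := by
  match k with
  | 0 => exact isMultilin_const 0
  | 1 => exact (isMultilin_one (C.d ∘ₗ LinearMap.snd ℝ 𝔤 Ω)).ite_zero (d 0 = 0)
  | k + 2 => exact (C.isMultilin_iterContr (k + 2) ϖ).smul _

theorem isMultilin_morBase (k : ℕ) (d : Fin k → ℤ) : IsMultilin (C.morBase k d) := by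
  match k with
  | 0 => exact isMultilin_const 0
  | 1 => exact isMultilin_one LinearMap.id
  | k + 2 => exact ((C.isMultilin_iterContr_succ (k + 1)).smul _).linear (LinearMap.inr ℝ 𝔤 Ω)

theorem nested_fst (ϖ : Ω) {k : ℕ} {e : Fin (k + 2) → 𝔤 × Ω} {a : Fin (k + 2)}
    (ha : (e a).1 = 0) : (C.nested ϖ k e).1 = 0 := by
  cases k with
  | zero =>
    change C.br (e 0).1 (e 1).1 = 0
    match a with
    | 0 => rw [ha]; simp
    | 1 => rw [ha]; simp
  | succ k => rfl

theorem poisson_eq_zero {e f : 𝔤 × Ω} (he : e.1 = 0) (hf : f.1 = 0) : C.poisson e f = 0 := by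
  simp [poisson, he, hf]

theorem poisson_zero (f : 𝔤 × Ω) : C.poisson 0 f = 0 := by
  simp [poisson]

/-- A nested bracket vanishes if two of its arguments have no vector part. -/
theorem nested_eq_zero (ϖ : Ω) {k : ℕ} {e : Fin (k + 2) → 𝔤 × Ω} {a b : Fin (k + 2)}
    (hab : a < b) (ha : (e a).1 = 0) (hb : (e b).1 = 0) : C.nested ϖ k e = 0 := by
  induction k with
  | zero =>
    have h1 : (a : ℕ) < b := hab
    have h2 := b.isLt
    obtain rfl : a = 0 := Fin.ext (by rw [Fin.val_zero]; omega)
    obtain rfl : b = 1 := Fin.ext (by rw [Fin.val_one]; omega)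
    simp [nested, dorfman, ha, hb]
  | succ k ih =>
    rw [nested]
    induction b using Fin.lastCases with
    | last =>
      induction a using Fin.lastCases with
      | last => exact absurd hab (lt_irrefl _)
      | cast a => exact C.poisson_eq_zero (C.nested_fst ϖ (a := a) ha) hb
    | cast b =>
      induction a using Fin.lastCases with
      | last => exact absurd hab (Fin.castSucc_lt_last b).not_gt
      | cast a => rw [ih (e := Fin.init e) (a := a) (b := b) hab ha hb, poisson_zero]

theorem vinBase_eq_zero (ϖ : Ω) {k : ℕ} {d : Fin k → ℤ} {e : Fin k → 𝔤 × Ω} {a b : Fin k}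
    (hab : a ≠ b) (ha : (e a).1 = 0) (hb : (e b).1 = 0) : C.vinBase ϖ k d e = 0 := by
  match k with
  | 0 => rfl
  | 1 => exact absurd (Subsingleton.elim a b) hab
  | k + 2 =>
    have : C.nested ϖ k e = 0 := by
      rcases lt_or_gt_of_ne hab with h | h
      · exact C.nested_eq_zero ϖ h ha hb
      · exact C.nested_eq_zero ϖ h hb ha
    simp [vinBase, this]

theorem vinBase_fst (ϖ : Ω) {k : ℕ} {d : Fin k → ℤ} {e : Fin k → 𝔤 × Ω} {a : Fin k}
    (ha : (e a).1 = 0) : (C.vinBase ϖ k d e).1 = 0 := by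
  match k with
  | 0 => rfl
  | 1 =>
    simp only [vinBase]
    split_ifs <;> rfl
  | k + 2 =>
    simp only [vinBase, Prod.smul_fst]
    split_ifs
    · rw [C.nested_fst ϖ ha, smul_zero]
    · exact smul_zero _

theorem symmetrize_vinBase_eq_zero (ϖ : Ω) {k : ℕ} (d : Fin k → ℤ) (e : Fin k → 𝔤 × Ω)
    {a b : Fin k} (hab : a ≠ b) (ha : (e a).1 = 0) (hb : (e b).1 = 0) :
    symmetrize (C.vinBase ϖ) k d e = 0 :=
  Finset.sum_eq_zero fun σ _ => by
    rw [C.vinBase_eq_zero ϖ (a := σ.symm a) (b := σ.symm b) (by simpa using hab) (by simpa)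
      (by simpa), smul_zero]

theorem symmetrize_vinBase_fst (ϖ : Ω) {k : ℕ} (d : Fin k → ℤ) (e : Fin k → 𝔤 × Ω)
    {a : Fin k} (ha : (e a).1 = 0) : (symmetrize (C.vinBase ϖ) k d e).1 = 0 := by
  rw [symmetrize, Prod.fst_sum]
  refine Finset.sum_eq_zero fun σ _ => ?_
  rw [Prod.smul_fst, C.vinBase_fst ϖ (a := σ.symm a) (by simpa), smul_zero]

variable {m : ℕ} {d : Fin m → ℤ} {e : Fin m → 𝔤 × Ω} {c : ℤ}

/-- The form part of a sum over unshuffles, from a derivative of an expression in the generic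
element. -/
theorem insertSum_snd {F : GradedFamily (𝔤 × Ω) (𝔤 × Ω)} (hF : ∀ k d, IsMultilin (F k d))
    {u : Finset (Fin m) → 𝔤 × Ω} (hu : u ∅ = 0)
    {Φ : Finset (Fin m) → Finset (Fin (m + 1)) → Ω} {φ ψ : Finset (Fin m) → Ω}
    (hΦ : ∀ S T, (T : Finset (Fin (m + 1))).Nonempty →
      (onSubtuples (consDeg d c S) F (Fin.cons (u S) e) T).2 = Φ S T)
    (h : IsInsertion d Φ φ ψ) : (insertSum d F c u e).2 = ψ Finset.univ := by
  rw [insertSum_eq_comb d F (fun k δ y => (hF _ δ).map_zero (i := 0) rfl) c hu, ← h.right]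
  simp only [comb_apply, Prod.snd_sum, Prod.smul_snd]
  refine Finset.sum_congr rfl fun S _ => ?_
  congr 1
  exact hΦ S _ (Finset.insert_nonempty _ _)

/-- The vector part of a sum over unshuffles, from a derivative of an expression in the generic
element. -/
theorem insertSum_fst {F : GradedFamily (𝔤 × Ω) (𝔤 × Ω)} (hF : ∀ k d, IsMultilin (F k d))
    {u : Finset (Fin m) → 𝔤 × Ω} (hu : u ∅ = 0)
    {Φ : Finset (Fin m) → Finset (Fin (m + 1)) → 𝔤} {φ ψ : Finset (Fin m) → 𝔤}
    (hΦ : ∀ S T, (T : Finset (Fin (m + 1))).Nonempty →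
      (onSubtuples (consDeg d c S) F (Fin.cons (u S) e) T).1 = Φ S T)
    (h : IsInsertion d Φ φ ψ) : (insertSum d F c u e).1 = ψ Finset.univ := by
  rw [insertSum_eq_comb d F (fun k δ y => (hF _ δ).map_zero (i := 0) rfl) c hu, ← h.right]
  simp only [comb_apply, Prod.fst_sum, Prod.smul_fst]
  refine Finset.sum_congr rfl fun S _ => ?_
  congr 1
  exact hΦ S _ (Finset.insert_nonempty _ _)

theorem insertSum_congr {V W : Type*} [AddCommGroup W] [Module ℝ W] (F : GradedFamily V W)
    {u u' : Finset (Fin m) → V} (h : ∀ S : Finset (Fin m), S.Nonempty → u S = u' S)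
    (x : Fin m → V) : insertSum d F c u x = insertSum d F c u' x := by
  refine Finset.sum_congr rfl fun S hS => ?_
  rw [h S (Finset.mem_filter.mp hS).2]

theorem IsHomTuple.vinForm_empty (h : C.IsHomTuple d e) (ϖ : Ω) : C.vinForm d e ϖ ∅ = 0 :=
  h.vinForm_mem_degLE C ϖ ∅ (by simp [degSum])

theorem IsHomTuple.obsForm_empty (h : C.IsHomTuple d e) (ϖ : Ω) : C.obsForm d e ϖ ∅ = 0 :=
  h.obsForm_mem_degLE C ϖ ∅ (by simp [degSum])

theorem IsHomTuple.morForm_empty (h : C.IsHomTuple d e) : C.morForm d e ∅ = 0 :=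
  h.morForm_mem_degLE C ∅ (by simp [degSum])

theorem onSubtuples_vinBase (h : C.IsHomTuple d e) (ϖ : Ω) {S : Finset (Fin m)}
    (hS : S.Nonempty) : onSubtuples d (symmetrize (C.vinBase ϖ)) e S
      = (C.vecCurv d (fun i => (e i).1) S, C.vinForm d e ϖ S) :=
  Prod.ext (C.onSubtuples_vinBase_fst h ϖ hS) (C.onSubtuples_vinBase_snd h ϖ hS)

/-- The structure given by the nested brackets squares to zero. -/
theorem insertSum_vinBase (h : C.IsHomTuple d e) {ϖ : Ω} (hϖ : ϖ ∈ C.gr 1) (hdϖ : C.d ϖ = 0) :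
    insertSum d (symmetrize (C.vinBase ϖ)) 1 (onSubtuples d (symmetrize (C.vinBase ϖ)) e) e
      = 0 := by
  have hF := IsMultilin.symmetrize (C.isMultilin_vinBase ϖ)
  -- The empty set does not occur among the unshuffles, but it does in `IsInsertion`.
  have hu : (C.vecCurv d (fun i => (e i).1) ∅, C.vinForm d e ϖ ∅) = 0 := by
    rw [h.vinForm_empty, vecCurv_empty, Prod.mk_zero_zero]
  rw [insertSum_congr (symmetrize (C.vinBase ϖ)) (fun S hS => C.onSubtuples_vinBase h ϖ hS)]
  refine Prod.ext ?_ ?_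
  · refine insertSum_fst hF hu (fun S T hT => ?_) (C.isInsertion_vecCurv_self h.vec)
    rw [onSubtuples_vinBase_fst C (h.cons_vinForm C hϖ S) ϖ hT, fst_cons]
  · refine insertSum_snd hF hu (fun S T hT => ?_) (C.isInsertion_vinForm_self h hϖ hdϖ)
    rw [onSubtuples_vinBase_snd C (h.cons_vinForm C hϖ S) ϖ hT]

/-- The structure given by the contractions of `ϖ` squares to zero. -/
theorem insertSum_obsBase (h : C.IsHomTuple d e) {ϖ : Ω} (hϖ : ϖ ∈ C.gr 1) (hdϖ : C.d ϖ = 0)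
    (hLϖ : C.lieOp d (fun i => (e i).1) (constCoeff ϖ) = 0) :
    insertSum d (symmetrize (C.obsBase ϖ)) 1
      (fun S => (C.vecCurv d (fun i => (e i).1) S, C.obsForm d e ϖ S)) e = 0 := by
  have hF := IsMultilin.symmetrize (C.isMultilin_obsBase ϖ)
  have hu : (C.vecCurv d (fun i => (e i).1) ∅, C.obsForm d e ϖ ∅) = 0 := by
    rw [h.obsForm_empty, vecCurv_empty, Prod.mk_zero_zero]
  have key := C.isInsertion_obsForm_self h hϖ hdϖ hLϖ
  rw [insertSum_eq_comb d (symmetrize (C.obsBase ϖ))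
    (fun k δ y => (hF _ δ).map_zero (i := 0) rfl) 1 hu]
  refine Eq.trans ?_ (congrFun key.right (Finset.univ : Finset (Fin m)))
  simp only [comb_apply]
  refine Finset.sum_congr rfl fun S _ => ?_
  congr 1
  exact onSubtuples_obsBase C ϖ (Finset.insert_nonempty _ _)

/-- Only the linear component of the morphism has a vector part. -/
theorem insertSum_morBase_fst (u : Finset (Fin m) → 𝔤 × Ω) (hm : 1 ≤ m) :
    (insertSum d (symmetrize C.morBase) 1 u e).1 = (u Finset.univ).1 := by
  have hne : (Finset.univ : Finset (Fin m)).Nonempty := ⟨⟨0, hm⟩, Finset.mem_univ _⟩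
  rw [insertSum, Prod.fst_sum, Finset.sum_eq_single Finset.univ]
  · obtain ⟨T, hT⟩ : ∃ T, T = (Finset.univ : Finset (Fin m))ᶜ := ⟨_, rfl⟩
    rw [← hT]
    have hT0 : T = ∅ := by rw [hT, Finset.compl_univ]
    subst hT0
    rw [mergeSign_empty_right, one_smul]
    have h1 := onSubtuples_insert_upSet d (symmetrize C.morBase) e (degSum d Finset.univ + 1 + 1)
      (u Finset.univ) ∅
    rw [show (insert 0 (upSet (∅ : Finset (Fin m)))) = {0} by simp [upSet],
      onSubtuples_singleton] at h1
    rw [← h1]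
    simp [symmetrize, morBase, koszulSign]
  · intro S _ hS
    have : Sᶜ.card ≠ 0 := by
      rw [Ne, Finset.card_eq_zero, Finset.compl_eq_empty_iff]
      exact hS
    have h1 := onSubtuples_insert_upSet d (symmetrize C.morBase) e (degSum d S + 1 + 1)
      (u S) Sᶜ
    rw [Prod.smul_fst, ← h1, onSubtuples_morBase_fst, smul_zero]
    rw [Finset.card_insert_of_notMem (zero_notMem_upSet _), Finset.card_map]
    omega
  · intro hn
    exact absurd (Finset.mem_filter.mpr ⟨Finset.mem_univ _, hne⟩) hn

theorem onSubtuples_morBase_singleton (i : Fin m) :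
    onSubtuples d (symmetrize C.morBase) e {i} = e i := by
  rw [onSubtuples_singleton]
  simp [symmetrize, morBase, koszulSign]

/-- The compatibility of the morphism with the two structures. -/
theorem insertSum_morBase (h : C.IsHomTuple d e) {ϖ : Ω} (hm : 1 ≤ m)
    (hham : C.diff (degProj d (-1) (generic d fun i => (e i).2))
      = -C.contr d (fun i => (e i).1) (constCoeff ϖ)) :
    insertSum d (symmetrize C.morBase) 1
        (fun S => (C.vecCurv d (fun i => (e i).1) S, C.obsForm d e ϖ S)) e
      = partitionSum (symmetrize (C.vinBase ϖ)) (symmetrize C.morBase) d e := by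
  have hne : (Finset.univ : Finset (Fin m)).Nonempty := ⟨⟨0, hm⟩, Finset.mem_univ _⟩
  have hV := IsMultilin.symmetrize (C.isMultilin_vinBase ϖ)
  have hu : (C.vecCurv d (fun i => (e i).1) ∅, C.obsForm d e ϖ ∅) = 0 := by
    rw [h.obsForm_empty, vecCurv_empty, Prod.mk_zero_zero]
  have hφ := cardSupp_generic d fun i => (e i).2
  -- The sum of the components of the morphism with at least two arguments.
  set u' : Finset (Fin m) → 𝔤 × Ω :=
    fun S => (0, C.morForm d e S - generic d (fun i => (e i).2) S) with hu'
  have hu'0 : u' ∅ = 0 := by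
    rw [hu']
    simp only [h.morForm_empty, hφ ∅ (by simp), sub_zero, Prod.mk_zero_zero]
  have hu'1 : ∀ S, S.card = 1 → u' S = 0 := by
    intro S hS
    obtain ⟨i, rfl⟩ := Finset.card_eq_one.mp hS
    have h1 := C.onSubtuples_morBase_snd (d := d) (e := e) (Finset.singleton_nonempty i)
    rw [onSubtuples_morBase_singleton] at h1
    have h2 : generic d (fun i => (e i).2) {i} = (e i).2 := by
      rw [generic_apply, Finset.sum_eq_single i]
      · simp
      · intro j _ hj
        exact if_neg fun h => hj (Finset.singleton_injective h).symm
      · simp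
    rw [hu']
    simp only [← h1, h2, sub_self, Prod.mk_zero_zero]
  have hu'2 : ∀ S, 2 ≤ S.card → onSubtuples d (symmetrize C.morBase) e S = u' S := by
    intro S hS
    refine Prod.ext (C.onSubtuples_morBase_fst (by omega)) ?_
    rw [C.onSubtuples_morBase_snd (Finset.card_pos.mp (by omega)), hu']
    simp only [hφ S (by omega), sub_zero]
  have hcons : ∀ S, C.IsHomTuple (consDeg d 0 S) (Fin.cons (u' S) e) := by
    intro S
    refine h.cons C 0 S (fun _ => rfl) ?_ ?_
    · refine sub_mem ((C.mem_homSub d).mp (h.morForm_mem_homSub C) S) ?_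
      exact (C.mem_homSub d).mp (h.generic_mem_homSub C) S
    · intro h1
      have h2 := h.morForm_mem_degLE C S (by omega)
      have h3 := h.generic_mem_degLE C S (by omega)
      simp only [hu', h2, h3, sub_zero]
  -- Partitions into singletons give the structure itself, those with one larger block an insertion.
  have hpart : partitionSum (symmetrize (C.vinBase ϖ)) (symmetrize C.morBase) d e
      = symmetrize (C.vinBase ϖ) m d e + insertSum d (symmetrize (C.vinBase ϖ)) 0 u' e := by
    rw [partitionSum_symmetrize d (C.vinBase ϖ) (symmetrize C.morBase) e (fun y => y.1 = 0)
      (fun S hS => C.onSubtuples_morBase_fst (by omega))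
      (fun r δ y a b hab ha hb => C.symmetrize_vinBase_eq_zero ϖ δ y hab ha hb)]
    simp only [onSubtuples_morBase_singleton]
    congr 1
    rw [insertSum]
    refine (Finset.sum_congr rfl fun S hS => ?_).trans
      (Finset.sum_subset (s₁ := Finset.univ.filter fun S : Finset (Fin m) => 2 ≤ S.card) ?_ ?_)
    · rw [hu'2 S (Finset.mem_filter.mp hS).2, add_zero]
    · intro S hS
      rw [Finset.mem_filter] at hS ⊢
      exact ⟨hS.1, Finset.card_pos.mp (by omega)⟩
    · intro S hS hS2
      rw [Finset.mem_filter] at hS hS2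
      have h1 : S.card = 1 := by
        have := hS.2.card_pos
        by_contra hn
        exact hS2 ⟨Finset.mem_univ _, by omega⟩
      rw [hu'1 S h1, (hV _ _).map_zero (i := 0) rfl, smul_zero]
  have hfull := C.onSubtuples_vinBase h ϖ hne
  rw [onSubtuples_univ] at hfull
  rw [hpart]
  refine Prod.ext ?_ ?_
  · rw [C.insertSum_morBase_fst _ hm, Prod.fst_add, hfull, insertSum, Prod.fst_sum,
      Finset.sum_eq_zero, add_zero]
    intro S _
    rw [Prod.smul_fst, C.symmetrize_vinBase_fst ϖ _ _ (a := 0) rfl, smul_zero]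
  · rw [Prod.snd_add, hfull, insertSum_snd hV hu'0 (fun S T hT => onSubtuples_vinBase_snd C
      (hcons S) ϖ hT) (C.isInsertion_vinForm_mor h ϖ),
      insertSum_snd (IsMultilin.symmetrize C.isMultilin_morBase) hu
        (fun S T hT => onSubtuples_morBase_snd C hT) (C.isInsertion_morForm h ϖ),
      C.morForm_comm h hham]
    rfl

end CartanCalculus
/-! ### Application to differential forms -/

section KoszulSign

/-- Elements of degree zero anticommute after the shift of degrees. -/
theorem koszulSign_symm_eq_sign {k : ℕ} {d : Fin k → ℤ} (hd : ∀ i, d i = 0)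
    (σ : Equiv.Perm (Fin k)) : koszulSign d σ.symm = (Equiv.Perm.sign σ : ℤ) := by
  rw [← Equiv.Perm.sign_symm, Equiv.Perm.sign_eq_prod_prod_Ioi, koszulSign, Units.coe_prod]
  refine Finset.prod_congr rfl fun i _ => ?_
  rw [Units.coe_prod, ← Finset.prod_filter_mul_prod_filter_not Finset.univ (fun j => i < j)]
  have h1 : ∀ j, (Int.negOnePow ((d i - 1) * (d j - 1)) : ℤ) = -1 := by
    intro j
    simp [hd]
  have h2 : (Finset.univ.filter fun j => i < j) = Finset.Ioi i := by ext; simp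
  rw [h2, Finset.prod_eq_one (s := Finset.univ.filter fun j => ¬ i < j), mul_one]
  · refine Finset.prod_congr rfl fun j hj => ?_
    rw [Finset.mem_Ioi] at hj
    rw [h1]
    by_cases h : σ.symm j < σ.symm i
    · simp [hj, h, h.not_gt]
    · have h' : σ.symm i < σ.symm j :=
        lt_of_le_of_ne (not_lt.mp h) fun h => hj.ne (σ.symm.injective h)
      simp [h, h']
  · intro j hj
    exact if_neg fun h => (Finset.mem_filter.mp hj).2 h.1

end KoszulSign

section Calculus

variable {E : Type*} [NormedAddCommGroup E] [NormedSpace ℝ E] [FiniteDimensional ℝ E]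
  {M : Type*} [TopologicalSpace M] [ChartedSpace E M] [IsManifold 𝓘(ℝ, E) ∞ M]

namespace TotalForm

theorem interior_interior_swap (X Y : VecField E M) (β : TotalForm E M) :
    interior X (interior Y β) = -interior Y (interior X β) := by
  have h := interior_interior_self (X + Y) β
  simp only [interior_add_left, interior_add, interior_interior_self, zero_add, add_zero] at h
  rw [eq_neg_iff_add_eq_zero, add_comm]
  exact h

/-- The involution `(-1) ^ (n + q)` on forms of degree `q`. -/
def parityLM (n : ℕ) : Module.End ℝ (TotalForm E M) where
  toFun β q := (-1 : ℤ) ^ (n + q) • β q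
  map_add' β γ := by funext q; simp
  map_smul' c β := funext fun q => smul_comm ((-1 : ℤ) ^ (n + q)) c (β q)

theorem parityLM_apply (n : ℕ) (β : TotalForm E M) (q : ℕ) :
    parityLM n β q = (-1 : ℤ) ^ (n + q) • β q := rfl

theorem _root_.DForm.extDeriv_zsmul (c : ℤ) {k : ℕ} (α : DForm E M k) :
    (c • α).extDeriv = c • α.extDeriv :=
  map_zsmul (AddMonoidHom.mk' DForm.extDeriv DForm.extDeriv_add) c α

theorem _root_.DForm.interior_zsmul (c : ℤ) {k : ℕ} (X : VecField E M) (α : DForm E M (k + 1)) :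
    (c • α).interior X = c • α.interior X := by
  ext1 Y
  simp [DForm.interior_apply]

/-- The forms of degree `n + p`. -/
def homogeneous (n : ℕ) (p : ℤ) : Submodule ℝ (TotalForm E M) where
  carrier := {β | ∀ q : ℕ, (q : ℤ) ≠ n + p → β q = 0}
  zero_mem' _ _ := rfl
  add_mem' hβ hγ q hq := by simp [hβ q hq, hγ q hq]
  smul_mem' c β hβ q hq := by simp [hβ q hq]

variable (E M) in
/-- The Cartan calculus of differential forms. -/
def cartanCalculus (n : ℕ) : CartanCalculus (VecField E M) (TotalForm E M) where
  d := extDerivLM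
  ι := interiorLM
  br := bracketLM
  γ := parityLM n
  gr := homogeneous n
  d_d := LinearMap.ext extDeriv_extDeriv
  γ_γ := by
    refine LinearMap.ext fun β => ?_
    funext q
    rw [Module.End.mul_apply, parityLM_apply, parityLM_apply, smul_smul, ← mul_pow]
    simp
  γ_d := by
    refine LinearMap.ext fun β => ?_
    funext q
    change (-1 : ℤ) ^ (n + q) • extDeriv β q = -extDeriv (parityLM n β) q
    cases q with
    | zero => simp [extDeriv]
    | succ q =>
      rw [extDeriv, extDeriv, parityLM_apply, DForm.extDeriv_zsmul, ← add_assoc, pow_succ]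
      simp
  γ_ι X := by
    refine LinearMap.ext fun β => ?_
    funext q
    change (-1 : ℤ) ^ (n + q) • interior X β q = -interior X (parityLM n β) q
    rw [interior, interior, parityLM_apply, DForm.interior_zsmul, ← add_assoc, pow_succ]
    simp
  ι_ι X Y := LinearMap.ext fun β => interior_interior_swap X Y β
  lie_ι X Y := LinearMap.ext fun β => lieDeriv_interior X Y β
  γ_gr := by
    intro p β h
    funext q
    rw [parityLM_apply, Pi.smul_apply]
    by_cases hq : (q : ℤ) = n + p
    · congr 1
      have : p = (n + q : ℕ) - 2 * n := by push_cast; omega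
      rw [this, Int.negOnePow_sub, Int.negOnePow_even (2 * n) (even_two_mul _), mul_one,
        Int.negOnePow_def, zpow_natCast]
      simp
    · rw [h q hq, smul_zero, smul_zero]
  d_mem := by
    intro p β h q hq
    cases q with
    | zero => rfl
    | succ q =>
      change (β q).extDeriv = 0
      rw [h q (by push_cast at hq; omega)]
      have := DForm.extDeriv_zsmul 0 (0 : DForm E M q)
      simpa using this
  ι_mem := by
    intro X p β h q hq
    change (β (q + 1)).interior X = 0
    rw [h (q + 1) (by push_cast; omega)]
    rfl
  br_swap := vecField_bracket_swap
  jacobi := vecField_jacobi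

theorem contract_eq_init {k : ℕ} (X : Fin (k + 1) → VecField E M) (β : TotalForm E M) :
    contract X β = contract (Fin.init X) (interior (X (Fin.last k)) β) := by
  induction k with
  | zero => rfl
  | succ k ih =>
    rw [contract, ih, contract, Fin.tail_init_eq_init_tail]
    rfl

/-- The iterated contraction, as a representation of the exterior algebra. -/
def exteriorInterior : ExteriorAlgebra ℝ (VecField E M) →ₐ[ℝ] Module.End ℝ (TotalForm E M) :=
  ExteriorAlgebra.lift ℝ ⟨interiorLM, fun X => LinearMap.ext (interior_interior_self X)⟩

theorem contract_eq_exteriorInterior {k : ℕ} (X : Fin k → VecField E M) (β : TotalForm E M) :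
    contract X β = exteriorInterior (ExteriorAlgebra.ιMulti ℝ k X) β := by
  induction k with
  | zero => simp [contract]
  | succ k ih =>
    rw [contract, ih, ExteriorAlgebra.ιMulti_succ_apply, map_mul, Module.End.mul_apply,
      exteriorInterior, ExteriorAlgebra.lift_ι_apply]
    rfl

theorem contract_perm {k : ℕ} (X : Fin k → VecField E M) (β : TotalForm E M)
    (σ : Equiv.Perm (Fin k)) :
    contract (X ∘ σ) β = (Equiv.Perm.sign σ : ℤ) • contract X β := by
  rw [contract_eq_exteriorInterior, contract_eq_exteriorInterior, AlternatingMap.map_perm,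
    Units.smul_def, map_zsmul]
  rfl

theorem contract_eq_zero {k : ℕ} {X : Fin k → VecField E M} {i : Fin k} (h : X i = 0)
    (β : TotalForm E M) : contract X β = 0 := by
  rw [contract_eq_exteriorInterior, AlternatingMap.map_coord_zero _ i h, map_zero]
  rfl

theorem cartanCalculus_ι_apply (n : ℕ) (X : VecField E M) (β : TotalForm E M) :
    (cartanCalculus E M n).ι X β = interior X β := rfl

/-- The signs in the right contractions of an `(n + 1)`-form are absorbed by the reversal of the
order of the vector fields. -/
theorem iterContr_eq_contract {n : ℕ} {β : TotalForm E M} (hβ : β ∈ homogeneous n 1) (k : ℕ)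
    (X : Fin k → VecField E M) : (cartanCalculus E M n).iterContr k X β = contract X β := by
  induction k with
  | zero => rfl
  | succ k ih =>
    have h : ∀ (k : ℕ) (Y : Fin k → VecField E M) (Z : VecField E M) (γ : TotalForm E M),
        (cartanCalculus E M n).ρ Z (contract Y γ)
          = contract Y ((cartanCalculus E M n).ρ Z γ) := by
      intro k Y Z γ
      induction k with
      | zero => rfl
      | succ k ih =>
        rw [contract, contract, ← ih]
        exact LinearMap.congr_fun ((cartanCalculus E M n).ρ_ι Z (Y 0)) _
    rw [CartanCalculus.iterContr, ih, h, contract_eq_init]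
    congr 1
    have h1 : (cartanCalculus E M n).ρ (X (Fin.last k)) β
        = (cartanCalculus E M n).γ ((cartanCalculus E M n).ι (X (Fin.last k)) β) := rfl
    rw [h1, (cartanCalculus E M n).γ_gr ((cartanCalculus E M n).ι_mem _ hβ)]
    simp [cartanCalculus_ι_apply]

end TotalForm

variable {n : ℕ} (ϖ : DForm E M (n + 1))

theorem of_mem_homogeneous : TotalForm.of ϖ ∈ TotalForm.homogeneous n 1 := by
  intro q hq
  have : q ≠ n + 1 := by rintro rfl; simp at hq
  exact Pi.single_eq_of_ne this ϖ

theorem extDeriv_of (h : ϖ.extDeriv = 0) : TotalForm.extDeriv (TotalForm.of ϖ) = 0 := by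
  funext k
  cases k with
  | zero => rfl
  | succ k =>
    change (TotalForm.of ϖ k).extDeriv = 0
    by_cases hk : k = n + 1
    · subst hk
      rw [TotalForm.of, Pi.single_eq_same, h]
    · rw [TotalForm.of, Pi.single_eq_of_ne hk]
      have := DForm.extDeriv_zsmul 0 (0 : DForm E M k)
      simpa using this

/-- The nested brackets of the Vinogradov algebroid are those of the Cartan calculus of forms. -/
theorem nestedBracket_eq (k : ℕ) (e : Fin (k + 2) → VinSpace E M) : nestedBracket ϖ k e
    = (TotalForm.cartanCalculus E M n).nested (TotalForm.of ϖ) k e := by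
  induction k with
  | zero => rfl
  | succ k ih =>
    rw [nestedBracket, ih]
    rfl

/-- The signs in the definition of the products and in the passage from products to codifferentials
cancel. -/
theorem productSign_mul_vin (k : ℕ) : (productSign (k + 2) : ℝ)
    * (-1) ^ ((k + 2) + (k + 2) * (k + 3) / 2) = -1 := by
  rw [productSign, if_neg (by omega), show k + 2 - 1 = k + 1 by omega]
  have h1 : (k + 2) * (k + 1) / 2 + ((k + 2) + (k + 2) * (k + 3) / 2)
      = (k + 2) * (k + 3) := by
    have h2 : 2 ∣ (k + 2) * (k + 1) := by
      rw [mul_comm]; exact (Nat.even_mul_succ_self (k + 1)).two_dvd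
    have h3 : 2 ∣ (k + 2) * (k + 3) := (Nat.even_mul_succ_self (k + 2)).two_dvd
    obtain ⟨a, ha⟩ := h2
    obtain ⟨b, hb⟩ := h3
    rw [ha, hb]
    simp only [Nat.mul_div_cancel_left _ (show 0 < 2 by norm_num)]
    nlinarith
  push_cast
  rw [neg_mul, ← pow_add, h1, (Nat.even_mul_succ_self (k + 2)).neg_one_pow]

/-- The sign of the codifferential of the local observables, which is that of the coefficients of
`obsSeries`. -/
theorem productSign_mul_obs (k : ℕ) :
    productSign (k + 2) * (-1) ^ ((k + 3).choose 2) = (-1) ^ (k + 3) := by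
  rw [productSign, if_neg (by omega), neg_mul, ← pow_add]
  have h1 : (k + 2) * (k + 2 - 1) / 2 + (k + 3).choose 2 = (k + 2) * (k + 1) + (k + 2) := by
    have h2 : 2 ∣ (k + 2) * (k + 1) := by
      rw [mul_comm]; exact (Nat.even_mul_succ_self (k + 1)).two_dvd
    have h3 : 2 ∣ (k + 3) * (k + 2) := by
      rw [mul_comm]; exact (Nat.even_mul_succ_self (k + 2)).two_dvd
    obtain ⟨a, ha⟩ := h2
    obtain ⟨b, hb⟩ := h3
    rw [Nat.choose_two_right, show k + 2 - 1 = k + 1 by omega, show k + 3 - 1 = k + 2 by omega,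
      ha, hb]
    simp only [Nat.mul_div_cancel_left _ (show 0 < 2 by norm_num)]
    nlinarith
  have h2 : Even ((k + 2) * (k + 1)) := by
    rw [mul_comm]; exact Nat.even_mul_succ_self (k + 1)
  rw [h1, pow_add, h2.neg_one_pow, one_mul, pow_succ _ (k + 2)]
  ring

/-- The codifferential of the twisted Vinogradov algebroid as a symmetrization. -/
theorem codifferential_vinProduct : codifferential (vinProduct ϖ)
    = symmetrize ((TotalForm.cartanCalculus E M n).vinBase (TotalForm.of ϖ)) := by
  funext k d e
  match k with
  | 0 => simp [codifferential, vinProduct, symmetrize, CartanCalculus.vinBase]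
  | 1 =>
    simp [codifferential, vinProduct, symmetrize, CartanCalculus.vinBase, productSign, koszulSign]
    rfl
  | k + 2 =>
    rw [codifferential, vinProduct, symmetrize, ← Int.cast_smul_eq_zsmul ℝ, smul_smul,
      Finset.smul_sum]
    refine Finset.sum_congr rfl fun σ _ => ?_
    rw [smul_comm]
    congr 1
    rw [CartanCalculus.vinBase, coeff_bernSeries, nestedBracket_eq]
    congr 1
    rw [← mul_assoc, mul_div_assoc', productSign_mul_vin]
    ring

/-- A homogeneous form, together with its Hamiltonian vector field if it has degree zero. -/
def hamPair (d : ℤ) (α : TotalForm E M) : VinSpace E M :=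
  (if d = 0 then hamVecField ϖ α else 0, α)

/-- The codifferential of the local observables as a symmetrization. -/
theorem codifferential_obsProduct (k : ℕ) (d : Fin k → ℤ) (x : Fin k → TotalForm E M) :
    codifferential (obsProduct ϖ) k d x
      = symmetrize ((TotalForm.cartanCalculus E M n).obsBase (TotalForm.of ϖ)) k d
        (fun i => hamPair ϖ (d i) (x i)) := by
  match k with
  | 0 => simp [codifferential, obsProduct, symmetrize, CartanCalculus.obsBase]
  | 1 =>
    simp [codifferential, obsProduct, symmetrize, CartanCalculus.obsBase, productSign, koszulSign]
    rfl
  | k + 2 =>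
    simp only [codifferential, obsProduct, symmetrize, CartanCalculus.obsBase,
      TotalForm.iterContr_eq_contract (of_mem_homogeneous ϖ), coeff_obsSeries]
    split_ifs with hd
    · have e : ∀ σ : Equiv.Perm (Fin (k + 2)), koszulSign d σ.symm •
          ((-1 : ℝ) ^ (k + 3) / ((k + 2).factorial : ℝ)) • TotalForm.contract
            (fun i => (((fun i => hamPair ϖ (d i) (x i)) ∘ σ) i).1) (TotalForm.of ϖ)
          = ((-1 : ℝ) ^ (k + 3) / ((k + 2).factorial : ℝ)) • TotalForm.contract
            (fun i => hamVecField ϖ (x i)) (TotalForm.of ϖ) := by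
        intro σ
        rw [koszulSign_symm_eq_sign hd, smul_comm]
        congr 1
        have h1 : (fun i => (((fun i => hamPair ϖ (d i) (x i)) ∘ σ) i).1)
            = (fun i => hamVecField ϖ (x i)) ∘ σ := by
          funext i
          simp [hamPair, hd]
        rw [h1, TotalForm.contract_perm, smul_smul, ← Units.val_mul, Int.units_mul_self,
          Units.val_one, one_smul]
      rw [Finset.sum_congr rfl fun σ _ => e σ, Finset.sum_const, Finset.card_univ,
        Fintype.card_perm, Fintype.card_fin, smul_smul, productSign_mul_obs,
        ← Nat.cast_smul_eq_nsmul ℝ, smul_smul, mul_div_cancel₀ _ (by positivity),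
        ← Int.cast_smul_eq_zsmul ℝ]
      push_cast
      rfl
    · rw [not_forall] at hd
      obtain ⟨i, hi⟩ := hd
      rw [smul_zero, Finset.sum_eq_zero]
      intro σ _
      rw [TotalForm.contract_eq_zero (i := σ.symm i) (by simp [hamPair, hi]), smul_zero, smul_zero]

end Calculus
/-! ### The Lie `n`-algebras and the isomorphism -/

namespace CartanCalculus

variable {𝔤 Ω : Type*} [AddCommGroup 𝔤] [Module ℝ 𝔤] [AddCommGroup Ω] [Module ℝ Ω]
  (C : CartanCalculus 𝔤 Ω) {m : ℕ} {d : Fin m → ℤ} {e : Fin m → 𝔤 × Ω}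

/-- The Hamiltonian condition, in terms of the generic element. -/
theorem IsHomTuple.diff_generic_of_hamiltonian (h : C.IsHomTuple d e) {ϖ : Ω} (hϖ : ϖ ∈ C.gr 1)
    (hham : ∀ i, d i = 0 → C.d (e i).2 = -C.ι (e i).1 ϖ) :
    C.diff (degProj d (-1) (generic d fun i => (e i).2))
      = -C.contr d (fun i => (e i).1) (constCoeff ϖ) := by
  rw [degProj_generic, contr, LinearMap.sum_apply, diff, map_sum, ← Finset.sum_neg_distrib]
  refine Finset.sum_congr rfl fun i _ => ?_
  rw [Module.End.mul_apply, ← theta_ptwise, ptwise_constCoeff, ptwise_constCoeff]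
  change _ = -theta d i _
  rw [← map_neg, ← map_neg]
  congr 2
  have hρ : C.ρ (e i).1 ϖ = C.γ (C.ι (e i).1 ϖ) := rfl
  rw [hρ, C.γ_gr (C.ι_mem _ hϖ)]
  by_cases hi : d i = 0
  · simp [hi, hham i hi]
  · rw [if_neg (by omega), h.vec i hi]
    simp

/-- Hamiltonian vector fields preserve `ϖ`. -/
theorem lieOp_constCoeff_of_hamiltonian {ϖ : Ω} (hdϖ : C.d ϖ = 0)
    (hham : C.diff (degProj d (-1) (generic d fun i => (e i).2))
      = -C.contr d (fun i => (e i).1) (constCoeff ϖ)) :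
    C.lieOp d (fun i => (e i).1) (constCoeff ϖ) = 0 := by
  have h1 := C.diff_contr_apply (X := fun i => (e i).1) (d := d) (constCoeff ϖ)
  rw [C.diff_constCoeff hdϖ, map_zero, zero_sub] at h1
  rw [← neg_eq_zero, ← h1, ← neg_eq_zero, ← map_neg, ← hham, diff_diff_apply]

end CartanCalculus

section GradedSymmetric

variable {V V' W : Type*} [AddCommGroup V] [Module ℝ V] [AddCommGroup V'] [Module ℝ V']
  [AddCommGroup W] [Module ℝ W]

/-- The symmetrization of multilinear maps, composed with maps `J d` which are linear on the
elements of degree `d`, is a graded symmetric family. For the local observables, `J` is the map to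
Hamiltonian pairs, which is linear on Hamiltonian forms only. -/
theorem isGradedSymmetric_symmetrize {L : ℤ → Submodule ℝ V} {L' : ℤ → Submodule ℝ W} {s : ℤ}
    {f : GradedFamily V' W} (hf : ∀ k d, IsMultilin (f k d)) (J : ℤ → V → V')
    (hadd : ∀ d, ∀ u ∈ L d, ∀ v ∈ L d, J d (u + v) = J d u + J d v)
    (hsmul : ∀ d (c : ℝ), ∀ u ∈ L d, J d (c • u) = c • J d u)
    (hmem : ∀ k, 1 ≤ k → ∀ (d : Fin k → ℤ) (x : Fin k → V), (∀ i, x i ∈ L (d i)) →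
      symmetrize f k d (fun i => J (d i) (x i)) ∈ L' (∑ i, (d i - 1) + s + 1)) :
    IsGradedSymmetric L L' s fun k d x => symmetrize f k d fun i => J (d i) (x i) := by
  have hF := IsMultilin.symmetrize hf
  have hup : ∀ (k : ℕ) (d : Fin k → ℤ) (x : Fin k → V) (i : Fin k) (u : V),
      (fun j => J (d j) (Function.update x i u j))
        = Function.update (fun j => J (d j) (x j)) i (J (d i) u) := by
    intro k d x i u
    funext j
    by_cases h : j = i
    · subst h; simp
    · simp [h]
  refine ⟨hmem, ?_, ?_, ?_⟩
  · intro k _ d x _ i u v hu hv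
    simp only [hup, hadd _ u hu v hv]
    exact (hF k d).map_update_add _ _ _ _
  · intro k _ d x _ i c u hu
    simp only [hup, hsmul _ c u hu]
    exact (hF k d).map_update_smul _ _ _ _
  · intro k _ d x _ σ
    exact symmetrize_perm f d (fun i => J (d i) (x i)) σ

end GradedSymmetric

section Theorem

variable {E : Type*} [NormedAddCommGroup E] [NormedSpace ℝ E] [FiniteDimensional ℝ E]
  {M : Type*} [TopologicalSpace M] [ChartedSpace E M] [IsManifold 𝓘(ℝ, E) ∞ M]
  {n : ℕ} {ϖ : DForm E M (n + 1)}

open TotalForm CartanCalculus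

/-- A Hamiltonian vector field is unique, by nondegeneracy. -/
theorem IsNPlectic.hamiltonian_unique (hϖ : IsNPlectic ϖ) {X Y : VecField E M}
    {α : TotalForm E M} (hX : IsHamiltonianPair ϖ X α) (hY : IsHamiltonianPair ϖ Y α) : X = Y := by
  have h1 : interior X (of ϖ) = interior Y (of ϖ) := neg_injective (hX.symm.trans hY)
  have h2 : interior (X - Y) (of ϖ) = 0 := by
    have := LinearMap.congr_fun (map_sub interiorLM X Y) (of ϖ)
    refine this.trans ?_
    rw [LinearMap.sub_apply, interiorLM_apply, interiorLM_apply, h1, sub_self]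
  refine sub_eq_zero.mp (hϖ.nondegenerate _ ?_)
  have h3 := congrFun h2 n
  simpa [TotalForm.interior, of] using h3

theorem isHamiltonianPair_hamVecField {α : TotalForm E M} (h : ∃ X, IsHamiltonianPair ϖ X α) :
    IsHamiltonianPair ϖ (hamVecField ϖ α) α := by
  rw [hamVecField, dif_pos h]
  exact h.choose_spec

theorem IsNPlectic.hamVecField_eq (hϖ : IsNPlectic ϖ) {X : VecField E M} {α : TotalForm E M}
    (h : IsHamiltonianPair ϖ X α) : hamVecField ϖ α = X :=
  hϖ.hamiltonian_unique (isHamiltonianPair_hamVecField ⟨X, h⟩) h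

theorem IsHamiltonianPair.add {X Y : VecField E M} {α β : TotalForm E M}
    (hX : IsHamiltonianPair ϖ X α) (hY : IsHamiltonianPair ϖ Y β) :
    IsHamiltonianPair ϖ (X + Y) (α + β) := by
  rw [IsHamiltonianPair] at *
  rw [TotalForm.extDeriv_add, interior_add_left, hX, hY, neg_add]

theorem IsHamiltonianPair.smul {X : VecField E M} {α : TotalForm E M}
    (hX : IsHamiltonianPair ϖ X α) (c : ℝ) : IsHamiltonianPair ϖ (c • X) (c • α) := by
  rw [IsHamiltonianPair] at *
  rw [TotalForm.extDeriv_smul, interior_smul_left, hX, smul_neg]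

theorem formGrading_le_homogeneous (n : ℕ) (d : ℤ) :
    (formGrading n d : Submodule ℝ (TotalForm E M)) ≤ homogeneous n (d - 1) :=
  fun _ h q hq => h q (Or.inr fun h1 => hq (by omega))

theorem mem_formGrading_of_homogeneous {d p : ℤ} {β : TotalForm E M} (h : β ∈ homogeneous n p)
    (hp : p + 1 = d) (h0 : 0 < d → β = 0) : β ∈ formGrading n d := by
  intro q hq
  rcases hq with hq | hq
  · rw [h0 hq]; rfl
  · exact h q (by omega)

theorem obsGrading_le (d : ℤ) : obsGrading ϖ d ≤ formGrading n d := by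
  rw [obsGrading]
  split_ifs with h
  · subst h
    exact fun _ hα => hα.1
  · exact le_rfl

theorem diagGrading_le (d : ℤ) : diagGrading ϖ d ≤ vinGrading n d := by
  rw [diagGrading]
  split_ifs with h
  · subst h
    exact fun e he => ⟨fun h => absurd rfl h, he.1⟩
  · exact le_rfl

theorem isHomTuple_of_mem_vinGrading {m : ℕ} {d : Fin m → ℤ} {e : Fin m → VinSpace E M}
    (h : ∀ i, e i ∈ vinGrading n (d i)) : (cartanCalculus E M n).IsHomTuple d e where
  vec i := (h i).1
  form i := formGrading_le_homogeneous n _ (h i).2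
  nonpos i hi := funext fun q => (h i).2 q (Or.inl hi)

theorem hamPair_mem (d : ℤ) {α : TotalForm E M} (h : α ∈ obsGrading ϖ d) :
    hamPair ϖ d α ∈ diagGrading ϖ d := by
  rw [diagGrading]
  rw [obsGrading] at h
  split_ifs at h ⊢ with hd
  · subst hd
    refine ⟨h.1, ?_⟩
    rw [hamPair, if_pos rfl]
    exact isHamiltonianPair_hamVecField h.2
  · refine ⟨fun _ => ?_, h⟩
    rw [hamPair, if_neg hd]

theorem IsNPlectic.hamPair_add (hϖ : IsNPlectic ϖ) (d : ℤ) {α β : TotalForm E M}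
    (hα : α ∈ obsGrading ϖ d) (hβ : β ∈ obsGrading ϖ d) :
    hamPair ϖ d (α + β) = hamPair ϖ d α + hamPair ϖ d β := by
  by_cases hd : d = 0
  · rw [obsGrading, if_pos hd] at hα hβ
    simp only [hamPair, if_pos hd, Prod.mk_add_mk]
    rw [hϖ.hamVecField_eq ((isHamiltonianPair_hamVecField hα.2).add
      (isHamiltonianPair_hamVecField hβ.2))]
  · simp [hamPair, hd]

theorem IsNPlectic.hamPair_smul (hϖ : IsNPlectic ϖ) (d : ℤ) (c : ℝ) {α : TotalForm E M}
    (hα : α ∈ obsGrading ϖ d) : hamPair ϖ d (c • α) = c • hamPair ϖ d α := by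
  by_cases hd : d = 0
  · rw [obsGrading, if_pos hd] at hα
    simp only [hamPair, if_pos hd, Prod.smul_mk]
    rw [hϖ.hamVecField_eq ((isHamiltonianPair_hamVecField hα.2).smul c)]
  · simp [hamPair, hd]

theorem IsNPlectic.d_of (hϖ : IsNPlectic ϖ) : (cartanCalculus E M n).d (of ϖ) = 0 :=
  extDeriv_of ϖ hϖ.closed

/-- The Hamiltonian condition for diagonal sections, in terms of the generic element. -/
theorem diff_generic_of_mem_diagGrading {m : ℕ} {d : Fin m → ℤ} {e : Fin m → VinSpace E M}
    (h : ∀ i, e i ∈ diagGrading ϖ (d i)) :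
    (cartanCalculus E M n).diff (degProj d (-1) (generic d fun i => (e i).2))
      = -(cartanCalculus E M n).contr d (fun i => (e i).1) (constCoeff (of ϖ)) := by
  refine (isHomTuple_of_mem_vinGrading fun i => diagGrading_le _ (h i)).diff_generic_of_hamiltonian
    (cartanCalculus E M n) (of_mem_homogeneous ϖ) fun i hi => ?_
  have h1 := h i
  rw [diagGrading, if_pos hi] at h1
  exact h1.2

/-- The values of the structure on the Vinogradov algebroid are sections of the right degree. -/
theorem symmetrize_vinBase_mem {m : ℕ} (hm : 1 ≤ m) {d : Fin m → ℤ} {e : Fin m → VinSpace E M}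
    (h : ∀ i, e i ∈ vinGrading n (d i)) :
    symmetrize ((cartanCalculus E M n).vinBase (of ϖ)) m d e
      ∈ vinGrading n (∑ i, (d i - 1) + 2) := by
  have hne : (Finset.univ : Finset (Fin m)).Nonempty := ⟨⟨0, hm⟩, Finset.mem_univ _⟩
  have he := isHomTuple_of_mem_vinGrading h
  have hsum : degSum d Finset.univ = ∑ i, (d i - 1) := rfl
  rw [← onSubtuples_univ d (symmetrize _) e, onSubtuples_vinBase _ he _ hne]
  refine ⟨fun h0 => vecCurv_apply_eq_zero _ he.vec (by omega), ?_⟩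
  refine mem_formGrading_of_homogeneous
    (((cartanCalculus E M n).mem_homSub d).mp
      (he.vinForm_mem_homSub _ (of_mem_homogeneous ϖ)) Finset.univ) (by omega) fun h0 => ?_
  exact he.vinForm_mem_degLE _ (of ϖ) Finset.univ (by omega)

/-- The diagonal sections are closed under the higher products. -/
theorem IsNPlectic.symmetrize_vinBase_mem_diagGrading (hϖ : IsNPlectic ϖ) {m : ℕ} (hm : 1 ≤ m)
    {d : Fin m → ℤ} {e : Fin m → VinSpace E M} (h : ∀ i, e i ∈ diagGrading ϖ (d i)) :
    symmetrize ((cartanCalculus E M n).vinBase (of ϖ)) m d e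
      ∈ diagGrading ϖ (∑ i, (d i - 1) + 2) := by
  have hne : (Finset.univ : Finset (Fin m)).Nonempty := ⟨⟨0, hm⟩, Finset.mem_univ _⟩
  have hv := fun i => diagGrading_le _ (h i)
  have h1 := symmetrize_vinBase_mem (ϖ := ϖ) hm hv
  rw [diagGrading]
  split_ifs with h0
  · rw [h0] at h1
    refine ⟨h1.2, ?_⟩
    have he := isHomTuple_of_mem_vinGrading hv
    have hham := diff_generic_of_mem_diagGrading h
    rw [← onSubtuples_univ d (symmetrize _) e, onSubtuples_vinBase _ he _ hne]
    exact he.d_vinForm _ (of_mem_homogeneous ϖ) hϖ.d_of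
      ((cartanCalculus E M n).lieOp_constCoeff_of_hamiltonian hϖ.d_of hham) hham
      (show ∑ i, (d i - 1) = -2 by omega)
  · exact h1

/-- The structure on the local observables is Hamiltonian, and the bracket of the Hamiltonian vector
fields is its Hamiltonian vector field. -/
theorem IsNPlectic.hamPair_obsForm (hϖ : IsNPlectic ϖ) {m : ℕ}
    {d : Fin m → ℤ} {e : Fin m → VinSpace E M} (h : ∀ i, e i ∈ diagGrading ϖ (d i))
    (S : Finset (Fin m)) :
    hamPair ϖ (degSum d S + 2) ((cartanCalculus E M n).obsForm d e (of ϖ) S)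
      = ((cartanCalculus E M n).vecCurv d (fun i => (e i).1) S,
        (cartanCalculus E M n).obsForm d e (of ϖ) S)
    ∧ (cartanCalculus E M n).obsForm d e (of ϖ) S ∈ obsGrading ϖ (degSum d S + 2) := by
  have he := isHomTuple_of_mem_vinGrading fun i => diagGrading_le _ (h i)
  have hham := diff_generic_of_mem_diagGrading h
  have hmem : (cartanCalculus E M n).obsForm d e (of ϖ) S ∈ formGrading n (degSum d S + 2) := by
    refine mem_formGrading_of_homogeneous
      (((cartanCalculus E M n).mem_homSub d).mp
        (he.obsForm_mem_homSub _ (of_mem_homogeneous ϖ)) S) (by omega) fun h0 => ?_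
    exact he.obsForm_mem_degLE _ (of ϖ) S (by omega)
  rw [hamPair, obsGrading]
  split_ifs with h0
  · have h1 : IsHamiltonianPair ϖ ((cartanCalculus E M n).vecCurv d (fun i => (e i).1) S)
        ((cartanCalculus E M n).obsForm d e (of ϖ) S) :=
      he.d_obsForm _ (of_mem_homogeneous ϖ) hϖ.d_of
        ((cartanCalculus E M n).lieOp_constCoeff_of_hamiltonian hϖ.d_of hham) (by omega)
    rw [h0] at hmem
    exact ⟨by rw [hϖ.hamVecField_eq h1], hmem, _, h1⟩
  · exact ⟨by rw [vecCurv_apply_eq_zero _ he.vec (by omega)], hmem⟩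

theorem iSupIndep_vinGrading (n : ℕ) :
    iSupIndep (vinGrading n : ℤ → Submodule ℝ (VinSpace E M)) := by
  rw [iSupIndep_def]
  intro d
  rw [Submodule.disjoint_def]
  intro e he he'
  refine Prod.ext ?_ (funext fun q => ?_)
  · by_cases hd : d = 0
    · have h : ⨆ j, ⨆ (_ : j ≠ d), vinGrading n j
          ≤ LinearMap.ker (LinearMap.fst ℝ (VecField E M) (TotalForm E M)) :=
        iSup₂_le fun j hj e he => he.1 fun h0 => hj (h0.trans hd.symm)
      exact h he'
    · exact he.1 hd
  · by_cases hq : (q : ℤ) = n - 1 + d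
    · have h : ⨆ j, ⨆ (_ : j ≠ d), vinGrading n j
          ≤ LinearMap.ker (LinearMap.proj q ∘ₗ LinearMap.snd ℝ (VecField E M) (TotalForm E M)) :=
        iSup₂_le fun j hj e he => he.2 q (Or.inr fun h0 => hj (by omega))
      exact h he'
    · exact he.2 q (Or.inr hq)

theorem iSupIndep_formGrading (n : ℕ) :
    iSupIndep (formGrading n : ℤ → Submodule ℝ (TotalForm E M)) := by
  rw [iSupIndep_def]
  intro d
  rw [Submodule.disjoint_def]
  intro β hβ hβ'
  refine funext fun q => ?_
  by_cases hq : (q : ℤ) = n - 1 + d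
  · have h : ⨆ j, ⨆ (_ : j ≠ d), formGrading n j
        ≤ LinearMap.ker (LinearMap.proj q : TotalForm E M →ₗ[ℝ] DForm E M q) :=
      iSup₂_le fun j hj γ hγ => hγ q (Or.inr fun h0 => hj (by omega))
    exact h hβ'
  · exact hβ q (Or.inr hq)

theorem formGrading_eq_bot {d : ℤ} (hd : d < 1 - n ∨ 0 < d) :
    (formGrading n d : Submodule ℝ (TotalForm E M)) = ⊥ := by
  rw [eq_bot_iff]
  intro β hβ
  refine (Submodule.mem_bot ℝ).mpr (funext fun q => hβ q ?_)
  rcases hd with hd | hd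
  · exact Or.inr (by omega)
  · exact Or.inl hd

theorem vinGrading_eq_bot (hn : 1 ≤ n) {d : ℤ} (hd : d < 1 - n ∨ 0 < d) :
    (vinGrading n d : Submodule ℝ (VinSpace E M)) = ⊥ := by
  rw [eq_bot_iff]
  intro e he
  have h2 : e.2 ∈ (⊥ : Submodule ℝ (TotalForm E M)) := by
    rw [← formGrading_eq_bot hd]
    exact he.2
  exact (Submodule.mem_bot ℝ).mpr (Prod.ext (he.1 (by omega)) ((Submodule.mem_bot ℝ).mp h2))

theorem unshuffleSum_vinBase {m : ℕ} {d : Fin m → ℤ} {e : Fin m → VinSpace E M}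
    (hϖ : IsNPlectic ϖ) (h : ∀ i, e i ∈ vinGrading n (d i)) :
    unshuffleSum (codifferential (vinProduct ϖ)) (codifferential (vinProduct ϖ)) d e = 0 := by
  rw [codifferential_vinProduct, unshuffleSum_eq_insertSum]
  exact insertSum_vinBase _ (isHomTuple_of_mem_vinGrading h) (of_mem_homogeneous ϖ) hϖ.d_of

/-- The unshuffle sum over the products of observables, in terms of Hamiltonian pairs. -/
theorem unshuffleSum_obsProduct {W : Type*} [AddCommGroup W] [Module ℝ W] (hϖ : IsNPlectic ϖ)
    (F : GradedFamily (VinSpace E M) W) {m : ℕ} {d : Fin m → ℤ} {x : Fin m → TotalForm E M}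
    (h : ∀ i, x i ∈ obsGrading ϖ (d i)) :
    unshuffleSum (fun k d x => F k d fun i => hamPair ϖ (d i) (x i))
        (codifferential (obsProduct ϖ)) d x
      = insertSum d F 1 (fun S => ((cartanCalculus E M n).vecCurv d
          (fun i => (hamPair ϖ (d i) (x i)).1) S,
          (cartanCalculus E M n).obsForm d (fun i => hamPair ϖ (d i) (x i)) (of ϖ) S))
        (fun i => hamPair ϖ (d i) (x i)) := by
  rw [unshuffleSum_eq_insertSum]
  refine Finset.sum_congr rfl fun S hS => ?_
  congr 2
  have h1 : onSubtuples d (codifferential (obsProduct ϖ)) x S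
      = (cartanCalculus E M n).obsForm d (fun i => hamPair ϖ (d i) (x i)) (of ϖ) S := by
    rw [← onSubtuples_obsBase _ _ (Finset.mem_filter.mp hS).2, onSubtuples,
      codifferential_obsProduct]
    rfl
  have h2 := (hϖ.hamPair_obsForm (fun i => hamPair_mem (d i) (h i)) S).1
  beta_reduce
  rw [← h2, h1]
  have h3 : degSum d S + 1 + 1 = degSum d S + 2 := by ring
  rw [h3]
  congr 1
  funext i
  induction i using Fin.cases with
  | zero => rfl
  | succ i => rfl

theorem IsNPlectic.isLieNAlgebra_vin (hϖ : IsNPlectic ϖ) (hn : 1 ≤ n) :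
    IsLieNAlgebra n (vinGrading n) (codifferential (vinProduct ϖ)) where
  independent := iSupIndep_vinGrading n
  symmetric := by
    rw [codifferential_vinProduct]
    exact isGradedSymmetric_symmetrize (isMultilin_vinBase _ _) (fun _ e => e)
      (fun _ _ _ _ _ => rfl) (fun _ _ _ _ => rfl)
      fun k hk d e he => by
        rw [add_assoc]
        exact symmetrize_vinBase_mem hk he
  square_zero _ _ _ h := unshuffleSum_vinBase hϖ h
  concentrated _ hd := vinGrading_eq_bot hn hd

theorem IsNPlectic.isLieNAlgebra_obs (hϖ : IsNPlectic ϖ) :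
    IsLieNAlgebra n (obsGrading ϖ) (codifferential (obsProduct ϖ)) where
  independent := (iSupIndep_formGrading n).mono obsGrading_le
  symmetric := by
    have h : codifferential (obsProduct ϖ) = fun k d x =>
        symmetrize ((cartanCalculus E M n).obsBase (of ϖ)) k d fun i => hamPair ϖ (d i) (x i) := by
      funext k d x
      exact codifferential_obsProduct ϖ k d x
    rw [h]
    refine isGradedSymmetric_symmetrize (isMultilin_obsBase _ _) (hamPair ϖ)
      (fun d α hα β hβ => hϖ.hamPair_add d hα hβ) (fun d c α hα => hϖ.hamPair_smul d c hα)
      fun k hk d x hx => ?_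
    have hne : (Finset.univ : Finset (Fin k)).Nonempty := ⟨⟨0, hk⟩, Finset.mem_univ _⟩
    rw [← onSubtuples_univ d (symmetrize _) fun i => hamPair ϖ (d i) (x i),
      onSubtuples_obsBase _ _ hne, add_assoc]
    exact (hϖ.hamPair_obsForm (fun i => hamPair_mem (d i) (hx i)) Finset.univ).2
  square_zero m d x hx := by
    have h : codifferential (obsProduct ϖ) = fun k d x =>
        symmetrize ((cartanCalculus E M n).obsBase (of ϖ)) k d fun i => hamPair ϖ (d i) (x i) := by
      funext k d x
      exact codifferential_obsProduct ϖ k d x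
    have he := fun i => hamPair_mem (d i) (hx i)
    have hham := diff_generic_of_mem_diagGrading he
    have h2 := unshuffleSum_obsProduct hϖ
      (symmetrize ((cartanCalculus E M n).obsBase (of ϖ))) hx
    rw [← h] at h2
    rw [h2]
    exact insertSum_obsBase _ (isHomTuple_of_mem_vinGrading fun i => diagGrading_le _ (he i))
      (of_mem_homogeneous ϖ) hϖ.d_of
      ((cartanCalculus E M n).lieOp_constCoeff_of_hamiltonian hϖ.d_of hham)
  concentrated d hd := eq_bot_iff.mpr ((obsGrading_le d).trans (formGrading_eq_bot hd).le)

theorem IsNPlectic.isSubLInfinityAlgebra_diag (hϖ : IsNPlectic ϖ) :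
    IsSubLInfinityAlgebra (diagGrading ϖ) (vinGrading n) (codifferential (vinProduct ϖ)) where
  le := diagGrading_le
  closed k hk d e he := by
    rw [codifferential_vinProduct]
    exact hϖ.symmetrize_vinBase_mem_diagGrading hk he

theorem IsNPlectic.isLieNAlgebra_diag (hϖ : IsNPlectic ϖ) (hn : 1 ≤ n) :
    IsLieNAlgebra n (diagGrading ϖ) (codifferential (vinProduct ϖ)) where
  independent := (iSupIndep_vinGrading n).mono diagGrading_le
  symmetric := by
    rw [codifferential_vinProduct]
    exact isGradedSymmetric_symmetrize (isMultilin_vinBase _ _) (fun _ e => e)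
      (fun _ _ _ _ _ => rfl) (fun _ _ _ _ => rfl)
      fun k hk d e he => by
        rw [add_assoc]
        exact hϖ.symmetrize_vinBase_mem_diagGrading hk he
  square_zero _ _ _ h := unshuffleSum_vinBase hϖ fun i => diagGrading_le _ (h i)
  concentrated d hd := eq_bot_iff.mpr ((diagGrading_le d).trans (vinGrading_eq_bot hn hd).le)

/-- The components of the morphism from the local observables to the diagonal sections: the
Hamiltonian pairs of the arguments are inserted into `morBase`. -/
def obsMorphism (ϖ : DForm E M (n + 1)) : GradedFamily (TotalForm E M) (VinSpace E M) :=
  fun k d x => symmetrize (cartanCalculus E M n).morBase k d fun i => hamPair ϖ (d i) (x i)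

theorem obsMorphism_one (d : ℤ) (α : TotalForm E M) :
    obsMorphism ϖ 1 (fun _ => d) (fun _ => α) = hamPair ϖ d α := by
  simp [obsMorphism, symmetrize, morBase, koszulSign]

/-- The components of the morphism take values in diagonal sections of the right degree. Those with
at least two arguments have negative degree, where no Hamiltonian condition is imposed. -/
theorem obsMorphism_mem {m : ℕ} (hm : 1 ≤ m) {d : Fin m → ℤ} {e : Fin m → VinSpace E M}
    (h : ∀ i, e i ∈ diagGrading ϖ (d i)) :
    symmetrize (cartanCalculus E M n).morBase m d e ∈ diagGrading ϖ (∑ i, (d i - 1) + 1) := by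
  have hne : (Finset.univ : Finset (Fin m)).Nonempty := ⟨⟨0, hm⟩, Finset.mem_univ _⟩
  have he := isHomTuple_of_mem_vinGrading fun i => diagGrading_le _ (h i)
  by_cases h1 : m = 1
  · subst h1
    have h2 : symmetrize (cartanCalculus E M n).morBase 1 d e = e 0 := by
      simp [symmetrize, morBase, koszulSign]
    rw [h2]
    simpa using h 0
  by_cases hd : ∃ i, 0 < d i
  · obtain ⟨i, hi⟩ := hd
    have h2 : e i = 0 := Prod.ext (he.vec i hi.ne') (he.nonpos i hi)
    rw [(IsMultilin.symmetrize (isMultilin_morBase _) m d).map_zero h2]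
    exact zero_mem _
  push Not at hd
  have hsum : ∑ i, (d i - 1) ≤ -2 := by
    have h2 : ∑ i, (d i - 1) ≤ ∑ _i : Fin m, (-1 : ℤ) :=
      Finset.sum_le_sum fun i _ => by have := hd i; omega
    have h3 : ∑ _i : Fin m, (-1 : ℤ) = -m := by simp
    omega
  rw [diagGrading, if_neg (by omega), ← onSubtuples_univ d (symmetrize _) e]
  refine ⟨fun _ => onSubtuples_morBase_fst _ (by simpa using h1), ?_⟩
  rw [onSubtuples_morBase_snd _ hne]
  exact mem_formGrading_of_homogeneous (((cartanCalculus E M n).mem_homSub d).mp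
    (he.morForm_mem_homSub _) Finset.univ)
    (show ∑ i, (d i - 1) + 0 + 1 = _ by omega) fun h0 => by omega

theorem IsNPlectic.isLInfinityIso_obsMorphism (hϖ : IsNPlectic ϖ) :
    IsLInfinityIso (obsGrading ϖ) (codifferential (obsProduct ϖ))
      (diagGrading ϖ) (codifferential (vinProduct ϖ)) (obsMorphism ϖ) where
  symmetric := isGradedSymmetric_symmetrize (isMultilin_morBase _) (hamPair ϖ)
    (fun d α hα β hβ => hϖ.hamPair_add d hα hβ) (fun d c α hα => hϖ.hamPair_smul d c hα)
    fun k hk d x hx => by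
      rw [add_zero]
      exact obsMorphism_mem hk fun i => hamPair_mem (d i) (hx i)
  comm m hm d x hx := by
    have he := fun i => hamPair_mem (d i) (hx i)
    rw [codifferential_vinProduct]
    exact (unshuffleSum_obsProduct hϖ _ hx).trans (insertSum_morBase _
      (isHomTuple_of_mem_vinGrading fun i => diagGrading_le _ (he i)) hm
      (diff_generic_of_mem_diagGrading he))
  bijective d := by
    simp only [obsMorphism_one]
    refine ⟨fun α hα => hamPair_mem d hα, fun α _ β _ h => congrArg Prod.snd h, ?_⟩
    rintro e he
    refine ⟨e.2, ?_, ?_⟩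
    · rw [SetLike.mem_coe, diagGrading] at he
      rw [SetLike.mem_coe, obsGrading]
      split_ifs at he ⊢ with hd
      · exact ⟨he.1, e.1, he.2⟩
      · exact he.2
    · rw [SetLike.mem_coe, diagGrading] at he
      refine Prod.ext ?_ rfl
      change (if d = 0 then hamVecField ϖ e.2 else 0) = e.1
      split_ifs at he ⊢ with hd
      · exact hϖ.hamVecField_eq he.2
      · exact (he.1 hd).symm

end Theorem
end

theorem mainTheorem1
    {E : Type*} [NormedAddCommGroup E] [NormedSpace ℝ E] [FiniteDimensional ℝ E]
    {M : Type*} [TopologicalSpace M] [T2Space M] [SecondCountableTopology M]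
    [ChartedSpace E M] [IsManifold 𝓘(ℝ, E) ∞ M]
    (n : ℕ) (hn : 1 ≤ n) (ϖ : DForm E M (n + 1)) (hϖ : IsNPlectic ϖ) :
    IsLieNAlgebra n (vinGrading n) (codifferential (vinProduct ϖ)) ∧
    IsLieNAlgebra n (obsGrading ϖ) (codifferential (obsProduct ϖ)) ∧
    IsLieNAlgebra n (diagGrading ϖ) (codifferential (vinProduct ϖ)) ∧
    IsSubLInfinityAlgebra (diagGrading ϖ) (vinGrading n) (codifferential (vinProduct ϖ)) ∧
    ∃ Ψ : GradedFamily (TotalForm E M) (VinSpace E M),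
      IsLInfinityIso (obsGrading ϖ) (codifferential (obsProduct ϖ))
        (diagGrading ϖ) (codifferential (vinProduct ϖ)) Ψ ∧
      (∀ α ∈ hamForms ϖ, Ψ 1 (fun _ => 0) (fun _ => α) = (hamVecField ϖ α, α)) ∧
      (∀ d : ℤ, d < 0 → ∀ β ∈ formGrading n d, Ψ 1 (fun _ => d) (fun _ => β) = (0, β)) := by
  refine ⟨hϖ.isLieNAlgebra_vin hn, hϖ.isLieNAlgebra_obs, hϖ.isLieNAlgebra_diag hn,
    hϖ.isSubLInfinityAlgebra_diag, obsMorphism ϖ, hϖ.isLInfinityIso_obsMorphism, ?_, ?_⟩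
  · intro α _
    rw [obsMorphism_one, hamPair, if_pos rfl]
  · intro d hd β _
    rw [obsMorphism_one, hamPair, if_neg hd.ne]
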